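/- **Setting.** Let $d\in\{2,3\}$, $k,q\ge 1$. Let $\mathcal T_h$ be an admissible (face-to-face) simplicial triangulation of a polygonal background domain $\widetilde\Omega\subset\mathbb R^d$, quasi-uniform with mesh size $h$: each element has diameter at most $h$ and contains a ball of radius $\rho h$, with a fixed $\rho>0$. Let $\mathcal V_h^{(p)}$ be the continuous functions on $\widetilde\Omega$ that are polynomials of degree at most $p$ on each element, $\mathcal V_h:=\mathcal V_h^{(k)}$. Let $t_n=n\Delta t$, $\Delta t=\mathbf T/N$, $n=0,\dots,N$. For each $n$ let $\phi_h^n\in\mathcal V_h^{(q)}$ be the discrete level set function, $\hat\phi_h^n$ its piecewise linear nodal interpolant, and let the mesh deformation $\Theta^n\in[\mathcal V_h^{(q)}]^d$ be a bijection of $\widetilde\Omega$ that fixes all vertices, is the identity outside the cut elements (those met by $\{\hat\phi_h^n=0\}$) and their neighbours (elements sharing a vertex with them), and satisfies $\|\Theta^n-\mathrm{id}\|_\infty\le C h^2$, with $C$ fixed. Let $W$ bound the speed of the level sets, $|\phi_h^{n+1}(x_V)-\phi_h^{n}(x_V)|\le W\,\Delta t$ for all mesh vertices $x_V$ and $0\le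 n<N$, and let $\delta>0$ with $\delta\ge W\,\Delta t$. (For vertex-exact approximations of signed distance functions of a domain moving with velocity $\mathbf w$ one can take $W=\|\mathbf w\|_{L^\infty}$.) *Deformed spaces and element sets.* $\mathcal T_h^n=\Theta^n(\mathcal T_h)$, $\mathcal V_h^n=\mathcal V_h\circ(\Theta^n)^{-1}$. Let $\mathcal T^{n}_{r}$ consist of the elements of $\mathcal T_h^n$ that meet $\Theta^n(\{\hat\phi_h^n<r\delta\})$ in positive measure, enlarged $r$ times by all neighbouring elements; let $\mathcal T^{n,\mathcal S}_{r}$ be defined likewise with the strip $\Theta^n(\{-r\delta\le\hat\phi_h^n<r\delta\})$, and let $\mathcal O^{n,\mathcal S}_{r}$ be the union of the closed elements of $\mathcal T^{n,\mathcal S}_{r}$. Let $\mathcal F^n_r$ be the set of common facets of distinct elements $T_1\in\mathcal T^n_r$ and $T_2\in\mathcal T^{n,\mathcal S}_r$. *Extension and ghost penalty.* For $T=\Theta^n(\hat T)$ and $v\in\mathcal V_h^n$ let $v_T^{*}=\mathcal E(v\circ\Theta^n|_{\hat T})\circ(\mathcal E\,\Theta^n|_{\hat T})^{-1}$, where $\mathcal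 E$ is the canonical extension of a polynomial to $\mathbb R^d$ and the inverse is taken in the $2h$-neighbourhood of $\hat T$. Set $$s^n_r(u,v)=\sum_{F\in\mathcal F^n_r}\frac1{h^2}\int_{T_1\cup T_2}(u_{T_1}^*-u_{T_2}^*)(v_{T_1}^*-v_{T_2}^*)\,dx,$$ $T_1,T_2\in\mathcal T_h^n$ being the two elements that share $F$. *Transfer operator.* Let $m=n-1$. The operator $\Pi^n:\mathcal V_h^{m}\to\mathcal V_h^n$ is defined as follows: for $v\in\mathcal V_h^m$ and each $\hat T\in\mathcal T_h$, let $\hat p_{\hat T}$ be the polynomial of degree at most $k$ with $\hat p_{\hat T}(\hat x_i)=v^*_{\Theta^m(\hat T)}(\Theta^n(\hat x_i))$ at the Lagrange nodes $\hat x_i$ of order $k$ of $\hat T$; then $\Pi^n v\in\mathcal V_h^n$ is the function whose value at $\Theta^n(\hat x_i)$, for each Lagrange node $\hat x_i$ of $\mathcal V_h$, is the average of $\hat p_{\hat T}(\hat x_i)$ over all elements $\hat T$ containing $\hat x_i$. **Claim.** There are constants $h_0,c_a,c_b>0$, depending only on $d,k,q,\rho,C$ (in particular not on $h$, $\Delta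 t$, $n$, $\delta$), such that for $h\le h_0$, all $1\le n\le N$ and all $v_h\in\mathcal V_h^{n-1}$, $$s_1^n(\Pi^nv_h,\Pi^nv_h)\;\le\;c_a\,s_2^{n-1}(v_h,v_h)+c_b\,h^2\,\|\nabla v_h\|^2_{L^2(\mathcal O_2^{n-1,\mathcal S})}.$$ -/

import Mathlib

noncomputable section

namespace EvolvingFEM

/-! ### Background mesh and finite element spaces -/

/-- Euclidean space `ℝᵈ`. -/
abbrev Space (d : ℕ) := EuclideanSpace ℝ (Fin d)

/-- An admissible (face-to-face) simplicial triangulation: a finite geometric simplicial complex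
in `ℝᵈ`, each simplex of which is a face of a `d`-dimensional one. -/
structure Triangulation (d : ℕ) where
  complex : Geometry.SimplicialComplex ℝ (Space d)
  finite : complex.faces.Finite
  pure : ∀ s ∈ complex.faces, ∃ T ∈ complex.faces, s ⊆ T ∧ T.card = d + 1

/-- The closed simplex with vertex set `T`. -/
def simplex {d : ℕ} (T : Finset (Space d)) : Set (Space d) :=
  convexHull ℝ (T : Set (Space d))

namespace Triangulation

variable {d : ℕ} (M : Triangulation d)

open Classical in
/-- The elements of the mesh, given by their vertex sets. -/
def elements : Finset (Finset (Space d)) :=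
  M.finite.toFinset.filter fun T => T.card = d + 1

/-- The (closed) background domain covered by the mesh. -/
def domain : Set (Space d) := M.complex.space

/-- Quasi-uniformity with mesh size `h` and regularity constant `ρ`: every element has diameter at
most `h` and contains a ball of radius `ρ h`. -/
structure QuasiUniform (ρ h : ℝ) : Prop where
  pos : 0 < h
  diam_le : ∀ T ∈ M.elements, Metric.diam (simplex T) ≤ h
  ball_subset : ∀ T ∈ M.elements, ∃ c, Metric.closedBall c (ρ * h) ⊆ simplex T

end Triangulation

/-- `p` is a polynomial of degree at most `k` that agrees with `f` on `S`. -/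
def IsPolyOn {d : ℕ} (k : ℕ) (S : Set (Space d)) (f : Space d → ℝ)
    (p : MvPolynomial (Fin d) ℝ) : Prop :=
  p.totalDegree ≤ k ∧ ∀ x ∈ S, MvPolynomial.eval (fun i => x i) p = f x

/-- The polynomial of degree at most `k` on the whole of `ℝᵈ` that agrees with `f` on `S`
(used only for sets `S` on which polynomials of degree at most `k` are determined by their
values). With `S` an element and `f` polynomial there, this is the canonical polynomial
extension; with `S` the set of Lagrange nodes of an element, it is the Lagrange interpolant. -/
def polyExt {d : ℕ} (k : ℕ) (S : Set (Space d)) (f : Space d → ℝ) : Space d → ℝ := fun x =>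
  MvPolynomial.eval (fun i => x i) (Classical.epsilon (IsPolyOn k S f))

/-- The set of Lagrange nodes of order `k` of the simplex with vertex set `T`: the points with
barycentric coordinates in `{0, 1/k, …, 1}`. -/
def lagrangeNodes {d : ℕ} (k : ℕ) (T : Finset (Space d)) : Set (Space d) :=
  {x | ∃ α : Space d → ℕ, ∑ V ∈ T, α V = k ∧ x = ∑ V ∈ T, ((α V : ℝ) / (k : ℝ)) • V}

namespace Triangulation

variable {d : ℕ} (M : Triangulation d)

/-- The continuous finite element space of order `k` on the undeformed mesh (only the values on
the background domain matter). -/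
def feSpace (k : ℕ) : Set (Space d → ℝ) :=
  {v | ContinuousOn v M.domain ∧ ∀ T ∈ M.elements, ∃ p, IsPolyOn k (simplex T) v p}

open Classical in
/-- The finite element function of order `k` with nodal values `g`, that is `∑ᵢ g(xᵢ) φᵢ` with
the Lagrange basis `φᵢ` of the finite element space. On a common face of two elements both local
interpolants coincide, so that the selected element does not matter. -/
def interpolate (k : ℕ) (g : Space d → ℝ) : Space d → ℝ := fun x =>
  if hx : ∃ T ∈ M.elements, x ∈ simplex T then polyExt k (lagrangeNodes k hx.choose) g x else 0

/-- The finite element space on the mesh deformed by `Θ`: functions `v` on the background domain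
such that `v ∘ Θ` is a finite element function of order `k` on the undeformed mesh. -/
def mappedSpace (k : ℕ) (Θ : Space d → Space d) : Set (Space d → ℝ) :=
  {v | v ∘ Θ ∈ M.feSpace k}

open Classical in
/-- A set of elements together with all neighbours, i.e. elements sharing a vertex with it. -/
def addLayer (S : Finset (Finset (Space d))) : Finset (Finset (Space d)) :=
  M.elements.filter fun T => ∃ T' ∈ S, ∃ V, V ∈ T ∧ V ∈ T'

/-! ### Discrete geometry at one time level

Here `φ` is the discrete level set function and `Θ` the mesh deformation of the time level. The
deformed elements `Θ '' simplex T` are represented by the undeformed elements `T`. -/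

/-- The piecewise linear interpolant of the discrete level set function. -/
def linLevelSet (φ : Space d → ℝ) : Space d → ℝ := M.interpolate 1 φ

/-- The undeformed domain `{φ̂ < c}`. -/
def linSublevel (φ : Space d → ℝ) (c : ℝ) : Set (Space d) :=
  {x ∈ M.domain | M.linLevelSet φ x < c}

/-- The discrete domain extended by `δ`: the image under `Θ` of `{φ̂ - δ < 0}`. -/
def extendedDomain (φ : Space d → ℝ) (Θ : Space d → Space d) (δ : ℝ) : Set (Space d) :=
  Θ '' M.linSublevel φ δ

/-- The discrete `δ`-strip: the image under `Θ` of `{φ̂ - δ < 0} \ {φ̂ + δ < 0}`. -/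
def strip (φ : Space d → ℝ) (Θ : Space d → Space d) (δ : ℝ) : Set (Space d) :=
  Θ '' (M.linSublevel φ δ \ M.linSublevel φ (-δ))

open Classical in
/-- Elements whose deformed version meets the extended domain in a set of positive measure. -/
def activeElements (φ : Space d → ℝ) (Θ : Space d → Space d) (δ : ℝ) :
    Finset (Finset (Space d)) :=
  M.elements.filter fun T =>
    0 < MeasureTheory.volume (Θ '' simplex T ∩ M.extendedDomain φ Θ δ)

open Classical in
/-- Elements whose deformed version meets the `δ`-strip in a set of positive measure. -/
def stripElements (φ : Space d → ℝ) (Θ : Space d → Space d) (δ : ℝ) :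
    Finset (Finset (Space d)) :=
  M.elements.filter fun T =>
    0 < MeasureTheory.volume (Θ '' simplex T ∩ M.strip φ Θ δ)

open Classical in
/-- The cut elements: those that are met by the zero level of `φ̂`. -/
def cutElements (φ : Space d → ℝ) : Finset (Finset (Space d)) :=
  M.elements.filter fun T => ∃ x ∈ simplex T, M.linLevelSet φ x = 0

/-- Active elements for the extension by `r δ` plus `r` element layers. -/
def activeLayered (φ : Space d → ℝ) (Θ : Space d → Space d) (δ : ℝ) (r : ℕ) :
    Finset (Finset (Space d)) :=
  M.addLayer^[r] (M.activeElements φ Θ (r * δ))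

/-- Elements of the `r δ`-strip plus `r` element layers. -/
def stripLayered (φ : Space d → ℝ) (Θ : Space d → Space d) (δ : ℝ) (r : ℕ) :
    Finset (Finset (Space d)) :=
  M.addLayer^[r] (M.stripElements φ Θ (r * δ))

/-- The domain covered by the deformed elements of the `r δ`-strip plus `r` element layers. -/
def stripRegion (φ : Space d → ℝ) (Θ : Space d → Space d) (δ : ℝ) (r : ℕ) : Set (Space d) :=
  ⋃ T ∈ M.stripLayered φ Θ δ r, Θ '' simplex T

open Classical in
/-- The active facets, each represented by the unordered pair of the two elements it separates;
two distinct elements have a common facet if they share exactly `d` vertices. -/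
def activeFacets (φ : Space d → ℝ) (Θ : Space d → Space d) (δ : ℝ) (r : ℕ) :
    Finset (Sym2 (Finset (Space d))) :=
  ((M.activeLayered φ Θ δ r ×ˢ M.stripLayered φ Θ δ r).filter fun P =>
    P.1 ≠ P.2 ∧ (P.1 ∩ P.2).card = d).image fun P => s(P.1, P.2)

/-- `Θ` is an isoparametric mesh deformation of order `q` belonging to the level set function `φ`:
a bijection of the background domain that is a vector-valued finite element function of order
`q`, fixes all vertices, is the identity away from the cut elements and their neighbours, and
differs from the identity by at most `C h ^ 2`. -/
structure IsDeformation (q : ℕ) (C h : ℝ) (φ : Space d → ℝ) (Θ : Space d → Space d) :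
    Prop where
  bijOn : Set.BijOn Θ M.domain M.domain
  mem_feSpace : ∀ i, (fun x => Θ x i) ∈ M.feSpace q
  vertex_fixed : ∀ T ∈ M.elements, ∀ V ∈ T, Θ V = V
  eq_self_of_far : ∀ x ∈ M.domain,
    (∀ T ∈ M.addLayer (M.cutElements φ), x ∉ simplex T) → Θ x = x
  near_id : ∀ x ∈ M.domain, ‖Θ x - x‖ ≤ C * h ^ 2

end Triangulation

/-! ### Extension of mapped polynomials and ghost penalty -/

/-- Polynomial extension of the element map `Θ|_T` to `ℝᵈ`. -/
def mapExt {d : ℕ} (q : ℕ) (Θ : Space d → Space d) (T : Finset (Space d)) :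
    Space d → Space d := fun x =>
  WithLp.toLp 2 fun i => polyExt q (simplex T) (fun y => Θ y i) x

/-- Inverse of the extended element map. As a polynomial map need not be injective on `ℝᵈ`, the
inverse is taken on the `2h`-neighbourhood of the element. -/
def mapExtInv {d : ℕ} (q : ℕ) (h : ℝ) (Θ : Space d → Space d) (T : Finset (Space d)) :
    Space d → Space d :=
  Function.invFunOn (mapExt q Θ T) (Metric.cthickening (2 * h) (simplex T))

/-- Canonical extension of the mapped polynomial `v|_{Θ(T)}` beyond the deformed element: the
polynomial extension of `v ∘ Θ|_T` composed with the inverse of the extended element map. -/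
def mappedExt {d : ℕ} (k q : ℕ) (h : ℝ) (Θ : Space d → Space d) (T : Finset (Space d))
    (v : Space d → ℝ) : Space d → ℝ := fun x =>
  polyExt k (simplex T) (v ∘ Θ) (mapExtInv q h Θ T x)

/-- Contribution to the ghost penalty of the facet separating two elements. -/
def facetPenalty {d : ℕ} (k q : ℕ) (h : ℝ) (Θ : Space d → Space d) (u v : Space d → ℝ) :
    Sym2 (Finset (Space d)) → ℝ :=
  Sym2.lift ⟨fun T₁ T₂ => 1 / h ^ 2 * ∫ x in Θ '' simplex T₁ ∪ Θ '' simplex T₂,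
      (mappedExt k q h Θ T₁ u x - mappedExt k q h Θ T₂ u x) *
        (mappedExt k q h Θ T₁ v x - mappedExt k q h Θ T₂ v x), by
    intro T₁ T₂
    dsimp only
    rw [Set.union_comm]
    congr 2
    funext x
    ring⟩

namespace Triangulation

variable {d : ℕ} (M : Triangulation d)

/-- The ghost penalty (direct version) `s_r(u, v)` at the time level with level set function `φ`
and mesh deformation `Θ`. -/
def ghostPenalty (k q : ℕ) (h : ℝ) (φ : Space d → ℝ) (Θ : Space d → Space d) (δ : ℝ) (r : ℕ)
    (u v : Space d → ℝ) : ℝ :=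
  ∑ F ∈ M.activeFacets φ Θ δ r, facetPenalty k q h Θ u v F

/-! ### Transfer operator -/

/-- Element-local shifted evaluation: the polynomial on the undeformed element `T` interpolating,
at the Lagrange nodes, the extension of `v|_{Θm(T)}` evaluated at the nodes mapped by `Θn`. -/
def localTransfer (k q : ℕ) (h : ℝ) (Θm Θn : Space d → Space d) (v : Space d → ℝ)
    (T : Finset (Space d)) : Space d → ℝ :=
  polyExt k (lagrangeNodes k T) fun x => mappedExt k q h Θm T v (Θn x)

open Classical in
/-- Oswald averaging: mean at `x` of the element-wise functions `w T` over the elements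
containing `x`. -/
def oswaldMean (w : Finset (Space d) → Space d → ℝ) (x : Space d) : ℝ :=
  (((M.elements.filter fun T => x ∈ simplex T).card : ℝ))⁻¹ *
    ∑ T ∈ M.elements.filter (fun T => x ∈ simplex T), w T x

/-- The transfer operator from the mesh deformed by `Θm` to the mesh deformed by `Θn`: element-wise
shifted evaluation, then Oswald interpolation into the continuous space on the new mesh. -/
def transfer (k q : ℕ) (h : ℝ) (Θm Θn : Space d → Space d) (v : Space d → ℝ) : Space d → ℝ :=
  fun x => M.interpolate k (M.oswaldMean (localTransfer k q h Θm Θn v))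
    (Function.invFunOn Θn M.domain x)

end Triangulation

end EvolvingFEM

end

noncomputable section

namespace EvolvingFEM

open MeasureTheory Metric

/-! On an undeformed element `T` let `P_T` be the polynomial of `v ∘ Θ^m` and `u_T` that of `Π v ∘
Θ^n`. Both ghost penalties are essentially `h⁻²` times the squared `L²` norm of a jump of such
polynomials across a facet, and the claim follows once `u_T - P_T` is of size `h²` times the
gradient.

A deformation is `id + O(h²)` and piecewise polynomial, so inverse estimates make each extended
element map a perturbation of the identity with small Lipschitz constant on a ball of radius `3h`
(`exists_localMap`). Its inverse moves points by at most `ε = K h²`, so the mapped extension differs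
from `P_T` by at most `g ε`, where `g` bounds the gradient (`LocalMap.abs_mappedExt_sub_le`). For
the same reason shifted evaluation changes a nodal value by at most `2 g ε`. Averaging does no harm:
by continuity the `P_S` of all elements `S` containing a node agree there. Lagrange stability
carries the nodal bound to `u_T - P_T` and to the gradient of `u_T` (`exists_transfer_close`).

Squaring, integrating over a patch of volume `h^d` and dividing by `h²` turns the error `g h²` into
`h² (h^d g²)`, and `h^d g²` is bounded by the squared norm of the gradient of `v` on the patch
(`exists_facetPenalty_le`, `exists_gradMean_le`). Here the gradient of `P_T` must be exchanged for
that of `v` on the deformed element; the error is absorbed for small `h`.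

The location of the patch is delicate. The level set moves by at most `δ` per step, so the active
facets with `r = 1` at the new time are among those with `r = 2` at the old one
(`activeFacets_subset`), and all neighbours of an element of the new strip lie in the old one
(`addLayer_stripLayered_subset`). In a facet pair `(T₁, T₂)` only `T₂` need belong to the strip, and
elements around the vertex of `T₁` opposite the facet may lie outside the old strip region. That
vertex is fixed by both deformations, so the transfer is exact there; every other node of `T₁` lies
only in elements sharing a vertex with `T₂` (`abs_oswaldMean_localTransfer_sub_le`). Summation over
facets uses that an element is close to a bounded number of pairs (`card_nearPairs_le`,
`sum_facets_le`). -/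

/-! ### Polynomials on Euclidean space -/

/-- Evaluation of a polynomial at a point of Euclidean space. -/
def evalAt {d : ℕ} (p : MvPolynomial (Fin d) ℝ) (x : Space d) : ℝ :=
  MvPolynomial.eval (fun i => x i) p

section Basic

variable {d : ℕ}

@[simp] lemma evalAt_add (p q : MvPolynomial (Fin d) ℝ) (x : Space d) :
    evalAt (p + q) x = evalAt p x + evalAt q x := by simp [evalAt]

@[simp] lemma evalAt_sub (p q : MvPolynomial (Fin d) ℝ) (x : Space d) :
    evalAt (p - q) x = evalAt p x - evalAt q x := by simp [evalAt]

@[simp] lemma evalAt_mul (p q : MvPolynomial (Fin d) ℝ) (x : Space d) :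
    evalAt (p * q) x = evalAt p x * evalAt q x := by simp [evalAt]

@[simp] lemma evalAt_C (a : ℝ) (x : Space d) : evalAt (MvPolynomial.C a) x = a := by
  simp [evalAt]

@[simp] lemma evalAt_X (i : Fin d) (x : Space d) : evalAt (MvPolynomial.X i) x = x i := by
  simp [evalAt]

@[simp] lemma evalAt_zero (x : Space d) : evalAt (0 : MvPolynomial (Fin d) ℝ) x = 0 := by
  simp [evalAt]

@[simp] lemma evalAt_one (x : Space d) : evalAt (1 : MvPolynomial (Fin d) ℝ) x = 1 := by
  simp [evalAt]

lemma evalAt_smul (a : ℝ) (p : MvPolynomial (Fin d) ℝ) (x : Space d) :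
    evalAt (a • p) x = a * evalAt p x := by simp [evalAt, MvPolynomial.smul_eval]

lemma evalAt_sum {ι : Type*} (s : Finset ι) (f : ι → MvPolynomial (Fin d) ℝ) (x : Space d) :
    evalAt (∑ i ∈ s, f i) x = ∑ i ∈ s, evalAt (f i) x := by simp [evalAt]

lemma evalAt_prod {ι : Type*} (s : Finset ι) (f : ι → MvPolynomial (Fin d) ℝ) (x : Space d) :
    evalAt (∏ i ∈ s, f i) x = ∏ i ∈ s, evalAt (f i) x := by
  simp [evalAt, map_prod]

/-- The derivative of a polynomial function in terms of the formal partial derivatives. -/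
def evalGrad (p : MvPolynomial (Fin d) ℝ) (x : Space d) : Space d →L[ℝ] ℝ :=
  ∑ i, evalAt (MvPolynomial.pderiv i p) x • (EuclideanSpace.proj i : Space d →L[ℝ] ℝ)

lemma hasFDerivAt_evalAt (p : MvPolynomial (Fin d) ℝ) (x : Space d) :
    HasFDerivAt (evalAt p) (evalGrad p x) x := by
  induction p using MvPolynomial.induction_on with
  | C a =>
    have : evalAt (MvPolynomial.C a : MvPolynomial (Fin d) ℝ) = fun _ => a := by
      funext y; simp
    rw [this]
    refine (hasFDerivAt_const a x).congr_fderiv ?_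
    simp [evalGrad]
  | add p q hp hq =>
    have : evalAt (p + q) = fun y => evalAt p y + evalAt q y := by funext y; simp
    rw [this]
    refine (hp.add hq).congr_fderiv ?_
    simp [evalGrad, add_smul, Finset.sum_add_distrib]
  | mul_X p j hp =>
    have : evalAt (p * MvPolynomial.X j) = fun y => evalAt p y * y j := by funext y; simp
    rw [this]
    have hj : HasFDerivAt (fun y : Space d => y j) (EuclideanSpace.proj j : Space d →L[ℝ] ℝ) x :=
      (EuclideanSpace.proj j : Space d →L[ℝ] ℝ).hasFDerivAt
    refine (hp.mul hj).congr_fderiv ?_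
    simp only [evalGrad, Derivation.leibniz, MvPolynomial.pderiv_X, smul_eq_mul, evalAt_add,
      evalAt_mul, evalAt_X, add_smul, Finset.sum_add_distrib, Finset.smul_sum, smul_smul]
    congr 1
    rw [Finset.sum_eq_single j]
    · simp
    · intro i _ hij
      simp [hij.symm]
    · simp

lemma contDiff_evalAt (p : MvPolynomial (Fin d) ℝ) : ContDiff ℝ ⊤ (evalAt p) := by
  induction p using MvPolynomial.induction_on with
  | C a =>
    have : evalAt (MvPolynomial.C a : MvPolynomial (Fin d) ℝ) = fun _ => a := by
      funext y; simp
    rw [this]; exact contDiff_const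
  | add p q hp hq =>
    have : evalAt (p + q) = fun y => evalAt p y + evalAt q y := by funext y; simp
    rw [this]; exact hp.add hq
  | mul_X p j hp =>
    have : evalAt (p * MvPolynomial.X j) = fun y => evalAt p y * y j := by funext y; simp
    rw [this]
    exact hp.mul (EuclideanSpace.proj j : Space d →L[ℝ] ℝ).contDiff

lemma continuous_evalAt (p : MvPolynomial (Fin d) ℝ) : Continuous (evalAt p) :=
  (contDiff_evalAt p).continuous

lemma norm_evalGrad_le (p : MvPolynomial (Fin d) ℝ) (x : Space d) :
    ‖evalGrad p x‖ ≤ ∑ i, |evalAt (MvPolynomial.pderiv i p) x| := by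
  refine (norm_sum_le _ _).trans (Finset.sum_le_sum fun i _ => ?_)
  rw [norm_smul, Real.norm_eq_abs]
  refine mul_le_of_le_one_right (abs_nonneg _) ?_
  refine ContinuousLinearMap.opNorm_le_bound _ zero_le_one fun y => ?_
  rw [one_mul]
  exact PiLp.norm_apply_le y i

lemma abs_evalAt_pderiv_le (p : MvPolynomial (Fin d) ℝ) (x : Space d) (i : Fin d) :
    |evalAt (MvPolynomial.pderiv i p) x| ≤ ‖evalGrad p x‖ := by
  have h := (evalGrad p x).le_opNorm (EuclideanSpace.single i 1)
  simpa [evalGrad, PiLp.single_apply] using h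

lemma totalDegree_pderiv_le (p : MvPolynomial (Fin d) ℝ) (i : Fin d) :
    (MvPolynomial.pderiv i p).totalDegree ≤ p.totalDegree := by
  conv_lhs => rw [← MvPolynomial.support_sum_monomial_coeff p]
  rw [map_sum]
  refine MvPolynomial.totalDegree_finsetSum_le fun s hs => ?_
  rw [MvPolynomial.pderiv_monomial]
  refine (MvPolynomial.totalDegree_monomial_le _ _).trans
    (le_trans ?_ (MvPolynomial.le_totalDegree hs))
  rw [Finsupp.sum_fintype _ _ (fun _ => rfl), Finsupp.sum_fintype _ _ (fun _ => rfl)]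
  exact Finset.sum_le_sum fun j _ => by simp

/-- A polynomial that vanishes near a point is zero. -/
lemma eq_zero_of_evalAt_eq_zero_on_ball {p : MvPolynomial (Fin d) ℝ} {c : Space d} {r : ℝ}
    (hr : 0 < r) (h : ∀ x ∈ ball c r, evalAt p x = 0) : p = 0 := by
  have hc : Continuous fun y : Fin d → ℝ => (WithLp.toLp 2 y : Space d) :=
    PiLp.continuous_toLp 2 _
  have ho : IsOpen {y : Fin d → ℝ | (WithLp.toLp 2 y : Space d) ∈ ball c r} :=
    isOpen_ball.preimage hc
  obtain ⟨ε, hε, hs⟩ := Metric.isOpen_iff.1 ho (fun i => c i) (by simpa using hr)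
  -- The ball contains a box, a product of infinite sets, and a polynomial vanishing on such a
  -- product is zero.
  refine MvPolynomial.funext_set (fun i => ball (c i) ε) (fun i => ?_) fun x hx => ?_
  · rw [Real.ball_eq_Ioo]
    exact Set.Ioo_infinite (by linarith)
  · rw [← ball_pi _ hε] at hx
    simpa [evalAt] using h _ (hs hx)

/-- Affine substitution `x ↦ c + s x` in a polynomial. -/
def rescale (c : Space d) (s : ℝ) (p : MvPolynomial (Fin d) ℝ) : MvPolynomial (Fin d) ℝ :=
  MvPolynomial.bind₁ (fun i => MvPolynomial.C (c i) + MvPolynomial.C s * MvPolynomial.X i) p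

lemma evalAt_rescale (c : Space d) (s : ℝ) (p : MvPolynomial (Fin d) ℝ) (x : Space d) :
    evalAt (rescale c s p) x = evalAt p (c + s • x) := by
  simp only [evalAt, rescale, MvPolynomial.eval, MvPolynomial.eval₂Hom_bind₁]
  congr 2
  simp

lemma totalDegree_rescale_le (c : Space d) (s : ℝ) (p : MvPolynomial (Fin d) ℝ) :
    (rescale c s p).totalDegree ≤ p.totalDegree := by
  unfold rescale
  conv_lhs => rw [← MvPolynomial.support_sum_monomial_coeff p]
  rw [map_sum]
  refine MvPolynomial.totalDegree_finsetSum_le fun m hm => ?_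
  rw [MvPolynomial.bind₁_monomial]
  refine (MvPolynomial.totalDegree_mul _ _).trans
    (le_trans ?_ (MvPolynomial.le_totalDegree hm))
  rw [MvPolynomial.totalDegree_C, zero_add]
  refine (MvPolynomial.totalDegree_finsetProd _ _).trans (Finset.sum_le_sum fun i _ => ?_)
  refine (MvPolynomial.totalDegree_pow _ _).trans (mul_le_of_le_one_right (Nat.zero_le _) ?_)
  refine (MvPolynomial.totalDegree_add _ _).trans (max_le ?_ ?_)
  · simp
  · refine (MvPolynomial.totalDegree_mul _ _).trans ?_
    simp

/-- Uniqueness of the Fréchet derivative of `x ↦ p (c + s x)` yields the formal chain rule. -/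
lemma evalAt_pderiv_rescale (c : Space d) (s : ℝ) (p : MvPolynomial (Fin d) ℝ) (x : Space d)
    (i : Fin d) :
    evalAt (MvPolynomial.pderiv i (rescale c s p)) x
      = s * evalAt (MvPolynomial.pderiv i p) (c + s • x) := by
  have h1 := hasFDerivAt_evalAt (rescale c s p) x
  have h2 : HasFDerivAt (evalAt (rescale c s p))
      ((evalGrad p (c + s • x)).comp (s • ContinuousLinearMap.id ℝ (Space d))) x := by
    have : evalAt (rescale c s p) = fun y => evalAt p (c + s • y) := by
      funext y; exact evalAt_rescale c s p y
    rw [this]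
    exact (hasFDerivAt_evalAt p _).comp x (((hasFDerivAt_id x).const_smul s).const_add c)
  have h3 := congrArg (fun L : Space d →L[ℝ] ℝ => L (EuclideanSpace.single i 1)) (h1.unique h2)
  simpa [evalGrad, PiLp.single_apply] using h3

end Basic

/-! ### Inverse estimates for polynomials of bounded degree -/

section NormEquivalence

variable {d : ℕ}

/-- The mean square over a ball is a positive definite quadratic form on a finite-dimensional space,
so compactness of the unit sphere of coefficients bounds every linear functional by it. The operator
`D` is left free so that one argument covers values (`LinearMap.id`) and partial derivatives. -/
lemma exists_ball_equivalence (d r : ℕ) {ρ : ℝ} (hρ : 0 < ρ) (R : ℝ)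
    (D : MvPolynomial (Fin d) ℝ →ₗ[ℝ] MvPolynomial (Fin d) ℝ) :
    ∃ C > 0, ∀ p : MvPolynomial (Fin d) ℝ, p.totalDegree ≤ r → ∀ x ∈ closedBall (0 : Space d) R,
      evalAt (D p) x ^ 2 ≤ C * ∫ y in closedBall (0 : Space d) ρ, evalAt p y ^ 2 := by
  classical
  let V := MvPolynomial.restrictTotalDegree (Fin d) ℝ r
  let b := Module.finBasis ℝ V
  let n := Module.finrank ℝ V
  let P : (Fin n → ℝ) → MvPolynomial (Fin d) ℝ := fun c => ∑ i, c i • (b i : MvPolynomial (Fin d) ℝ)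
  have hP : ∀ c x, evalAt (P c) x = ∑ i, c i * evalAt (b i : MvPolynomial (Fin d) ℝ) x := by
    intro c x
    simp only [P, evalAt_sum, evalAt_smul]
  let F : (Fin n → ℝ) → ℝ := fun c => ∫ y in closedBall (0 : Space d) ρ, evalAt (P c) y ^ 2
  have hcont : Continuous (Function.uncurry fun (c : Fin n → ℝ) (y : Space d) =>
      evalAt (P c) y ^ 2) := by
    simp only [Function.uncurry_def, hP]
    refine Continuous.pow (continuous_finsetSum _ fun i _ => ?_) 2
    exact ((continuous_apply i).comp continuous_fst).mul
      ((continuous_evalAt _).comp continuous_snd)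
  have hF : Continuous F :=
    continuous_parametric_integral_of_continuous hcont (isCompact_closedBall _ _)
  have hFpos : ∀ c, c ≠ 0 → 0 < F c := by
    intro c hc
    have hPne : P c ≠ 0 := by
      intro h0
      apply hc
      have : ∑ i, c i • b i = 0 := by
        apply Subtype.ext
        simpa [P] using h0
      funext i
      exact Fintype.linearIndependent_iff.1 b.linearIndependent c this i
    have hnn : 0 ≤ᵐ[volume.restrict (closedBall (0 : Space d) ρ)] fun y => evalAt (P c) y ^ 2 :=
      Filter.Eventually.of_forall fun y => sq_nonneg _
    have hcc : Continuous fun y => evalAt (P c) y ^ 2 := (continuous_evalAt _).pow 2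
    rw [setIntegral_pos_iff_support_of_nonneg_ae hnn
      (hcc.continuousOn.integrableOn_compact (isCompact_closedBall _ _))]
    have hex : ∃ x ∈ ball (0 : Space d) ρ, evalAt (P c) x ≠ 0 := by
      by_contra! hcon
      exact hPne (eq_zero_of_evalAt_eq_zero_on_ball hρ hcon)
    obtain ⟨x, hx, hx0⟩ := hex
    have hopen : IsOpen (Function.support (fun y => evalAt (P c) y ^ 2) ∩ ball (0 : Space d) ρ) :=
      hcc.isOpen_support.inter isOpen_ball
    refine (hopen.measure_pos volume ⟨x, ?_, hx⟩).trans_le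
      (measure_mono (Set.inter_subset_inter_right _ ball_subset_closedBall))
    simpa using hx0
  obtain ⟨m, hm, hmF⟩ : ∃ m > 0, ∀ c, m * ‖c‖ ^ 2 ≤ F c := by
    -- An empty sphere leaves only the zero vector, for which every `m` serves.
    rcases (sphere (0 : Fin n → ℝ) 1).eq_empty_or_nonempty with he | hne
    · refine ⟨1, one_pos, fun c => ?_⟩
      by_cases hc : c = 0
      · simp only [hc, norm_zero]
        have : 0 ≤ F 0 := integral_nonneg fun y => sq_nonneg _
        simpa using this
      · exfalso
        have : (‖c‖⁻¹ • c) ∈ sphere (0 : Fin n → ℝ) 1 := by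
          simp [norm_smul, hc]
        rw [he] at this
        exact this
    · obtain ⟨c0, hc0, hmin⟩ := (isCompact_sphere (0 : Fin n → ℝ) 1).exists_isMinOn hne
        hF.continuousOn
      have hc0' : c0 ≠ 0 := by
        rintro rfl
        simp at hc0
      refine ⟨F c0, hFpos _ hc0', fun c => ?_⟩
      by_cases hc : c = 0
      · have : 0 ≤ F 0 := integral_nonneg fun y => sq_nonneg _
        simpa [hc] using this
      · have h1 : F c0 ≤ F (‖c‖⁻¹ • c) := hmin (by simp [norm_smul, hc])
        have h2 : F (‖c‖⁻¹ • c) = (‖c‖⁻¹) ^ 2 * F c := by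
          simp only [F]
          rw [← integral_const_mul]
          congr 1
          funext y
          simp only [hP, Pi.smul_apply, smul_eq_mul, mul_assoc, ← Finset.mul_sum]
          ring
        rw [h2] at h1
        have hpos : 0 < ‖c‖ := norm_pos_iff.2 hc
        calc F c0 * ‖c‖ ^ 2 ≤ (‖c‖⁻¹) ^ 2 * F c * ‖c‖ ^ 2 := by gcongr
          _ = F c := by field_simp
  have hbd : ∀ i : Fin n, ∃ M, ∀ x ∈ closedBall (0 : Space d) R,
      ‖evalAt (D (b i : MvPolynomial (Fin d) ℝ)) x‖ ≤ M := fun i =>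
    (isCompact_closedBall _ _).exists_bound_of_continuousOn (continuous_evalAt _).continuousOn
  choose M hM using hbd
  let A := ∑ i, |M i|
  -- `A` bounds the images of the basis on the ball of radius `R`; the summand `1` keeps the
  -- constant positive when `A = 0`.
  refine ⟨(A ^ 2 + 1) / m, by positivity, fun p hp x hx => ?_⟩
  let p' : V := ⟨p, (MvPolynomial.mem_restrictTotalDegree _ _ _).2 hp⟩
  let c := b.repr p'
  have hpc : P c = p := by
    have h := congrArg V.subtype (b.sum_repr p')
    rw [map_sum] at h
    exact h
  have h1 : |evalAt (D p) x| ≤ A * ‖(c : Fin n → ℝ)‖ := by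
    have hD : evalAt (D p) x = ∑ i, c i * evalAt (D (b i : MvPolynomial (Fin d) ℝ)) x := by
      rw [← hpc]
      simp only [P, map_sum, map_smul, evalAt_sum, evalAt_smul]
      rfl
    rw [hD, Finset.sum_mul]
    refine (Finset.abs_sum_le_sum_abs _ _).trans (Finset.sum_le_sum fun i _ => ?_)
    rw [abs_mul, mul_comm]
    have h2 : |evalAt (D (b i : MvPolynomial (Fin d) ℝ)) x| ≤ |M i| :=
      (hM i x hx).trans (le_abs_self _)
    have h3 : |c i| ≤ ‖(c : Fin n → ℝ)‖ := norm_le_pi_norm (c : Fin n → ℝ) i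
    gcongr
  have h2 := hmF c
  have h3 : F c = ∫ y in closedBall (0 : Space d) ρ, evalAt p y ^ 2 := by simp only [F, hpc]
  rw [← h3]
  calc evalAt (D p) x ^ 2 = |evalAt (D p) x| ^ 2 := (sq_abs _).symm
    _ ≤ (A * ‖(c : Fin n → ℝ)‖) ^ 2 := by gcongr
    _ = A ^ 2 / m * (m * ‖(c : Fin n → ℝ)‖ ^ 2) := by field_simp
    _ ≤ (A ^ 2 + 1) / m * F c := by
      have : 0 ≤ m * ‖(c : Fin n → ℝ)‖ ^ 2 := by positivity
      gcongr
      linarith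

open scoped Pointwise in
lemma setIntegral_closedBall_scale (f : Space d → ℝ) (c : Space d) {s ρ : ℝ} (hs : 0 < s) :
    ∫ y in closedBall (0 : Space d) ρ, f (c + s • y)
      = (s ^ d)⁻¹ * ∫ y in closedBall c (ρ * s), f y := by
  have h1 := Measure.setIntegral_comp_smul_of_pos (volume : Measure (Space d))
    (fun y => f (c + y)) (closedBall (0 : Space d) ρ) hs
  rw [h1]
  have h2 : s • closedBall (0 : Space d) ρ = closedBall 0 (ρ * s) := by
    rw [smul_closedBall' hs.ne', smul_zero, Real.norm_of_nonneg hs.le, mul_comm]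
  rw [h2]
  simp only [finrank_euclideanSpace, Fintype.card_fin, smul_eq_mul]
  congr 1
  have h3 := (measurePreserving_add_left (volume : Measure (Space d)) c).setIntegral_preimage_emb
    (measurableEmbedding_addLeft c) f (closedBall c (ρ * s))
  rw [← h3]
  congr 2
  ext y
  simp

/-- On polynomials of bounded degree, the values and the scaled partial derivatives in a ball are
controlled by the mean square over another ball with the same centre. -/
theorem exists_inverse_estimate (d r : ℕ) {ρ : ℝ} (hρ : 0 < ρ) (R : ℝ) :
    ∃ C > 0, ∀ (c : Space d) (s : ℝ), 0 < s → ∀ p : MvPolynomial (Fin d) ℝ, p.totalDegree ≤ r →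
      ∀ x ∈ closedBall c (R * s),
        (evalAt p x ^ 2 ≤ C * ((s ^ d)⁻¹ * ∫ y in closedBall c (ρ * s), evalAt p y ^ 2)) ∧
        ∀ i, (s * evalAt (MvPolynomial.pderiv i p) x) ^ 2 ≤
          C * ((s ^ d)⁻¹ * ∫ y in closedBall c (ρ * s), evalAt p y ^ 2) := by
  obtain ⟨C₀, hC₀, h₀⟩ := exists_ball_equivalence d r hρ R LinearMap.id
  have h₁ := fun i : Fin d => exists_ball_equivalence d r hρ R
    (MvPolynomial.pderiv i).toLinearMap
  choose C₁ hC₁ h₁ using h₁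
  refine ⟨C₀ + ∑ i, C₁ i, add_pos_of_pos_of_nonneg hC₀ (Finset.sum_nonneg fun i _ => (hC₁ i).le),
    fun c s hs p hp x hx => ?_⟩
  -- Rescaling by `x = c + s z` reduces to the fixed balls about the origin. Each derivative picks
  -- up a factor `s`, and the volume element gives `s ^ d`.
  set I := ∫ y in closedBall (0 : Space d) ρ, evalAt (rescale c s p) y ^ 2 with hI
  have hI' : I = (s ^ d)⁻¹ * ∫ y in closedBall c (ρ * s), evalAt p y ^ 2 := by
    rw [hI, ← setIntegral_closedBall_scale _ c hs]
    simp only [evalAt_rescale]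
  have hI0 : 0 ≤ I := integral_nonneg fun y => sq_nonneg _
  have hdeg := (totalDegree_rescale_le c s p).trans hp
  set z : Space d := s⁻¹ • (x - c) with hz
  have hxz : c + s • z = x := by simp [hz, smul_smul, hs.ne']
  have hzR : z ∈ closedBall (0 : Space d) R := by
    rw [mem_closedBall_zero_iff, hz, norm_smul, norm_inv, Real.norm_of_nonneg hs.le,
      inv_mul_le_iff₀ hs, mul_comm, ← dist_eq_norm]
    exact hx
  rw [← hI']
  constructor
  · have := h₀ _ hdeg z hzR
    rw [LinearMap.id_apply, evalAt_rescale, hxz] at this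
    exact this.trans (mul_le_mul_of_nonneg_right
      (le_add_of_nonneg_right (Finset.sum_nonneg fun i _ => (hC₁ i).le)) hI0)
  · intro i
    have := h₁ i _ hdeg z hzR
    rw [Derivation.coeFn_coe, evalAt_pderiv_rescale, hxz] at this
    refine this.trans (mul_le_mul_of_nonneg_right ?_ hI0)
    have := Finset.single_le_sum (fun i _ => (hC₁ i).le) (Finset.mem_univ i)
    linarith

/-- Mean squares over a ball are bounded by the maximum. -/
lemma setIntegral_sq_le {f : Space d → ℝ} {c : Space d} {s A : ℝ} (hs : 0 ≤ s)
    (h : ∀ x ∈ closedBall c s, |f x| ≤ A) :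
    ∫ y in closedBall c s, f y ^ 2 ≤ volume.real (ball (0 : Space d) 1) * s ^ d * A ^ 2 := by
  have hA : ∀ x ∈ closedBall c s, ‖f x ^ 2‖ ≤ A ^ 2 := fun x hx => by
    rw [norm_pow, Real.norm_eq_abs]
    exact pow_le_pow_left₀ (abs_nonneg _) (h x hx) 2
  have h1 := norm_setIntegral_le_of_norm_le_const (μ := volume)
    (isCompact_closedBall c s).measure_lt_top hA
  have h2 : volume.real (closedBall c s) = s ^ d * volume.real (ball (0 : Space d) 1) := by
    rw [Measure.real, Measure.addHaar_closedBall _ _ hs, ENNReal.toReal_mul,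
      ENNReal.toReal_ofReal (by positivity)]
    simp [Measure.real]
  rw [h2] at h1
  calc _ ≤ _ := le_abs_self _
    _ ≤ _ := h1
    _ = _ := by ring

/-- On polynomials of bounded degree, the values and the scaled derivative in a ball are
controlled by the maximum over another ball with the same centre. -/
theorem exists_inverse_estimate_sup (d r : ℕ) {ρ : ℝ} (hρ : 0 < ρ) (R : ℝ) :
    ∃ C > 0, ∀ (c : Space d) (s : ℝ), 0 < s → ∀ p : MvPolynomial (Fin d) ℝ, p.totalDegree ≤ r →
      ∀ A, (∀ y ∈ closedBall c (ρ * s), |evalAt p y| ≤ A) → ∀ x ∈ closedBall c (R * s),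
        |evalAt p x| ≤ C * A ∧ s * ‖evalGrad p x‖ ≤ C * A := by
  obtain ⟨C, hC, h⟩ := exists_inverse_estimate d r hρ R
  set ω := volume.real (ball (0 : Space d) 1)
  -- The volume `ω (ρ s)^d` of the ball cancels the weight `s^{-d}`; the square root turns mean
  -- squares into maxima. The factor `d + 1` below pays for the sum over the partial derivatives.
  set K := Real.sqrt (C * (ω * ρ ^ d)) with hK
  refine ⟨(d + 1) * (K + 1), by positivity, fun c s hs p hp A hA x hx => ?_⟩
  have hA0 : 0 ≤ A := (abs_nonneg _).trans (hA c (mem_closedBall_self (by positivity)))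
  obtain ⟨h1, h2⟩ := h c s hs p hp x hx
  have hK2 : C * ((s ^ d)⁻¹ * ∫ y in closedBall c (ρ * s), evalAt p y ^ 2) ≤ (K * A) ^ 2 := by
    calc _ ≤ C * ((s ^ d)⁻¹ * (ω * (ρ * s) ^ d * A ^ 2)) := by
          gcongr
          exact setIntegral_sq_le (by positivity) hA
      _ = (K * A) ^ 2 := by
        rw [mul_pow K, hK, Real.sq_sqrt (by positivity), mul_pow ρ]
        field_simp
  have hKA : 0 ≤ K * A := by positivity
  have h3 : |evalAt p x| ≤ K * A := abs_le_of_sq_le_sq (h1.trans hK2) hKA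
  have h4 : ∀ i, |s * evalAt (MvPolynomial.pderiv i p) x| ≤ K * A := fun i =>
    abs_le_of_sq_le_sq ((h2 i).trans hK2) hKA
  constructor
  · nlinarith [mul_nonneg (Nat.cast_nonneg (α := ℝ) d) hKA,
      mul_nonneg (Nat.cast_nonneg (α := ℝ) d) hA0]
  · calc s * ‖evalGrad p x‖ ≤ s * ∑ i, |evalAt (MvPolynomial.pderiv i p) x| := by
          gcongr; exact norm_evalGrad_le p x
      _ = ∑ i, |s * evalAt (MvPolynomial.pderiv i p) x| := by
          simp only [Finset.mul_sum, abs_mul, abs_of_pos hs]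
      _ ≤ ∑ _i : Fin d, K * A := Finset.sum_le_sum fun i _ => h4 i
      _ = d * (K * A) := by simp
      _ ≤ _ := by nlinarith [mul_nonneg (Nat.cast_nonneg (α := ℝ) d) hA0]

/-- A bound on the derivative in a ball gives a Lipschitz estimate there. -/
lemma abs_evalAt_sub_le {p : MvPolynomial (Fin d) ℝ} {c : Space d} {s L : ℝ}
    (h : ∀ x ∈ closedBall c s, ‖evalGrad p x‖ ≤ L) {x y : Space d} (hx : x ∈ closedBall c s)
    (hy : y ∈ closedBall c s) : |evalAt p x - evalAt p y| ≤ L * ‖x - y‖ :=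
  (convex_closedBall c s).norm_image_sub_le_of_norm_hasFDerivWithin_le
    (fun z _ => (hasFDerivAt_evalAt p z).hasFDerivWithinAt) h hy hx

end NormEquivalence

/-! ### Barycentric coordinates and Lagrange interpolation -/

section Lagrange

variable {d : ℕ} {T : Finset (Space d)}

/-- `T` is the vertex set of a non-degenerate `d`-simplex. -/
structure IsElement (T : Finset (Space d)) : Prop where
  indep : AffineIndependent ℝ ((↑) : T → Space d)
  card_eq : T.card = d + 1

/-- The polynomial representing an affine function. -/
def affinePoly (f : Space d →ᵃ[ℝ] ℝ) : MvPolynomial (Fin d) ℝ :=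
  MvPolynomial.C (f 0) +
    ∑ i, MvPolynomial.C (f.linear (EuclideanSpace.single i 1)) * MvPolynomial.X i

lemma evalAt_affinePoly (f : Space d →ᵃ[ℝ] ℝ) (x : Space d) : evalAt (affinePoly f) x = f x := by
  have h1 : f x = f.linear x + f 0 := by
    have := f.map_vadd 0 x
    simpa using this
  have h2 : x = ∑ i, x i • EuclideanSpace.single i (1 : ℝ) := by
    ext j
    simp [Pi.single_apply]
  have h3 : f.linear x = ∑ i, f.linear (EuclideanSpace.single i 1) * x i := by
    conv_lhs => rw [h2]
    simp [map_sum, mul_comm]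
  simp only [affinePoly, evalAt_add, evalAt_C, evalAt_sum, evalAt_mul, evalAt_X]
  rw [h1, h3, add_comm]

lemma totalDegree_affinePoly_le (f : Space d →ᵃ[ℝ] ℝ) : (affinePoly f).totalDegree ≤ 1 := by
  refine (MvPolynomial.totalDegree_add _ _).trans (max_le (by simp) ?_)
  refine MvPolynomial.totalDegree_finsetSum_le fun i _ => ?_
  exact (MvPolynomial.totalDegree_mul _ _).trans (by simp)

/-- By counting, `d + 1` affinely independent points span, so `T` is an affine basis. Coordinates
are indexed by all points, with value zero off `T`, so that sums need no subtypes. -/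
lemma IsElement.exists_bary (hT : IsElement T) : ∃ l : Space d → Space d →ᵃ[ℝ] ℝ,
    (∀ x, ∑ V ∈ T, l V x = 1 ∧ ∑ V ∈ T, l V x • V = x) ∧
    ∀ w : Space d → ℝ, ∑ V ∈ T, w V = 1 → ∀ V ∈ T, l V (∑ U ∈ T, w U • U) = w V := by
  classical
  have htot : affineSpan ℝ (Set.range ((↑) : T → Space d)) = ⊤ := by
    rw [hT.indep.affineSpan_eq_top_iff_card_eq_finrank_add_one]
    simp [hT.card_eq]
  let b : AffineBasis T ℝ (Space d) := ⟨(↑), hT.indep, htot⟩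
  refine ⟨fun V => if h : V ∈ T then b.coord ⟨V, h⟩ else 0, fun x => ⟨?_, ?_⟩, fun w hw V hV => ?_⟩
  · rw [← Finset.sum_attach, ← b.sum_coord_apply_eq_one x]
    exact Finset.sum_congr rfl fun V _ => by simp [V.2]
  · rw [← Finset.sum_attach]
    conv_rhs => rw [← b.linear_combination_coord_eq_self x]
    refine Finset.sum_congr rfl fun V _ => ?_
    simp only [V.2, dite_true]
    rfl
  · simp only [hV, dite_true]
    have hw' : ∑ U : T, w U = 1 := by rw [← hw, ← Finset.sum_attach T]; rfl
    have := b.coord_apply_combination_of_mem (Finset.mem_univ ⟨V, hV⟩) (w := fun U : T => w U) hw'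
    rw [Finset.affineCombination_eq_linear_combination _ _ _ hw'] at this
    rw [← Finset.sum_attach T]
    exact this

/-- The barycentric coordinate with respect to the vertex `V` of an element. -/
def IsElement.bary (hT : IsElement T) : Space d → Space d →ᵃ[ℝ] ℝ := hT.exists_bary.choose

lemma IsElement.sum_bary (hT : IsElement T) (x : Space d) : ∑ V ∈ T, hT.bary V x = 1 :=
  (hT.exists_bary.choose_spec.1 x).1

lemma IsElement.bary_combination (hT : IsElement T) {w : Space d → ℝ} (hw : ∑ V ∈ T, w V = 1)
    {V : Space d} (hV : V ∈ T) : hT.bary V (∑ U ∈ T, w U • U) = w V :=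
  hT.exists_bary.choose_spec.2 w hw V hV

lemma mem_simplex_iff {S : Finset (Space d)} {x : Space d} : x ∈ simplex S ↔
    ∃ w : Space d → ℝ, (∀ V ∈ S, 0 ≤ w V) ∧ ∑ V ∈ S, w V = 1 ∧ ∑ V ∈ S, w V • V = x :=
  Finset.mem_convexHull'

lemma IsElement.bary_nonneg (hT : IsElement T) {x : Space d} (hx : x ∈ simplex T) {V : Space d}
    (hV : V ∈ T) : 0 ≤ hT.bary V x := by
  obtain ⟨w, hw0, hw1, rfl⟩ := mem_simplex_iff.1 hx
  rw [hT.bary_combination hw1 hV]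
  exact hw0 V hV

lemma IsElement.bary_le_one (hT : IsElement T) {x : Space d} (hx : x ∈ simplex T) {V : Space d}
    (hV : V ∈ T) : hT.bary V x ≤ 1 := by
  rw [← hT.sum_bary x]
  exact Finset.single_le_sum (f := fun V => hT.bary V x) (fun U hU => hT.bary_nonneg hx hU) hV

/-- Barycentric coordinates on a face: the coordinates outside the face vanish. -/
lemma IsElement.bary_face (hT : IsElement T) {S : Finset (Space d)} (hST : S ⊆ T)
    {w : Space d → ℝ} (hw : ∑ V ∈ S, w V = 1) :
    (∀ V ∈ S, hT.bary V (∑ U ∈ S, w U • U) = w V) ∧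
      ∀ V ∈ T, V ∉ S → hT.bary V (∑ U ∈ S, w U • U) = 0 := by
  classical
  have h1 : ∑ U ∈ T, (if U ∈ S then w U else 0) = 1 := by
    rw [← Finset.sum_filter, Finset.filter_mem_eq_inter, Finset.inter_eq_right.2 hST, hw]
  have h2 : ∑ U ∈ T, (if U ∈ S then w U else 0) • U = ∑ U ∈ S, w U • U := by
    simp only [ite_smul, zero_smul]
    rw [← Finset.sum_filter, Finset.filter_mem_eq_inter, Finset.inter_eq_right.2 hST]
  constructor
  · intro V hV
    have := hT.bary_combination (w := fun U => if U ∈ S then w U else 0) h1 (hST hV)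
    rw [h2] at this
    simpa [hV] using this
  · intro V hV hVS
    have := hT.bary_combination (w := fun U => if U ∈ S then w U else 0) h1 hV
    rw [h2] at this
    simpa [hVS] using this

open Classical in
/-- Multi-indices of order `k` supported in `S`. -/
def multiIndices (k : ℕ) (S : Finset (Space d)) : Finset (Space d → ℕ) := S.piAntidiag k

lemma mem_multiIndices {k : ℕ} {S : Finset (Space d)} {α : Space d → ℕ} :
    α ∈ multiIndices k S ↔ ∑ V ∈ S, α V = k ∧ ∀ V, α V ≠ 0 → V ∈ S := by
  classical
  simp [multiIndices]

/-- The Lagrange node of order `k` with a given multi-index. -/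
def lagrangeNode (k : ℕ) (S : Finset (Space d)) (α : Space d → ℕ) : Space d :=
  ∑ V ∈ S, ((α V : ℝ) / (k : ℝ)) • V

lemma lagrangeNode_mem {k : ℕ} {α : Space d → ℕ} (hα : α ∈ multiIndices k T) :
    lagrangeNode k T α ∈ lagrangeNodes k T :=
  ⟨α, (mem_multiIndices.1 hα).1, rfl⟩

lemma exists_multiIndex {k : ℕ} {x : Space d} (hx : x ∈ lagrangeNodes k T) :
    ∃ α ∈ multiIndices k T, x = lagrangeNode k T α := by
  classical
  obtain ⟨α, h1, rfl⟩ := hx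
  -- The multi-index in `lagrangeNodes` is arbitrary off `T`; cutting it off there makes it a
  -- canonical label of the node.
  refine ⟨fun V => if V ∈ T then α V else 0, mem_multiIndices.2 ⟨?_, fun V hV => ?_⟩, ?_⟩
  · rw [← h1]
    exact Finset.sum_congr rfl fun V hV => by simp [hV]
  · by_contra h
    simp [h] at hV
  · exact Finset.sum_congr rfl fun V hV => by simp [hV]

lemma sum_multiIndex_div {k : ℕ} (hk : 1 ≤ k) {α : Space d → ℕ} (hα : ∑ V ∈ T, α V = k) :
    ∑ V ∈ T, (α V : ℝ) / (k : ℝ) = 1 := by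
  rw [← Finset.sum_div, ← Nat.cast_sum, hα, div_self]
  exact_mod_cast (by lia : k ≠ 0)

lemma lagrangeNodes_subset_simplex {k : ℕ} (hk : 1 ≤ k) (S : Finset (Space d)) :
    lagrangeNodes k S ⊆ simplex S := by
  rintro x ⟨α, h1, rfl⟩
  exact mem_simplex_iff.2 ⟨fun V => (α V : ℝ) / k, fun V _ => by positivity,
    sum_multiIndex_div hk h1, rfl⟩

/-- The value of a Lagrange basis function in terms of the barycentric coordinates `w`. -/
def lagrangeWeight (k : ℕ) (S : Finset (Space d)) (α : Space d → ℕ) (w : Space d → ℝ) : ℝ :=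
  ∏ V ∈ S, ∏ j ∈ Finset.range (α V), ((j + 1 : ℝ)⁻¹ * (k * w V - j))

/-- The Lagrange basis function of order `k` with a given multi-index. -/
def IsElement.lagrangeBasis (hT : IsElement T) (k : ℕ) (α : Space d → ℕ) :
    MvPolynomial (Fin d) ℝ :=
  ∏ V ∈ T, ∏ j ∈ Finset.range (α V),
    (MvPolynomial.C ((j + 1 : ℝ)⁻¹) *
      (MvPolynomial.C (k : ℝ) * affinePoly (hT.bary V) - MvPolynomial.C (j : ℝ)))

lemma IsElement.evalAt_lagrangeBasis (hT : IsElement T) (k : ℕ) (α : Space d → ℕ) (x : Space d) :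
    evalAt (hT.lagrangeBasis k α) x = lagrangeWeight k T α (fun V => hT.bary V x) := by
  simp only [IsElement.lagrangeBasis, lagrangeWeight, evalAt_prod, evalAt_affinePoly, evalAt_mul,
    evalAt_sub, evalAt_C]

lemma IsElement.totalDegree_lagrangeBasis_le (hT : IsElement T) (k : ℕ) (α : Space d → ℕ) :
    (hT.lagrangeBasis k α).totalDegree ≤ ∑ V ∈ T, α V := by
  refine (MvPolynomial.totalDegree_finsetProd _ _).trans (Finset.sum_le_sum fun V _ => ?_)
  refine (MvPolynomial.totalDegree_finsetProd _ _).trans ?_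
  refine (Finset.sum_le_card_nsmul _ _ 1 fun j _ => ?_).trans (by simp)
  refine (MvPolynomial.totalDegree_mul _ _).trans ?_
  rw [MvPolynomial.totalDegree_C, zero_add]
  refine (MvPolynomial.totalDegree_sub _ _).trans (max_le ?_
    ((MvPolynomial.totalDegree_C _).le.trans zero_le_one))
  refine (MvPolynomial.totalDegree_mul _ _).trans ?_
  rw [MvPolynomial.totalDegree_C, zero_add]
  exact totalDegree_affinePoly_le _

/-- At its own node each vertex contributes `∏ (α - j) / ∏ (j + 1)` over `j < α`, which is `α! /
α!`; reversing one product makes the factors cancel one by one. -/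
lemma lagrangeWeight_self {k : ℕ} (hk : 1 ≤ k) (S : Finset (Space d)) (α : Space d → ℕ) :
    lagrangeWeight k S α (fun V => (α V : ℝ) / k) = 1 := by
  have hk' : (k : ℝ) ≠ 0 := by exact_mod_cast (by lia : k ≠ 0)
  refine Finset.prod_eq_one fun V _ => ?_
  rw [Finset.prod_mul_distrib, ← Finset.prod_range_reflect, ← Finset.prod_mul_distrib]
  refine Finset.prod_eq_one fun j hj => ?_
  have hj' := Finset.mem_range.1 hj
  have h1 : ((α V - 1 - j : ℕ) : ℝ) = α V - 1 - j := by
    rw [Nat.cast_sub (by lia), Nat.cast_sub (by lia)]; simp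
  rw [h1, mul_div_cancel₀ _ hk']
  have h2 : (α V : ℝ) - j ≠ 0 := by
    have : (j : ℝ) < α V := by exact_mod_cast hj'
    linarith
  rw [show (((α V : ℝ) - 1 - j) + 1) = α V - j by ring, inv_mul_cancel₀ h2]

/-- Distinct multi-indices with equal sums satisfy `β V < α V` at some vertex `V`, and there the
factor with `j = β V` vanishes. -/
lemma lagrangeWeight_of_ne {k : ℕ} (hk : 1 ≤ k) {S : Finset (Space d)} {α β : Space d → ℕ}
    (hα : α ∈ multiIndices k S) (hβ : β ∈ multiIndices k S) (h : α ≠ β) :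
    lagrangeWeight k S α (fun V => (β V : ℝ) / k) = 0 := by
  have hk' : (k : ℝ) ≠ 0 := by exact_mod_cast (by lia : k ≠ 0)
  rw [mem_multiIndices] at hα hβ
  obtain ⟨V, hV, hlt⟩ : ∃ V ∈ S, β V < α V := by
    by_contra! hcon
    apply h
    funext V
    by_cases hV : V ∈ S
    · exact (Finset.sum_eq_sum_iff_of_le hcon).1 (hα.1.trans hβ.1.symm) V hV
    · have h1 : α V = 0 := by_contra fun h => hV (hα.2 V h)
      have h2 : β V = 0 := by_contra fun h => hV (hβ.2 V h)
      rw [h1, h2]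
  refine Finset.prod_eq_zero hV (Finset.prod_eq_zero (Finset.mem_range.2 hlt) ?_)
  rw [mul_div_cancel₀ _ hk', sub_self, mul_zero]

lemma IsElement.bary_lagrangeNode (hT : IsElement T) {k : ℕ} (hk : 1 ≤ k) {α : Space d → ℕ}
    (hα : α ∈ multiIndices k T) {V : Space d} (hV : V ∈ T) :
    hT.bary V (lagrangeNode k T α) = (α V : ℝ) / k :=
  hT.bary_combination (sum_multiIndex_div hk (mem_multiIndices.1 hα).1) hV

open Classical in
lemma IsElement.evalAt_lagrangeBasis_node (hT : IsElement T) {k : ℕ} (hk : 1 ≤ k)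
    {α β : Space d → ℕ} (hα : α ∈ multiIndices k T) (hβ : β ∈ multiIndices k T) :
    evalAt (hT.lagrangeBasis k α) (lagrangeNode k T β) = if α = β then 1 else 0 := by
  have h1 : lagrangeWeight k T α (fun V => hT.bary V (lagrangeNode k T β))
      = lagrangeWeight k T α (fun V => (β V : ℝ) / k) := by
    refine Finset.prod_congr rfl fun V hV => ?_
    simp only [hT.bary_lagrangeNode hk hβ hV]
  rw [hT.evalAt_lagrangeBasis, h1]
  split_ifs with h
  · rw [h, lagrangeWeight_self hk]
  · exact lagrangeWeight_of_ne hk hα hβ h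

/-- The Lagrange interpolant of order `k` on an element. -/
def IsElement.lagrangeInterp (hT : IsElement T) (k : ℕ) (g : Space d → ℝ) :
    MvPolynomial (Fin d) ℝ :=
  ∑ α ∈ multiIndices k T, g (lagrangeNode k T α) • hT.lagrangeBasis k α

lemma IsElement.totalDegree_lagrangeInterp_le (hT : IsElement T) (k : ℕ) (g : Space d → ℝ) :
    (hT.lagrangeInterp k g).totalDegree ≤ k := by
  refine MvPolynomial.totalDegree_finsetSum_le fun α hα => ?_
  refine (MvPolynomial.totalDegree_smul_le _ _).trans ?_
  exact (hT.totalDegree_lagrangeBasis_le k α).trans_eq (mem_multiIndices.1 hα).1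

lemma IsElement.evalAt_lagrangeInterp_node (hT : IsElement T) {k : ℕ} (hk : 1 ≤ k)
    (g : Space d → ℝ) {x : Space d} (hx : x ∈ lagrangeNodes k T) :
    evalAt (hT.lagrangeInterp k g) x = g x := by
  classical
  obtain ⟨β, hβ, rfl⟩ := exists_multiIndex hx
  rw [IsElement.lagrangeInterp, evalAt_sum, Finset.sum_eq_single β]
  · rw [evalAt_smul, hT.evalAt_lagrangeBasis_node hk hβ hβ, if_pos rfl, mul_one]
  · intro α hα hne
    rw [evalAt_smul, hT.evalAt_lagrangeBasis_node hk hα hβ, if_neg hne, mul_zero]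
  · exact fun h => absurd hβ h

/-- An exponent vector of degree at most `k` becomes a multi-index on `d + 1` vertices by adding the
slack `k - ∑ n i` as zeroth entry. Injectivity suffices, as only this inequality between the
dimensions is missing for unisolvence. -/
lemma card_degree_le_card_multiIndices (hc : T.card = d + 1) (k : ℕ) :
    Nat.card {n : Fin d →₀ ℕ | (n.sum fun _ e => e) ≤ k} ≤ (multiIndices k T).card := by
  classical
  have hcard : Fintype.card T = d + 1 := by simp [hc]
  let e : T ≃ Fin (d + 1) := Fintype.equivFinOfCardEq hcard
  let f : (Fin d →₀ ℕ) → Space d → ℕ := fun n V =>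
    if h : V ∈ T then Fin.cons (α := fun _ => ℕ) (k - ∑ i, n i) n (e ⟨V, h⟩) else 0
  have hf : ∀ n ∈ {n : Fin d →₀ ℕ | (n.sum fun _ e => e) ≤ k}, f n ∈ multiIndices k T := by
    intro n hn
    have hn' : ∑ i, n i ≤ k := by
      have h : (n.sum fun _ e => e) ≤ k := hn
      rwa [Finsupp.sum_fintype _ _ (fun _ => rfl)] at h
    refine mem_multiIndices.2 ⟨?_, fun V hV => ?_⟩
    · rw [← Finset.sum_attach]
      have h1 : ∑ V ∈ T.attach, f n V
          = ∑ V : T, Fin.cons (α := fun _ => ℕ) (k - ∑ i, n i) n (e V) := by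
        refine Finset.sum_congr rfl fun V _ => ?_
        simp [f, V.2]
      rw [h1, e.sum_comp (fun j => Fin.cons (α := fun _ => ℕ) (k - ∑ i, n i) n j),
        Fin.sum_univ_succ]
      simp only [Fin.cons_zero, Fin.cons_succ]
      lia
    · by_contra h
      simp [f, h] at hV
  have hinj : Function.Injective f := by
    intro n m hnm
    ext i
    have h1 := congrFun hnm (e.symm i.succ)
    simpa [f] using h1
  have hcm : (multiIndices k T).card = Nat.card (multiIndices k T : Set (Space d → ℕ)) := by simp
  rw [hcm]
  exact Nat.card_le_card_of_injective
    (fun n : {n : Fin d →₀ ℕ | (n.sum fun _ e => e) ≤ k} =>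
      (⟨f n, hf n n.2⟩ : (multiIndices k T : Set (Space d → ℕ))))
    fun n m h => Subtype.ext (hinj (Subtype.ext_iff.1 h))

/-- Unisolvence of the Lagrange nodes. -/
theorem IsElement.eq_zero_of_lagrangeNodes (hT : IsElement T) {k : ℕ} (hk : 1 ≤ k)
    {p : MvPolynomial (Fin d) ℝ} (hp : p.totalDegree ≤ k)
    (h : ∀ x ∈ lagrangeNodes k T, evalAt p x = 0) : p = 0 := by
  classical
  let V := MvPolynomial.restrictTotalDegree (Fin d) ℝ k
  let A := {α // α ∈ multiIndices k T}
  let ev : V →ₗ[ℝ] (A → ℝ) :=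
    { toFun := fun p α => evalAt (p : MvPolynomial (Fin d) ℝ) (lagrangeNode k T α)
      map_add' := fun p q => by funext α; simp
      map_smul' := fun a p => by funext α; simp [evalAt_smul] }
  have hsurj : Function.Surjective ev := by
    intro g
    refine ⟨⟨∑ α : A, g α • hT.lagrangeBasis k α, ?_⟩, ?_⟩
    · rw [MvPolynomial.mem_restrictTotalDegree]
      refine MvPolynomial.totalDegree_finsetSum_le fun α _ => ?_
      refine (MvPolynomial.totalDegree_smul_le _ _).trans ?_
      exact (hT.totalDegree_lagrangeBasis_le k α).trans_eq (mem_multiIndices.1 α.2).1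
    · funext β
      change evalAt (∑ α : A, g α • hT.lagrangeBasis k α) (lagrangeNode k T β) = g β
      rw [evalAt_sum, Finset.sum_eq_single β]
      · rw [evalAt_smul, hT.evalAt_lagrangeBasis_node hk β.2 β.2, if_pos rfl, mul_one]
      · intro α _ hne
        rw [evalAt_smul, hT.evalAt_lagrangeBasis_node hk α.2 β.2,
          if_neg fun h => hne (Subtype.ext h), mul_zero]
      · simp
  have hV : Module.finrank ℝ V = Nat.card {n : Fin d →₀ ℕ | (n.sum fun _ e => e) ≤ k} :=
    Module.finrank_eq_nat_card_basis
      (MvPolynomial.basisRestrictSupport ℝ {n : Fin d →₀ ℕ | (n.sum fun _ e => e) ≤ k})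
  have hA : Module.finrank ℝ (A → ℝ) = (multiIndices k T).card := by simp [A]
  have hle : Module.finrank ℝ (A → ℝ) ≤ Module.finrank ℝ V :=
    LinearMap.finrank_le_finrank_of_surjective (f := ev) hsurj
  have heq : Module.finrank ℝ V = Module.finrank ℝ (A → ℝ) := by
    refine le_antisymm ?_ hle
    rw [hV, hA]
    exact card_degree_le_card_multiIndices hT.card_eq k
  -- Evaluation at the nodes is onto because the Lagrange basis is dual to them; with equal
  -- dimensions it is also one-to-one.
  have hinj := (LinearMap.injective_iff_surjective_of_finrank_eq_finrank heq).2 hsurj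
  have h0 : (⟨p, (MvPolynomial.mem_restrictTotalDegree _ _ _).2 hp⟩ : V) = 0 := by
    apply hinj
    rw [map_zero]
    funext α
    exact h _ (lagrangeNode_mem α.2)
  exact congrArg Subtype.val h0

lemma IsElement.eq_of_lagrangeNodes (hT : IsElement T) {k : ℕ} (hk : 1 ≤ k)
    {p r : MvPolynomial (Fin d) ℝ} (hp : p.totalDegree ≤ k) (hr : r.totalDegree ≤ k)
    (h : ∀ x ∈ lagrangeNodes k T, evalAt p x = evalAt r x) : p = r := by
  refine sub_eq_zero.1 (hT.eq_zero_of_lagrangeNodes hk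
    ((MvPolynomial.totalDegree_sub _ _).trans (max_le hp hr)) fun x hx => ?_)
  rw [evalAt_sub, h x hx, sub_self]

/-- The canonical polynomial extension is the polynomial itself. -/
lemma IsElement.polyExt_eq (hT : IsElement T) {k : ℕ} (hk : 1 ≤ k) {S : Set (Space d)}
    (hS : lagrangeNodes k T ⊆ S) {f : Space d → ℝ} {p : MvPolynomial (Fin d) ℝ}
    (hp : p.totalDegree ≤ k) (h : ∀ x ∈ S, evalAt p x = f x) :
    polyExt k S f = evalAt p := by
  have hex : IsPolyOn k S f (Classical.epsilon (IsPolyOn k S f)) :=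
    Classical.epsilon_spec ⟨p, hp, h⟩
  -- The arbitrary choice in `polyExt` is harmless: any candidate agrees with `p` at the nodes,
  -- hence equals it.
  have : Classical.epsilon (IsPolyOn k S f) = p :=
    hT.eq_of_lagrangeNodes hk hex.1 hp fun x hx => (hex.2 x (hS hx)).trans (h x (hS hx)).symm
  funext x
  rw [polyExt, this]
  rfl

lemma IsElement.polyExt_lagrangeNodes (hT : IsElement T) {k : ℕ} (hk : 1 ≤ k) (g : Space d → ℝ) :
    polyExt k (lagrangeNodes k T) g = evalAt (hT.lagrangeInterp k g) :=
  hT.polyExt_eq hk subset_rfl (hT.totalDegree_lagrangeInterp_le k g)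
    fun _ hx => hT.evalAt_lagrangeInterp_node hk g hx

/-- On a face, the Lagrange interpolant depends only on the nodes in the face. -/
lemma IsElement.lagrangeInterp_face (hT : IsElement T) (k : ℕ) (g : Space d → ℝ)
    {S : Finset (Space d)} (hST : S ⊆ T) {w : Space d → ℝ} (hw : ∑ V ∈ S, w V = 1) :
    evalAt (hT.lagrangeInterp k g) (∑ V ∈ S, w V • V)
      = ∑ α ∈ multiIndices k S, g (lagrangeNode k S α) * lagrangeWeight k S α w := by
  classical
  obtain ⟨h1, h2⟩ := hT.bary_face hST hw
  have hsub : multiIndices k S ⊆ multiIndices k T := by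
    intro α hα
    rw [mem_multiIndices] at hα ⊢
    refine ⟨?_, fun V hV => hST (hα.2 V hV)⟩
    rw [← hα.1]
    exact (Finset.sum_subset hST fun V _ hV => by_contra fun h => hV (hα.2 V h)).symm
  rw [IsElement.lagrangeInterp, evalAt_sum, ← Finset.sum_subset hsub]
  · refine Finset.sum_congr rfl fun α hα => ?_
    have hα' := (mem_multiIndices.1 hα).2
    rw [evalAt_smul, hT.evalAt_lagrangeBasis]
    congr 1
    · congr 1
      refine (Finset.sum_subset hST fun V _ hV => ?_).symm
      have : α V = 0 := by_contra fun h => hV (hα' V h)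
      simp [this]
    · rw [lagrangeWeight, lagrangeWeight, ← Finset.prod_subset hST]
      · exact Finset.prod_congr rfl fun V hV => by rw [h1 V hV]
      · intro V _ hV
        have : α V = 0 := by_contra fun h => hV (hα' V h)
        simp [this]
  · intro α hα hαS
    -- A multi-index not supported in the face charges a vertex `V` off it; its factor with `j = 0`
    -- is `k` times the coordinate of `V`, which vanishes on the face.
    obtain ⟨V, hV, hVS⟩ : ∃ V, α V ≠ 0 ∧ V ∉ S := by
      by_contra! hcon
      apply hαS
      rw [mem_multiIndices] at hα ⊢
      refine ⟨?_, hcon⟩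
      rw [← hα.1]
      exact Finset.sum_subset hST fun V _ hV => by_contra fun h => hV (hcon V h)
    have hVT := (mem_multiIndices.1 hα).2 V hV
    rw [evalAt_smul, hT.evalAt_lagrangeBasis, lagrangeWeight, Finset.prod_eq_zero hVT, mul_zero]
    refine Finset.prod_eq_zero (i := 0) (Finset.mem_range.2 (Nat.pos_of_ne_zero hV)) ?_
    simp [h2 V hVT hVS]

/-- Stability of Lagrange interpolation in terms of bounds for the barycentric coordinates. -/
lemma IsElement.abs_evalAt_le_of_nodes (hT : IsElement T) {k : ℕ} (hk : 1 ≤ k)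
    {p : MvPolynomial (Fin d) ℝ} (hp : p.totalDegree ≤ k) {A B : ℝ} (hB : 0 ≤ B)
    (hA : ∀ x ∈ lagrangeNodes k T, |evalAt p x| ≤ A) {x : Space d}
    (hx : ∀ V ∈ T, |hT.bary V x| ≤ B) :
    |evalAt p x| ≤ ((k + 1) ^ (d + 1) * (k * B + k) ^ k) * A := by
  classical
  have hpe : p = hT.lagrangeInterp k (evalAt p) :=
    hT.eq_of_lagrangeNodes hk hp (hT.totalDegree_lagrangeInterp_le k _) fun y hy =>
      (hT.evalAt_lagrangeInterp_node hk _ hy).symm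
  -- Each of the `d + 1` entries lies in `{0, …, k}`. A basis function has `k` factors in total,
  -- each at most `k B + k`; the product of both counts is the stability constant.
  have hcard : ((multiIndices k T).card : ℝ) ≤ (k + 1) ^ (d + 1) := by
    have h1 : (multiIndices k T).card ≤ (T.pi fun _ => Finset.range (k + 1)).card := by
      refine Finset.card_le_card_of_injOn (fun α V _ => α V) (fun α hα => ?_) ?_
      · rw [Finset.mem_coe, Finset.mem_pi]
        intro V hV
        rw [Finset.mem_range, Nat.lt_succ_iff, ← (mem_multiIndices.1 hα).1]
        exact Finset.single_le_sum (fun _ _ => Nat.zero_le _) hV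
      · intro α hα β hβ h
        funext V
        by_cases hV : V ∈ T
        · exact congrFun (congrFun h V) hV
        · have h1 : α V = 0 := by_contra fun h => hV ((mem_multiIndices.1 hα).2 V h)
          have h2 : β V = 0 := by_contra fun h => hV ((mem_multiIndices.1 hβ).2 V h)
          rw [h1, h2]
    rw [Finset.card_pi, Finset.prod_const, Finset.card_range, hT.card_eq] at h1
    exact_mod_cast h1
  have hbas : ∀ α ∈ multiIndices k T, |evalAt (hT.lagrangeBasis k α) x| ≤ (k * B + k) ^ k := by
    intro α hα
    have hα1 := (mem_multiIndices.1 hα).1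
    rw [hT.evalAt_lagrangeBasis, lagrangeWeight, Finset.abs_prod]
    have hfac : ∀ V ∈ T, |∏ j ∈ Finset.range (α V), ((j + 1 : ℝ)⁻¹ * (k * hT.bary V x - j))|
        ≤ (k * B + k) ^ α V := by
      intro V hV
      rw [Finset.abs_prod]
      refine (Finset.prod_le_prod (g := fun _ => (k * B + k : ℝ)) (fun _ _ => abs_nonneg _)
        fun j hj => ?_).trans (by simp)
      have hαk : α V ≤ k := hα1 ▸ Finset.single_le_sum (fun _ _ => Nat.zero_le _) hV
      have hjk : (j : ℝ) ≤ k := by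
        exact_mod_cast (Finset.mem_range.1 hj).le.trans hαk
      rw [abs_mul, abs_inv]
      have h1 : |(j + 1 : ℝ)|⁻¹ ≤ 1 := by
        rw [abs_of_nonneg (by positivity)]
        exact inv_le_one_of_one_le₀ (by linarith [(Nat.cast_nonneg j : (0 : ℝ) ≤ j)])
      have h2 : |k * hT.bary V x - j| ≤ k * B + k := by
        refine (abs_sub _ _).trans ?_
        rw [abs_mul, Nat.abs_cast, Nat.abs_cast]
        have := hx V hV
        gcongr
      calc _ ≤ 1 * (k * B + k) := by gcongr
        _ = _ := one_mul _
    refine (Finset.prod_le_prod (fun _ _ => abs_nonneg _) hfac).trans ?_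
    rw [Finset.prod_pow_eq_pow_sum, hα1]
  rw [hpe, IsElement.lagrangeInterp, evalAt_sum]
  refine (Finset.abs_sum_le_sum_abs _ _).trans ?_
  -- Nonnegativity of `A` is read off at one node, the vertex `V` with multi-index `k e_V`.
  have hA0 : 0 ≤ A := by
    obtain ⟨V, hV⟩ : T.Nonempty := Finset.card_pos.1 (by rw [hT.card_eq]; lia)
    refine (abs_nonneg _).trans (hA (lagrangeNode k T (Pi.single V k)) (lagrangeNode_mem ?_))
    refine mem_multiIndices.2 ⟨?_, fun U hU => ?_⟩
    · rw [Finset.sum_eq_single V (fun U _ hU => Pi.single_eq_of_ne hU _) fun h => absurd hV h]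
      simp
    · by_contra h
      exact hU (Pi.single_eq_of_ne (fun hh : U = V => h (hh.symm ▸ hV)) _)
  calc _ ≤ ∑ _α ∈ multiIndices k T, A * (k * B + k) ^ k := by
        refine Finset.sum_le_sum fun α hα => ?_
        rw [evalAt_smul, abs_mul]
        have h1 := hA _ (lagrangeNode_mem hα)
        have h2 := hbas α hα
        gcongr
    _ = (multiIndices k T).card * (A * (k * B + k) ^ k) := by simp
    _ ≤ (k + 1) ^ (d + 1) * (A * (k * B + k) ^ k) := by gcongr
    _ = _ := by ring

/-- Barycentric coordinates are bounded on balls comparable to an inscribed ball. -/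
lemma IsElement.abs_bary_le (hT : IsElement T) {c : Space d} {s R : ℝ} (hs : 0 < s) (hR : 0 < R)
    (hc : closedBall c s ⊆ simplex T) {x : Space d} (hx : x ∈ closedBall c (R * s))
    {V : Space d} (hV : V ∈ T) : |hT.bary V x| ≤ 1 + R := by
  -- Pulling `x` towards `c` by the factor `R⁻¹` lands in the inscribed ball. The coordinate is in
  -- `[0, 1]` at both `c` and `y`, and it is extrapolated affinely back to `x`.
  set y : Space d := AffineMap.lineMap c x R⁻¹ with hy
  have hyc : y ∈ closedBall c s := by
    rw [mem_closedBall, hy, dist_lineMap_left, Real.norm_of_nonneg (by positivity),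
      inv_mul_le_iff₀ hR, dist_comm]
    exact hx
  have h0 := hT.bary_nonneg (hc (mem_closedBall_self hs.le)) hV
  have h1 := hT.bary_le_one (hc (mem_closedBall_self hs.le)) hV
  have h2 := hT.bary_nonneg (hc hyc) hV
  have h3 := hT.bary_le_one (hc hyc) hV
  have h4 : hT.bary V y = hT.bary V c + R⁻¹ * (hT.bary V x - hT.bary V c) := by
    rw [hy, AffineMap.apply_lineMap, AffineMap.lineMap_apply]
    simp only [vsub_eq_sub, smul_eq_mul, vadd_eq_add]
    ring
  have h5 : hT.bary V x = hT.bary V c + R * (hT.bary V y - hT.bary V c) := by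
    rw [h4]; field_simp; ring
  rw [h5, abs_le]
  constructor <;> nlinarith

end Lagrange

lemma exists_eq_one_of_sum_eq_one {ι : Type*} {s : Finset ι} {f : ι → ℕ} (h : ∑ i ∈ s, f i = 1) :
    ∃ i ∈ s, f i = 1 ∧ ∀ j ∈ s, j ≠ i → f j = 0 := by
  classical
  obtain ⟨i, hi, hfi⟩ := Finset.exists_ne_zero_of_sum_ne_zero (h.trans_ne one_ne_zero)
  rw [← Finset.add_sum_erase s f hi] at h
  refine ⟨i, hi, by lia, fun j hj hne => ?_⟩
  have := Finset.single_le_sum (f := f) (fun _ _ => Nat.zero_le _) (Finset.mem_erase.2 ⟨hne, hj⟩)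
  lia

/-! ### Finite element interpolation on the mesh -/

namespace Triangulation

variable {d : ℕ} {M : Triangulation d}

lemma mem_elements {T : Finset (Space d)} :
    T ∈ M.elements ↔ T ∈ M.complex.faces ∧ T.card = d + 1 := by
  simp [elements]

lemma isElement {T : Finset (Space d)} (hT : T ∈ M.elements) : IsElement T :=
  ⟨M.complex.indep (mem_elements.1 hT).1, (mem_elements.1 hT).2⟩

lemma simplex_subset_domain {T : Finset (Space d)} (hT : T ∈ M.elements) :
    simplex T ⊆ M.domain :=
  M.complex.convexHull_subset_space (mem_elements.1 hT).1

lemma exists_mem_simplex {x : Space d} (hx : x ∈ M.domain) : ∃ T ∈ M.elements, x ∈ simplex T := by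
  obtain ⟨s, hs, hxs⟩ := Geometry.SimplicialComplex.mem_space_iff.1 hx
  obtain ⟨T, hT, hsT, hc⟩ := M.pure s hs
  exact ⟨T, mem_elements.2 ⟨hT, hc⟩, convexHull_mono (by exact_mod_cast hsT) hxs⟩

-- This is the form in which the face-to-face condition enters: continuity of interpolants,
-- disjointness of inscribed balls and the location of nodes all rest on it.
open Classical in
lemma mem_simplex_inter {T T' : Finset (Space d)} (hT : T ∈ M.elements) (hT' : T' ∈ M.elements)
    {x : Space d} (hx : x ∈ simplex T) (hx' : x ∈ simplex T') : x ∈ simplex (T ∩ T') := by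
  have := M.complex.inter_subset_convexHull (mem_elements.1 hT).1 (mem_elements.1 hT').1 ⟨hx, hx'⟩
  rw [simplex]
  exact_mod_cast this

/-- The finite element interpolant on an element is the local Lagrange interpolant. -/
theorem interpolate_eq {k : ℕ} (hk : 1 ≤ k) {T : Finset (Space d)} (hT : T ∈ M.elements)
    (g : Space d → ℝ) {x : Space d} (hx : x ∈ simplex T) :
    M.interpolate k g x = evalAt ((isElement hT).lagrangeInterp k g) x := by
  classical
  have hex : ∃ T ∈ M.elements, x ∈ simplex T := ⟨T, hT, hx⟩
  rw [interpolate, dif_pos hex]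
  obtain ⟨hT', hx'⟩ := hex.choose_spec
  rw [(isElement hT').polyExt_lagrangeNodes hk]
  -- The point is a convex combination of vertices common to the chosen element and `T`, where both
  -- local interpolants are given by the same face formula.
  obtain ⟨w, -, hw1, hw⟩ := mem_simplex_iff.1 (mem_simplex_inter hT hT' hx hx')
  generalize hex.choose = T' at *
  subst hw
  rw [(isElement hT).lagrangeInterp_face k g Finset.inter_subset_left hw1,
    (isElement hT').lagrangeInterp_face k g Finset.inter_subset_right hw1]

/-- The piecewise linear interpolant in barycentric coordinates. -/
lemma linLevelSet_eq {T : Finset (Space d)} (hT : T ∈ M.elements) (φ : Space d → ℝ) {x : Space d}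
    (hx : x ∈ simplex T) : M.linLevelSet φ x = ∑ V ∈ T, (isElement hT).bary V x * φ V := by
  rw [linLevelSet, interpolate_eq le_rfl hT φ hx]
  set hE := isElement hT
  have hp : (∑ V ∈ T, φ V • affinePoly (hE.bary V)).totalDegree ≤ 1 :=
    MvPolynomial.totalDegree_finsetSum_le fun V _ =>
      (MvPolynomial.totalDegree_smul_le _ _).trans (totalDegree_affinePoly_le _)
  have h : hE.lagrangeInterp 1 φ = ∑ V ∈ T, φ V • affinePoly (hE.bary V) := by
    refine hE.eq_of_lagrangeNodes le_rfl (hE.totalDegree_lagrangeInterp_le 1 φ) hp fun y hy => ?_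
    rw [hE.evalAt_lagrangeInterp_node le_rfl φ hy]
    obtain ⟨α, hα, rfl⟩ := exists_multiIndex hy
    -- A multi-index of order one is a unit vector, so its node is a vertex.
    obtain ⟨V, hV, hαV⟩ : ∃ V ∈ T, α V = 1 ∧ ∀ U ∈ T, U ≠ V → α U = 0 :=
      exists_eq_one_of_sum_eq_one (mem_multiIndices.1 hα).1
    have hnode : lagrangeNode 1 T α = V := by
      rw [lagrangeNode, Finset.sum_eq_single V]
      · simp [hαV.1]
      · intro U hU hne
        simp [hαV.2 U hU hne]
      · exact fun h => absurd hV h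
    rw [evalAt_sum, Finset.sum_eq_single V]
    · rw [evalAt_smul, evalAt_affinePoly, hE.bary_lagrangeNode le_rfl hα hV, hαV.1, hnode]
      simp
    · intro U hU hne
      rw [evalAt_smul, evalAt_affinePoly, hE.bary_lagrangeNode le_rfl hα hU, hαV.2 U hU hne]
      simp
    · exact fun h => absurd hV h
  rw [h, evalAt_sum]
  exact Finset.sum_congr rfl fun V _ => by rw [evalAt_smul, evalAt_affinePoly, mul_comm]

/-- The piecewise linear interpolants change at most by the change of the vertex values. -/
lemma abs_linLevelSet_sub_le {φ ψ : Space d → ℝ} {A : ℝ}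
    (h : ∀ T ∈ M.elements, ∀ V ∈ T, |φ V - ψ V| ≤ A) {x : Space d} (hx : x ∈ M.domain) :
    |M.linLevelSet φ x - M.linLevelSet ψ x| ≤ A := by
  obtain ⟨T, hT, hxT⟩ := exists_mem_simplex hx
  rw [linLevelSet_eq hT φ hxT, linLevelSet_eq hT ψ hxT, ← Finset.sum_sub_distrib]
  refine (Finset.abs_sum_le_sum_abs _ _).trans ?_
  calc _ ≤ ∑ V ∈ T, (isElement hT).bary V x * A := by
        refine Finset.sum_le_sum fun V hV => ?_
        have h0 := (isElement hT).bary_nonneg hxT hV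
        rw [← mul_sub, abs_mul, abs_of_nonneg h0]
        exact mul_le_mul_of_nonneg_left (h T hT V hV) h0
    _ = A := by rw [← Finset.sum_mul, (isElement hT).sum_bary, one_mul]

end Triangulation

/-! ### Maps close to the identity -/

section NearIdentity

variable {X : Type*} [NormedAddCommGroup X] {E : X → X}

/-- `E` differs from the identity on `B` by a map that is Lipschitz with constant `1/2` and bounded
by `ε`. -/
structure NearId (E : X → X) (B : Set X) (ε : ℝ) : Prop where
  dist_le : ∀ x ∈ B, ‖E x - x‖ ≤ ε
  lip : ∀ x ∈ B, ∀ y ∈ B, ‖(E x - x) - (E y - y)‖ ≤ 1 / 2 * ‖x - y‖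

lemma NearId.mono {B B' : Set X} {ε : ℝ} (h : NearId E B ε) (hB : B' ⊆ B) : NearId E B' ε :=
  ⟨fun x hx => h.dist_le x (hB hx), fun x hx y hy => h.lip x (hB hx) y (hB hy)⟩

lemma NearId.norm_sub_le {B : Set X} {ε : ℝ} (h : NearId E B ε) {x y : X} (hx : x ∈ B)
    (hy : y ∈ B) : ‖x - y‖ ≤ 2 * ‖E x - E y‖ := by
  have h1 := h.lip x hx y hy
  have h2 : x - y = (E x - E y) - ((E x - x) - (E y - y)) := by abel
  have h3 : ‖x - y‖ ≤ ‖E x - E y‖ + ‖(E x - x) - (E y - y)‖ := by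
    conv_lhs => rw [h2]
    exact _root_.norm_sub_le _ _
  linarith

lemma NearId.norm_image_sub_le {B : Set X} {ε : ℝ} (h : NearId E B ε) {x y : X} (hx : x ∈ B)
    (hy : y ∈ B) : ‖E x - E y‖ ≤ 2 * ‖x - y‖ := by
  have h1 := h.lip x hx y hy
  have h2 : E x - E y = (x - y) + ((E x - x) - (E y - y)) := by abel
  have h3 : ‖E x - E y‖ ≤ ‖x - y‖ + ‖(E x - x) - (E y - y)‖ := by
    conv_lhs => rw [h2]
    exact norm_add_le _ _
  have := norm_nonneg (x - y)
  linarith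

lemma NearId.injOn {B : Set X} {ε : ℝ} (h : NearId E B ε) : Set.InjOn E B := by
  intro x hx y hy hxy
  have := h.norm_sub_le hx hy
  rw [hxy, sub_self, norm_zero, mul_zero] at this
  exact sub_eq_zero.1 (norm_le_zero_iff.1 this)

/-- Local surjectivity of maps close to the identity. -/
lemma NearId.closedBall_subset_image [CompleteSpace X] {y : X} {s ε : ℝ} (hs : 0 ≤ s)
    (h : NearId E (closedBall y s) ε) : closedBall (E y) (s / 2) ⊆ E '' closedBall y s := by
  intro x hx
  have hy : y ∈ closedBall y s := mem_closedBall_self hs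
  -- Solutions of `E z = x` are the fixed points of `f`, which is a contraction with constant `1/2`.
  -- It preserves the ball because `s / 2` is spent on `x - E y` and `s / 2` on the contraction.
  let f : X → X := fun z => x - (E z - z)
  have hmaps : Set.MapsTo f (closedBall y s) (closedBall y s) := by
    intro z hz
    have h1 := h.lip y hy z hz
    rw [mem_closedBall, dist_eq_norm] at hx hz ⊢
    have h2 : f z - y = (x - E y) + ((E y - y) - (E z - z)) := by simp only [f]; abel
    rw [h2]
    rw [norm_sub_rev] at hz
    exact (norm_add_le _ _).trans (by linarith)
  have hcontr : ContractingWith (1 / 2 : NNReal) (hmaps.restrict f _ _) := by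
    refine ⟨by norm_num [← NNReal.coe_lt_coe], LipschitzWith.of_dist_le_mul fun a b => ?_⟩
    have h1 := h.lip b b.2 a a.2
    have h2 : f a - f b = (E b - b) - (E a - a) := by simp only [f]; abel
    change dist (f a) (f b) ≤ _
    rw [dist_eq_norm, h2, dist_comm, Subtype.dist_eq, dist_eq_norm]
    simpa using h1
  obtain ⟨z, hz, hfix, -⟩ := hcontr.exists_fixedPoint' isClosed_closedBall.isComplete hmaps hy
    (edist_ne_top _ _)
  refine ⟨z, hz, ?_⟩
  have h3 : x - (E z - z) = z := hfix
  have h4 : x = z + (E z - z) := sub_eq_iff_eq_add.1 h3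
  rw [h4]; abel

/-- Since `E x` is within `ε` of `x`, the image of the ball of radius `2ε` about `x` covers `x`
itself. -/
lemma NearId.exists_preimage [CompleteSpace X] {B : Set X} {x : X} {ε : ℝ} (hε : 0 ≤ ε)
    (h : NearId E B ε) (hx : closedBall x (2 * ε) ⊆ B) :
    ∃ y ∈ B, E y = x := by
  have hxB : x ∈ B := hx (mem_closedBall_self (by positivity))
  obtain ⟨y, hy, hyx⟩ := (h.mono hx).closedBall_subset_image (by positivity)
    (show x ∈ closedBall (E x) (2 * ε / 2) by
      rw [mem_closedBall, dist_comm, dist_eq_norm]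
      linarith [h.dist_le x hxB])
  exact ⟨y, hx hy, hyx⟩

end NearIdentity

/-! ### Polynomial maps near the identity and inverses of extended element maps -/

section Extension

variable {d : ℕ}

/-- A continuous linear endomorphism that is near the identity is invertible. -/
lemma exists_equiv_of_norm_sub_id_le {L : Space d →L[ℝ] Space d}
    (h : ‖L - ContinuousLinearMap.id ℝ (Space d)‖ ≤ 1 / 2) :
    ∃ e : Space d ≃L[ℝ] Space d, (e : Space d →L[ℝ] Space d) = L := by
  have hinj : Function.Injective L := by
    intro x y hxy
    have h1 := (L - ContinuousLinearMap.id ℝ (Space d)).le_of_opNorm_le h (x - y)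
    have h2 : (L - ContinuousLinearMap.id ℝ (Space d)) (x - y) = -(x - y) := by
      simp [hxy]
    rw [h2, norm_neg] at h1
    have : ‖x - y‖ ≤ 0 := by linarith [norm_nonneg (x - y)]
    exact sub_eq_zero.1 (norm_le_zero_iff.1 this)
  refine ⟨(LinearEquiv.ofInjectiveEndo L.toLinearMap hinj).toContinuousLinearEquiv, ?_⟩
  ext1 x
  rfl

/-- The map with polynomial components `P i`. -/
def polyMap (P : Fin d → MvPolynomial (Fin d) ℝ) (x : Space d) : Space d :=
  WithLp.toLp 2 fun i => evalAt (P i) x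

lemma norm_le_of_coord_le {x : Space d} {A : ℝ} (h : ∀ i, |x i| ≤ A) : ‖x‖ ≤ d * A := by
  have h1 : ‖x‖ ≤ ∑ i, |x i| := by
    rw [EuclideanSpace.norm_eq]
    refine (Real.sqrt_le_sqrt ?_).trans_eq
      (Real.sqrt_sq (Finset.sum_nonneg fun i _ => abs_nonneg (x i)))
    simp only [Real.norm_eq_abs]
    exact Finset.sum_sq_le_sq_sum_of_nonneg fun i _ => abs_nonneg _
  refine h1.trans ((Finset.sum_le_sum fun i _ => h i).trans ?_)
  simp

lemma polyMap_sub_self_apply (P : Fin d → MvPolynomial (Fin d) ℝ) (x : Space d) (i : Fin d) :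
    (polyMap P x - x) i = evalAt (P i - MvPolynomial.X i) x := by
  simp [polyMap]

lemma contDiff_polyMap (P : Fin d → MvPolynomial (Fin d) ℝ) : ContDiff ℝ ⊤ (polyMap P) :=
  contDiff_euclidean.2 fun i => contDiff_evalAt (P i)

/-- Inverse estimates turn a bound on the displacement of a polynomial map on an inscribed ball into
closeness to the identity on a larger ball. -/
theorem exists_nearId_polyMap (d q : ℕ) {ρ C : ℝ} (hρ : 0 < ρ) (hC : 0 ≤ C) (hq : 1 ≤ q) (R : ℝ) :
    ∃ K > 0, ∀ (P : Fin d → MvPolynomial (Fin d) ℝ), (∀ i, (P i).totalDegree ≤ q) →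
      ∀ (c : Space d) (h : ℝ), 0 < h → K * h ≤ 1 / 2 →
      (∀ x ∈ closedBall c (ρ * h), ‖polyMap P x - x‖ ≤ C * h ^ 2) →
      NearId (polyMap P) (closedBall c (R * h)) (K * h ^ 2) := by
  obtain ⟨K, hK, hinv⟩ := exists_inverse_estimate_sup d q hρ R
  refine ⟨(d + 1) * (K * (C + 1)), by positivity, fun P hP c h hh hKh hdist => ?_⟩
  have hdeg : ∀ i, (P i - MvPolynomial.X i).totalDegree ≤ q := fun i =>
    (MvPolynomial.totalDegree_sub _ _).trans
      (max_le (hP i) ((MvPolynomial.totalDegree_X i).le.trans hq))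
  have hA : ∀ i, ∀ y ∈ closedBall c (ρ * h), |evalAt (P i - MvPolynomial.X i) y| ≤ C * h ^ 2 := by
    intro i y hy
    rw [← polyMap_sub_self_apply]
    exact (PiLp.norm_apply_le _ i).trans (hdist y hy)
  have hest := fun i => hinv c h hh _ (hdeg i) _ (hA i)
  constructor
  · intro x hx
    have h1 : ‖polyMap P x - x‖ ≤ d * (K * (C * h ^ 2)) := by
      refine norm_le_of_coord_le fun i => ?_
      rw [polyMap_sub_self_apply]
      exact (hest i x hx).1
    refine h1.trans ?_
    have : (d : ℝ) * (K * C) ≤ (d + 1) * (K * (C + 1)) := by gcongr <;> linarith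
    calc (d : ℝ) * (K * (C * h ^ 2)) = d * (K * C) * h ^ 2 := by ring
      _ ≤ _ := by gcongr
  · intro x hx y hy
    -- The inverse estimate costs one power of `h`: a displacement of order `h²` has a derivative of
    -- order `h`, which `K h ≤ 1/2` makes small.
    have h1 : ‖(polyMap P x - x) - (polyMap P y - y)‖ ≤ d * (K * C * h * ‖x - y‖) := by
      refine norm_le_of_coord_le fun i => ?_
      rw [PiLp.sub_apply, polyMap_sub_self_apply, polyMap_sub_self_apply]
      refine abs_evalAt_sub_le (fun z hz => ?_) hx hy
      have h2 := (hest i z hz).2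
      rw [show K * (C * h ^ 2) = h * (K * C * h) by ring] at h2
      exact le_of_mul_le_mul_left h2 hh
    refine h1.trans ?_
    have : (d : ℝ) * (K * C) ≤ (d + 1) * (K * (C + 1)) := by gcongr <;> linarith
    calc (d : ℝ) * (K * C * h * ‖x - y‖) = d * (K * C) * h * ‖x - y‖ := by ring
      _ ≤ (d + 1) * (K * (C + 1)) * h * ‖x - y‖ := by gcongr
      _ ≤ _ := by gcongr

/-- The derivative of a map near the identity is near the identity. -/
lemma NearId.norm_fderiv_sub_id_le {E : Space d → Space d} {B : Set (Space d)} {ε : ℝ}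
    (h : NearId E B ε) {x : Space d} (hx : B ∈ nhds x) {E' : Space d →L[ℝ] Space d}
    (hE : HasFDerivAt E E' x) : ‖E' - ContinuousLinearMap.id ℝ (Space d)‖ ≤ 1 / 2 := by
  have h1 : HasFDerivAt (fun y => E y - y) (E' - ContinuousLinearMap.id ℝ (Space d)) x :=
    hE.sub (hasFDerivAt_id x)
  have h2 : LipschitzOnWith (1 / 2 : NNReal) (fun y => E y - y) B :=
    LipschitzOnWith.of_dist_le_mul fun a ha b hb => by
      rw [dist_eq_norm, dist_eq_norm]
      simpa using h.lip a ha b hb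
  simpa using h1.le_of_lipschitzOn hx h2

/-- The `d`-dimensional Hausdorff measure has the same null sets as Lebesgue measure and behaves
well under Lipschitz maps, without measurability of `A`. -/
lemma volume_image_eq_zero_of_lipschitzOn {f : Space d → Space d} {A : Set (Space d)} {K : NNReal}
    (hf : LipschitzOnWith K f A) (hA : volume A = 0) : volume (f '' A) = 0 := by
  let μ : Measure (Space d) := Measure.hausdorffMeasure (Module.finrank ℝ (Space d))
  have h1 : μ ≪ (volume : Measure (Space d)) := Measure.absolutelyContinuous_isAddHaarMeasure _ _
  have h2 : (volume : Measure (Space d)) ≪ μ := Measure.absolutelyContinuous_isAddHaarMeasure _ _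
  refine h2 ?_
  have h3 := hf.hausdorffMeasure_image_le (d := Module.finrank ℝ (Space d)) (Nat.cast_nonneg _)
  have h4 : Measure.hausdorffMeasure (Module.finrank ℝ (Space d)) A = 0 := h1 hA
  rw [h4, mul_zero] at h3
  exact nonpos_iff_eq_zero.1 h3

/-- Both `E` and its inverse on the image are 2-Lipschitz, so null sets are preserved in both
directions. -/
lemma NearId.volume_image_eq_zero_iff {E : Space d → Space d} {B A : Set (Space d)} {ε : ℝ}
    (h : NearId E B ε) (hA : A ⊆ B) : volume (E '' A) = 0 ↔ volume A = 0 := by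
  have hlip : LipschitzOnWith 2 E A := LipschitzOnWith.of_dist_le_mul fun a ha b hb => by
    rw [dist_eq_norm, dist_eq_norm]
    simpa using h.norm_image_sub_le (hA ha) (hA hb)
  refine ⟨fun h0 => ?_, volume_image_eq_zero_of_lipschitzOn hlip⟩
  have hinv : Set.LeftInvOn (Function.invFunOn E A) E A := (h.injOn.mono hA).leftInvOn_invFunOn
  have hlip' : LipschitzOnWith 2 (Function.invFunOn E A) (E '' A) := by
    refine LipschitzOnWith.of_dist_le_mul ?_
    rintro _ ⟨a, ha, rfl⟩ _ ⟨b, hb, rfl⟩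
    rw [hinv ha, hinv hb, dist_eq_norm, dist_eq_norm]
    simpa using h.norm_sub_le (hA ha) (hA hb)
  have h1 := volume_image_eq_zero_of_lipschitzOn hlip' h0
  rwa [hinv.image_image] at h1

/-- The extended element map on an element with an inscribed ball of radius `ρ h` centred at `c` is
smooth, extends `Θ` and is close to the identity. -/
structure LocalMap (q : ℕ) (ρ h ε : ℝ) (Θ : Space d → Space d) (T : Finset (Space d))
    (c : Space d) : Prop where
  h_pos : 0 < h
  eps_nonneg : 0 ≤ ε
  eps_le : ε ≤ h / 4
  eps_le' : ε ≤ ρ * h / 8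
  ball_subset : closedBall c (ρ * h) ⊆ simplex T
  diam_le : Metric.diam (simplex T) ≤ h
  contDiff : ContDiff ℝ ⊤ (mapExt q Θ T)
  eq_on : ∀ y ∈ simplex T, mapExt q Θ T y = Θ y
  near : NearId (mapExt q Θ T) (closedBall c (3 * h)) ε

/-- The points at distance at most `3 h / 2` from an element. -/
def nearSet (h : ℝ) (T : Finset (Space d)) : Set (Space d) :=
  {x | ∃ z ∈ simplex T, dist x z ≤ 3 / 2 * h}

lemma isCompact_simplex (T : Finset (Space d)) : IsCompact (simplex T) :=
  T.finite_toSet.isCompact_convexHull ℝ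

lemma dist_le_of_mem_simplex {T : Finset (Space d)} {h : ℝ} (hd : Metric.diam (simplex T) ≤ h)
    {x y : Space d} (hx : x ∈ simplex T) (hy : y ∈ simplex T) : dist x y ≤ h :=
  (Metric.dist_le_diam_of_mem (isCompact_simplex T).isBounded hx hy).trans hd

namespace LocalMap

variable {q : ℕ} {ρ h ε : ℝ} {Θ : Space d → Space d} {T : Finset (Space d)} {c : Space d}

lemma rho_h_nonneg (H : LocalMap q ρ h ε Θ T c) : 0 ≤ ρ * h := by
  linarith [H.eps_le', H.eps_nonneg]

lemma center_mem (H : LocalMap q ρ h ε Θ T c) : c ∈ simplex T :=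
  H.ball_subset (mem_closedBall_self H.rho_h_nonneg)

lemma nearSet_subset (H : LocalMap q ρ h ε Θ T c) : nearSet h T ⊆ closedBall c (3 * h) := by
  rintro x ⟨z, hz, hxz⟩
  have := dist_le_of_mem_simplex H.diam_le hz H.center_mem
  have := dist_triangle x z c
  rw [mem_closedBall]
  linarith [H.h_pos]

lemma simplex_subset_nearSet (H : LocalMap q ρ h ε Θ T c) : simplex T ⊆ nearSet h T :=
  fun x hx => ⟨x, hx, by rw [dist_self]; linarith [H.h_pos]⟩

lemma simplex_subset (H : LocalMap q ρ h ε Θ T c) : simplex T ⊆ closedBall c (3 * h) :=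
  H.simplex_subset_nearSet.trans H.nearSet_subset

lemma cthickening_subset (H : LocalMap q ρ h ε Θ T c) :
    cthickening (2 * h) (simplex T) ⊆ closedBall c (3 * h) := by
  intro x hx
  rw [(isCompact_simplex T).cthickening_eq_biUnion_closedBall (by linarith [H.h_pos])] at hx
  obtain ⟨z, hz, hxz⟩ := Set.mem_iUnion₂.1 hx
  have := dist_le_of_mem_simplex H.diam_le hz H.center_mem
  have := dist_triangle x z c
  rw [mem_closedBall] at hxz ⊢
  linarith

/-- The radii fit because `3h/2 + 2ε ≤ 2h`: the ball on which the contraction argument runs stays in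
the neighbourhood where the inverse is taken. That neighbourhood lies within `3h` of the centre,
where the map is injective. -/
lemma mapExtInv_spec (H : LocalMap q ρ h ε Θ T c) {x : Space d} (hx : x ∈ nearSet h T) :
    mapExtInv q h Θ T x ∈ closedBall c (3 * h) ∧ mapExt q Θ T (mapExtInv q h Θ T x) = x ∧
      ‖mapExtInv q h Θ T x - x‖ ≤ ε := by
  obtain ⟨z, hz, hxz⟩ := hx
  have hsub : closedBall x (2 * ε) ⊆ cthickening (2 * h) (simplex T) := by
    intro y hy
    refine mem_cthickening_of_dist_le y z _ _ hz ?_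
    rw [mem_closedBall] at hy
    have := dist_triangle y x z
    linarith [H.eps_le]
  have hex : ∃ y ∈ cthickening (2 * h) (simplex T), mapExt q Θ T y = x :=
    (H.near.mono H.cthickening_subset).exists_preimage H.eps_nonneg hsub
  have h1 := Function.invFunOn_mem hex
  have h2 := Function.invFunOn_eq hex
  refine ⟨H.cthickening_subset h1, h2, ?_⟩
  have h3 := H.near.dist_le _ (H.cthickening_subset h1)
  rw [h2, norm_sub_rev] at h3
  exact h3

lemma mapExtInv_eq (H : LocalMap q ρ h ε Θ T c) {x y : Space d} (hx : x ∈ nearSet h T)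
    (hy : y ∈ closedBall c (3 * h)) (hyx : mapExt q Θ T y = x) : mapExtInv q h Θ T x = y := by
  obtain ⟨h1, h2, -⟩ := H.mapExtInv_spec hx
  exact H.near.injOn h1 hy (h2.trans hyx.symm)

lemma norm_sub_self_le (H : LocalMap q ρ h ε Θ T c) {y : Space d} (hy : y ∈ simplex T) :
    ‖Θ y - y‖ ≤ ε := by
  rw [← H.eq_on y hy]
  exact H.near.dist_le y (H.simplex_subset hy)

lemma image_subset_nearSet (H : LocalMap q ρ h ε Θ T c) : Θ '' simplex T ⊆ nearSet h T := by
  rintro _ ⟨y, hy, rfl⟩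
  refine ⟨y, hy, ?_⟩
  rw [dist_eq_norm]
  linarith [H.norm_sub_self_le hy, H.eps_le, H.h_pos]

/-- The image of a neighbouring element is in the region where the inverse is defined. -/
lemma image_subset_nearSet_of_inter (H : LocalMap q ρ h ε Θ T c) {T' : Finset (Space d)}
    {c' : Space d} {Θ' : Space d → Space d} (H' : LocalMap q ρ h ε Θ' T' c') {V : Space d}
    (hV : V ∈ T) (hV' : V ∈ T') : Θ' '' simplex T' ⊆ nearSet h T := by
  rintro _ ⟨y, hy, rfl⟩
  refine ⟨V, subset_convexHull ℝ _ hV, ?_⟩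
  have h1 := dist_le_of_mem_simplex H'.diam_le hy (subset_convexHull ℝ _ hV')
  have h2 := H'.norm_sub_self_le hy
  rw [← dist_eq_norm] at h2
  have := dist_triangle (Θ' y) y V
  linarith [H.eps_le, H.h_pos]

lemma simplex_subset_nearSet_of_inter (H : LocalMap q ρ h ε Θ T c) {T' : Finset (Space d)}
    {c' : Space d} {Θ' : Space d → Space d} (H' : LocalMap q ρ h ε Θ' T' c') {V : Space d}
    (hV : V ∈ T) (hV' : V ∈ T') : simplex T' ⊆ nearSet h T := by
  intro y hy
  refine ⟨V, subset_convexHull ℝ _ hV, ?_⟩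
  have h1 := dist_le_of_mem_simplex H'.diam_le hy (subset_convexHull ℝ _ hV')
  linarith [H.h_pos]

lemma mapExtInv_apply (H : LocalMap q ρ h ε Θ T c) {y : Space d} (hy : y ∈ simplex T) :
    mapExtInv q h Θ T (Θ y) = y :=
  H.mapExtInv_eq (H.image_subset_nearSet ⟨y, hy, rfl⟩) (H.simplex_subset hy) (H.eq_on y hy)

lemma norm_mapExtInv_sub_le (H : LocalMap q ρ h ε Θ T c) {x y : Space d} (hx : x ∈ nearSet h T)
    (hy : y ∈ nearSet h T) : ‖mapExtInv q h Θ T x - mapExtInv q h Θ T y‖ ≤ 2 * ‖x - y‖ := by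
  obtain ⟨h1, h2, -⟩ := H.mapExtInv_spec hx
  obtain ⟨h3, h4, -⟩ := H.mapExtInv_spec hy
  have := H.near.norm_sub_le h1 h3
  rwa [h2, h4] at this

lemma continuousOn_mapExtInv (H : LocalMap q ρ h ε Θ T c) :
    ContinuousOn (mapExtInv q h Θ T) (nearSet h T) := by
  have : LipschitzOnWith 2 (mapExtInv q h Θ T) (nearSet h T) :=
    LipschitzOnWith.of_dist_le_mul fun a ha b hb => by
      rw [dist_eq_norm, dist_eq_norm]
      simpa using H.norm_mapExtInv_sub_le ha hb
  exact this.continuousOn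

lemma isCompact_image (H : LocalMap q ρ h ε Θ T c) : IsCompact (Θ '' simplex T) := by
  rw [← Set.image_congr H.eq_on]
  exact (isCompact_simplex T).image H.contDiff.continuous

lemma volume_image_eq_zero_iff (H : LocalMap q ρ h ε Θ T c) {A : Set (Space d)}
    (hA : A ⊆ simplex T) : volume (Θ '' A) = 0 ↔ volume A = 0 := by
  rw [← H.near.volume_image_eq_zero_iff (hA.trans H.simplex_subset),
    Set.image_congr fun y hy => H.eq_on y (hA hy)]

/-- Points of the concentric smaller ball are images of points of the element. -/
lemma mapExtInv_mem_simplex (H : LocalMap q ρ h ε Θ T c) {x : Space d}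
    (hx : x ∈ closedBall c (3 / 4 * (ρ * h))) :
    x ∈ nearSet h T ∧ mapExtInv q h Θ T x ∈ simplex T ∧ Θ (mapExtInv q h Θ T x) = x := by
  have hxT : x ∈ simplex T :=
    H.ball_subset (closedBall_subset_closedBall (by linarith [H.rho_h_nonneg]) hx)
  have hxn := H.simplex_subset_nearSet hxT
  obtain ⟨-, h2, h3⟩ := H.mapExtInv_spec hxn
  have h4 : mapExtInv q h Θ T x ∈ simplex T := by
    -- The inverse moves the point by `ε ≤ ρ h / 8`, which fits into the remaining margin `ρ h / 4`.
    refine H.ball_subset ?_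
    rw [mem_closedBall] at hx ⊢
    rw [← dist_eq_norm] at h3
    have := dist_triangle (mapExtInv q h Θ T x) x c
    linarith [H.eps_le', H.rho_h_nonneg]
  exact ⟨hxn, h4, by rw [← H.eq_on _ h4, h2]⟩

lemma closedBall_subset_image (H : LocalMap q ρ h ε Θ T c) :
    closedBall c (3 / 4 * (ρ * h)) ⊆ Θ '' simplex T := fun _ hx =>
  ⟨_, (H.mapExtInv_mem_simplex hx).2⟩

end LocalMap

end Extension

/-! ### Uniform control of the deformations -/

namespace Triangulation

variable {d : ℕ} {M : Triangulation d}

/-- For small mesh size all extended element maps are close to the identity. -/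
theorem exists_localMap (d q : ℕ) (hq : 1 ≤ q) {ρ : ℝ} (hρ : 0 < ρ) (C : ℝ) :
    ∃ K > 0, ∀ (M : Triangulation d) (h : ℝ), M.QuasiUniform ρ h → K * h ≤ 1 / 4 →
      K * h ≤ ρ / 8 → ∀ φ Θ, M.IsDeformation q C h φ Θ → ∀ T ∈ M.elements, ∀ c,
        closedBall c (ρ * h) ⊆ simplex T → LocalMap q ρ h (K * h ^ 2) Θ T c := by
  -- The sign of `C` is not prescribed, hence the absolute value. The factor `3` covers the
  -- `2h`-neighbourhood of an element of diameter at most `h`.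
  obtain ⟨K, hK, hnear⟩ := exists_nearId_polyMap d q hρ (abs_nonneg C) hq 3
  refine ⟨K, hK, fun M h hM hKh hKρ φ Θ hΘ T hT c hc => ?_⟩
  have hh := hM.pos
  have hE := isElement hT
  have hp : ∀ i, ∃ p, IsPolyOn q (simplex T) (fun x => Θ x i) p := fun i =>
    (hΘ.mem_feSpace i).2 T hT
  choose P hP using hp
  have hmap : mapExt q Θ T = polyMap P := by
    funext x
    rw [mapExt, polyMap]
    congr 1
    funext i
    rw [hE.polyExt_eq hq (lagrangeNodes_subset_simplex hq T) (hP i).1 (hP i).2]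
  have heq : ∀ y ∈ simplex T, polyMap P y = Θ y := by
    intro y hy
    ext i
    exact (hP i).2 y hy
  refine ⟨hh, by positivity, by nlinarith, by nlinarith, hc, hM.diam_le T hT, ?_, ?_, ?_⟩
  · rw [hmap]; exact contDiff_polyMap P
  · rw [hmap]; exact heq
  · rw [hmap]
    refine hnear P (fun i => (hP i).1) c h hh (by linarith) fun x hx => ?_
    rw [heq x (hc hx)]
    refine (hΘ.near_id x (simplex_subset_domain hT (hc hx))).trans ?_
    gcongr
    exact le_abs_self C

end Triangulation

namespace Triangulation

variable {d : ℕ} {M : Triangulation d}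

/-! ### Combinatorics of the mesh -/

/-- Inscribed balls of distinct elements are disjoint. -/
lemma disjoint_ball_of_ne {T T' : Finset (Space d)} (hT : T ∈ M.elements) (hT' : T' ∈ M.elements)
    (hne : T ≠ T') {c c' : Space d} {r s : ℝ} (hrs : r < s) (hc : closedBall c s ⊆ simplex T)
    (hc' : closedBall c' s ⊆ simplex T') : Disjoint (closedBall c r) (closedBall c' r) := by
  classical
  rw [Set.disjoint_left]
  intro x hx hx'
  -- If the smaller balls met, a full neighbourhood of `x` would lie in the hull of the common
  -- vertices. The barycentric coordinate of a vertex missing from `T'` would vanish there, hence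
  -- identically, although it is `1` at that vertex.
  have hsub : ∀ y ∈ ball x (s - r), y ∈ simplex (T ∩ T') := by
    intro y hy
    refine mem_simplex_inter hT hT' (hc ?_) (hc' ?_)
    all_goals
      rw [mem_ball] at hy
      rw [mem_closedBall] at *
    · linarith [dist_triangle y x c]
    · linarith [dist_triangle y x c']
  have hE := isElement hT
  obtain ⟨V, hV, hV'⟩ : ∃ V ∈ T, V ∉ T' := by
    by_contra! hcon
    exact hne (Finset.eq_of_subset_of_card_le hcon (by rw [hE.card_eq, (isElement hT').card_eq]))
  have h0 : affinePoly (hE.bary V) = 0 := by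
    refine eq_zero_of_evalAt_eq_zero_on_ball (c := x) (sub_pos.2 hrs) fun y hy => ?_
    obtain ⟨w, -, hw1, rfl⟩ := mem_simplex_iff.1 (hsub y hy)
    rw [evalAt_affinePoly]
    exact (hE.bary_face Finset.inter_subset_left hw1).2 V hV
      fun h => hV' (Finset.mem_inter.1 h).2
  have h1 := hE.bary_combination (w := Pi.single V 1) (by simp [hV]) hV
  rw [← evalAt_affinePoly, h0] at h1
  simp at h1

lemma volume_real_closedBall (c : Space d) {r : ℝ} (hr : 0 ≤ r) :
    volume.real (closedBall c r) = r ^ d * volume.real (ball (0 : Space d) 1) := by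
  rw [Measure.real, Measure.addHaar_closedBall _ _ hr, ENNReal.toReal_mul,
    ENNReal.toReal_ofReal (by positivity)]
  simp [Measure.real]

lemma volume_real_unitBall_pos : 0 < volume.real (ball (0 : Space d) 1) :=
  ENNReal.toReal_pos (measure_ball_pos _ _ one_pos).ne' measure_ball_lt_top.ne

/-- Only a bounded number of elements have their centre close to a given point. -/
lemma card_le_of_centers (hρ : 0 < ρ) {h : ℝ} (hh : 0 < h) {ctr : Finset (Space d) → Space d}
    (hctr : ∀ T ∈ M.elements, closedBall (ctr T) (ρ * h) ⊆ simplex T)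
    {S : Finset (Finset (Space d))} (hS : S ⊆ M.elements) {x : Space d} {R : ℝ} (hR : 0 ≤ R)
    (hx : ∀ T ∈ S, dist (ctr T) x ≤ R * h) :
    (S.card : ℝ) ≤ ((R + ρ) / (ρ / 2)) ^ d := by
  set ω := volume.real (ball (0 : Space d) 1) with hω
  have hωp : 0 < ω := volume_real_unitBall_pos
  -- Packing: balls of half the inscribed radius are disjoint and all lie in one ball of radius `(R
  -- + ρ) h`, so their volumes bound their number.
  have h1 : volume.real (⋃ T ∈ S, closedBall (ctr T) (ρ / 2 * h))
      = ∑ T ∈ S, volume.real (closedBall (ctr T) (ρ / 2 * h)) := by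
    refine measureReal_biUnion_finset (fun T hT T' hT' hne => ?_)
      (fun T _ => measurableSet_closedBall) (fun T _ => measure_closedBall_lt_top.ne)
    refine disjoint_ball_of_ne (hS hT) (hS hT') hne ?_ (hctr T (hS hT)) (hctr T' (hS hT'))
    nlinarith
  have h2 : volume.real (⋃ T ∈ S, closedBall (ctr T) (ρ / 2 * h))
      ≤ volume.real (closedBall x ((R + ρ) * h)) := by
    refine measureReal_mono (Set.iUnion₂_subset fun T hT => ?_) measure_closedBall_lt_top.ne
    refine closedBall_subset_closedBall' ?_
    have := hx T hT
    nlinarith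
  rw [h1] at h2
  simp only [volume_real_closedBall _ (show 0 ≤ ρ / 2 * h by positivity),
    volume_real_closedBall _ (show 0 ≤ (R + ρ) * h by positivity), Finset.sum_const,
    nsmul_eq_mul, ← mul_assoc] at h2
  have h3 := le_of_mul_le_mul_right h2 hωp
  rw [mul_pow, mul_pow, ← mul_assoc] at h3
  have h4 := le_of_mul_le_mul_right h3 (by positivity)
  rw [div_pow, le_div_iff₀ (by positivity)]
  exact h4

lemma mem_addLayer {S : Finset (Finset (Space d))} {T : Finset (Space d)} :
    T ∈ M.addLayer S ↔ T ∈ M.elements ∧ ∃ T' ∈ S, ∃ V, V ∈ T ∧ V ∈ T' := by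
  simp [addLayer]

lemma addLayer_mono {S S' : Finset (Finset (Space d))} (h : S ⊆ S') :
    M.addLayer S ⊆ M.addLayer S' := by
  intro T hT
  obtain ⟨h1, T', hT', h2⟩ := mem_addLayer.1 hT
  exact mem_addLayer.2 ⟨h1, T', h hT', h2⟩

lemma addLayer_subset_elements (S : Finset (Finset (Space d))) : M.addLayer S ⊆ M.elements :=
  Finset.filter_subset _ _

lemma subset_addLayer {S : Finset (Finset (Space d))} (hS : S ⊆ M.elements) :
    S ⊆ M.addLayer S := by
  intro T hT
  obtain ⟨V, hV⟩ : T.Nonempty := Finset.card_pos.1 (by rw [(isElement (hS hT)).card_eq]; lia)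
  exact mem_addLayer.2 ⟨hS hT, T, hT, V, hV, hV⟩

/-- Deformations preserve null sets, so the element selections depend only on the undeformed level
set and can be compared between two time levels with different deformations. -/
lemma volume_inter_pos_iff {q : ℕ} {ρ h ε : ℝ} {Θ : Space d → Space d} {T : Finset (Space d)}
    {c : Space d} (H : LocalMap q ρ h ε Θ T c) (hΘ : Set.InjOn Θ M.domain) (hT : T ∈ M.elements)
    {S : Set (Space d)} (hS : S ⊆ M.domain) :
    0 < volume (Θ '' simplex T ∩ Θ '' S) ↔ 0 < volume (simplex T ∩ S) := by
  rw [← hΘ.image_inter (simplex_subset_domain hT) hS, pos_iff_ne_zero, pos_iff_ne_zero, ne_eq,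
    ne_eq, H.volume_image_eq_zero_iff Set.inter_subset_left]

/-! ### Inclusion of element and facet sets between consecutive time levels -/

section TimeStep

variable {q : ℕ} {ρ h ε δ : ℝ} {φ ψ : Space d → ℝ} {Θ Ψ : Space d → Space d}
  {ctr : Finset (Space d) → Space d}

lemma linSublevel_subset (hφ : ∀ x ∈ M.domain, |M.linLevelSet φ x - M.linLevelSet ψ x| ≤ δ)
    {a b : ℝ} (hab : a + δ ≤ b) : M.linSublevel φ a ⊆ M.linSublevel ψ b := fun x hx =>
  ⟨hx.1, by linarith [hx.2, (abs_le.1 (hφ x hx.1)).1]⟩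

lemma activeElements_subset (hφ : ∀ x ∈ M.domain, |M.linLevelSet φ x - M.linLevelSet ψ x| ≤ δ)
    (hΘ : Set.InjOn Θ M.domain) (hΨ : Set.InjOn Ψ M.domain)
    (H : ∀ T ∈ M.elements, LocalMap q ρ h ε Θ T (ctr T))
    (H' : ∀ T ∈ M.elements, LocalMap q ρ h ε Ψ T (ctr T)) {a b : ℝ} (hab : a + δ ≤ b) :
    M.activeElements φ Θ a ⊆ M.activeElements ψ Ψ b := by
  intro T hT
  obtain ⟨hTM, hpos⟩ := Finset.mem_filter.1 hT
  refine Finset.mem_filter.2 ⟨hTM, ?_⟩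
  rw [extendedDomain, volume_inter_pos_iff (H T hTM) hΘ hTM fun x hx => hx.1] at hpos
  rw [extendedDomain, volume_inter_pos_iff (H' T hTM) hΨ hTM fun x hx => hx.1]
  exact hpos.trans_le (measure_mono (Set.inter_subset_inter_right _ (linSublevel_subset hφ hab)))

lemma stripElements_subset (hφ : ∀ x ∈ M.domain, |M.linLevelSet φ x - M.linLevelSet ψ x| ≤ δ)
    (hΘ : Set.InjOn Θ M.domain) (hΨ : Set.InjOn Ψ M.domain)
    (H : ∀ T ∈ M.elements, LocalMap q ρ h ε Θ T (ctr T))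
    (H' : ∀ T ∈ M.elements, LocalMap q ρ h ε Ψ T (ctr T)) {a b : ℝ} (hab : a + δ ≤ b) :
    M.stripElements φ Θ a ⊆ M.stripElements ψ Ψ b := by
  intro T hT
  obtain ⟨hTM, hpos⟩ := Finset.mem_filter.1 hT
  refine Finset.mem_filter.2 ⟨hTM, ?_⟩
  rw [strip, volume_inter_pos_iff (H T hTM) hΘ hTM fun x hx => hx.1.1] at hpos
  rw [strip, volume_inter_pos_iff (H' T hTM) hΨ hTM fun x hx => hx.1.1]
  refine hpos.trans_le (measure_mono (Set.inter_subset_inter_right _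
    (Set.sdiff_subset_sdiff (linSublevel_subset hφ hab) ?_)))
  -- The removed inner set must shrink, so here the roles of `φ` and `ψ` are exchanged.
  refine linSublevel_subset (fun x hx => ?_) (by linarith : -b + δ ≤ -a)
  rw [abs_sub_comm]
  exact hφ x hx

/-- Passing from `r = 1` to `r = 2` provides one more `δ`, spent on the motion of the level set, and
one more layer, spent on the neighbours that the averaging operator sees. -/
lemma addLayer_stripLayered_subset
    (hφ : ∀ x ∈ M.domain, |M.linLevelSet φ x - M.linLevelSet ψ x| ≤ δ)
    (hΘ : Set.InjOn Θ M.domain) (hΨ : Set.InjOn Ψ M.domain)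
    (H : ∀ T ∈ M.elements, LocalMap q ρ h ε Θ T (ctr T))
    (H' : ∀ T ∈ M.elements, LocalMap q ρ h ε Ψ T (ctr T)) :
    M.addLayer (M.stripLayered φ Θ δ 1) ⊆ M.stripLayered ψ Ψ δ 2 := by
  simp only [stripLayered, Function.iterate_succ, Function.iterate_zero, Function.comp, id]
  refine addLayer_mono (addLayer_mono (stripElements_subset hφ hΘ hΨ H H' ?_))
  push_cast
  linarith

lemma stripLayered_subset
    (hφ : ∀ x ∈ M.domain, |M.linLevelSet φ x - M.linLevelSet ψ x| ≤ δ)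
    (hΘ : Set.InjOn Θ M.domain) (hΨ : Set.InjOn Ψ M.domain)
    (H : ∀ T ∈ M.elements, LocalMap q ρ h ε Θ T (ctr T))
    (H' : ∀ T ∈ M.elements, LocalMap q ρ h ε Ψ T (ctr T)) :
    M.stripLayered φ Θ δ 1 ⊆ M.stripLayered ψ Ψ δ 2 :=
  (subset_addLayer (by
    simp only [stripLayered, Function.iterate_succ, Function.iterate_zero, Function.comp, id]
    exact addLayer_subset_elements _)).trans (addLayer_stripLayered_subset hφ hΘ hΨ H H')

lemma activeLayered_subset
    (hφ : ∀ x ∈ M.domain, |M.linLevelSet φ x - M.linLevelSet ψ x| ≤ δ)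
    (hΘ : Set.InjOn Θ M.domain) (hΨ : Set.InjOn Ψ M.domain)
    (H : ∀ T ∈ M.elements, LocalMap q ρ h ε Θ T (ctr T))
    (H' : ∀ T ∈ M.elements, LocalMap q ρ h ε Ψ T (ctr T)) :
    M.activeLayered φ Θ δ 1 ⊆ M.activeLayered ψ Ψ δ 2 := by
  simp only [activeLayered, Function.iterate_succ, Function.iterate_zero, Function.comp, id]
  refine (subset_addLayer (addLayer_subset_elements _)).trans
    (addLayer_mono (addLayer_mono (activeElements_subset hφ hΘ hΨ H H' ?_)))
  push_cast
  linarith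

lemma activeFacets_subset
    (hφ : ∀ x ∈ M.domain, |M.linLevelSet φ x - M.linLevelSet ψ x| ≤ δ)
    (hΘ : Set.InjOn Θ M.domain) (hΨ : Set.InjOn Ψ M.domain)
    (H : ∀ T ∈ M.elements, LocalMap q ρ h ε Θ T (ctr T))
    (H' : ∀ T ∈ M.elements, LocalMap q ρ h ε Ψ T (ctr T)) :
    M.activeFacets φ Θ δ 1 ⊆ M.activeFacets ψ Ψ δ 2 := by
  classical
  refine Finset.image_subset_image (Finset.filter_subset_filter _ ?_)
  exact Finset.product_subset_product (activeLayered_subset hφ hΘ hΨ H H')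
    (stripLayered_subset hφ hΘ hΨ H H')

end TimeStep

end Triangulation

/-! ### Ghost penalty of a single facet -/

section Facet

variable {d : ℕ} {k q : ℕ} {ρ h ε : ℝ} {Θ : Space d → Space d} {T : Finset (Space d)} {c : Space d}
  {v : Space d → ℝ} {p : MvPolynomial (Fin d) ℝ}

lemma LocalMap.mappedExt_eq (_H : LocalMap q ρ h ε Θ T c) (hT : IsElement T) (hk : 1 ≤ k)
    (hp : IsPolyOn k (simplex T) (v ∘ Θ) p) (x : Space d) :
    mappedExt k q h Θ T v x = evalAt p (mapExtInv q h Θ T x) := by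
  rw [mappedExt, hT.polyExt_eq hk (lagrangeNodes_subset_simplex hk T) hp.1 hp.2]

/-- The extension is `p` evaluated at the preimage of `x`, which is within `ε` of `x`. This lets
mapped polynomials be replaced by polynomials on the undeformed element. -/
lemma LocalMap.abs_mappedExt_sub_le (H : LocalMap q ρ h ε Θ T c) (hT : IsElement T) (hk : 1 ≤ k)
    (hp : IsPolyOn k (simplex T) (v ∘ Θ) p) {g : ℝ}
    (hg : ∀ x ∈ closedBall c (3 * h), ‖evalGrad p x‖ ≤ g) {x : Space d} (hx : x ∈ nearSet h T) :
    |mappedExt k q h Θ T v x - evalAt p x| ≤ g * ε := by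
  rw [H.mappedExt_eq hT hk hp]
  obtain ⟨h1, -, h2⟩ := H.mapExtInv_spec hx
  have hg0 : 0 ≤ g := (norm_nonneg _).trans (hg _ h1)
  exact (abs_evalAt_sub_le hg h1 (H.nearSet_subset hx)).trans (by gcongr)

lemma LocalMap.continuousOn_mappedExt (H : LocalMap q ρ h ε Θ T c) (hT : IsElement T) (hk : 1 ≤ k)
    (hp : IsPolyOn k (simplex T) (v ∘ Θ) p) :
    ContinuousOn (mappedExt k q h Θ T v) (nearSet h T) := by
  have : mappedExt k q h Θ T v = evalAt p ∘ mapExtInv q h Θ T := by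
    funext x
    exact H.mappedExt_eq hT hk hp x
  rw [this]
  exact (continuous_evalAt p).comp_continuousOn H.continuousOn_mapExtInv

lemma facetPenalty_self (k q : ℕ) (h : ℝ) (Θ : Space d → Space d) (v : Space d → ℝ)
    (T₁ T₂ : Finset (Space d)) :
    facetPenalty k q h Θ v v s(T₁, T₂) = 1 / h ^ 2 * ∫ x in Θ '' simplex T₁ ∪ Θ '' simplex T₂,
      (mappedExt k q h Θ T₁ v x - mappedExt k q h Θ T₂ v x) ^ 2 := by
  simp only [facetPenalty, Sym2.lift_mk, pow_two]

lemma facetPenalty_self_nonneg (k q : ℕ) (h : ℝ) (Θ : Space d → Space d) (v : Space d → ℝ)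
    (F : Sym2 (Finset (Space d))) : 0 ≤ facetPenalty k q h Θ v v F := by
  induction F with
  | _ T₁ T₂ =>
    rw [facetPenalty_self]
    exact mul_nonneg (by positivity) (integral_nonneg fun x => sq_nonneg _)

/-- The facet contribution controls the difference of the polynomials of both elements. -/
lemma setIntegral_sub_sq_le (hk : 1 ≤ k) {T₁ T₂ : Finset (Space d)} {c₁ c₂ V : Space d}
    (hT₁ : IsElement T₁) (hT₂ : IsElement T₂) (hV₁ : V ∈ T₁) (hV₂ : V ∈ T₂)
    (H₁ : LocalMap q ρ h ε Θ T₁ c₁) (H₂ : LocalMap q ρ h ε Θ T₂ c₂)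
    {p₁ p₂ : MvPolynomial (Fin d) ℝ} (hp₁ : IsPolyOn k (simplex T₁) (v ∘ Θ) p₁)
    (hp₂ : IsPolyOn k (simplex T₂) (v ∘ Θ) p₂) {g : ℝ}
    (hg₁ : ∀ x ∈ closedBall c₁ (3 * h), ‖evalGrad p₁ x‖ ≤ g)
    (hg₂ : ∀ x ∈ closedBall c₂ (3 * h), ‖evalGrad p₂ x‖ ≤ g) :
    ∫ x in closedBall c₁ (ρ / 2 * h), evalAt (p₁ - p₂) x ^ 2 ≤
      2 * h ^ 2 * facetPenalty k q h Θ v v s(T₁, T₂) +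
        8 * (g * ε) ^ 2 * ((ρ / 2 * h) ^ d * volume.real (ball (0 : Space d) 1)) := by
  set b := closedBall c₁ (ρ / 2 * h) with hb
  have hh := H₁.h_pos
  have hρh := H₁.rho_h_nonneg
  set w : Space d → ℝ := fun x => mappedExt k q h Θ T₁ v x - mappedExt k q h Θ T₂ v x with hw
  have hbT : b ⊆ simplex T₁ :=
    (closedBall_subset_closedBall (by linarith)).trans H₁.ball_subset
  have hb1 : b ⊆ nearSet h T₁ := hbT.trans H₁.simplex_subset_nearSet
  have hb2 : b ⊆ nearSet h T₂ := hbT.trans (H₂.simplex_subset_nearSet_of_inter H₁ hV₂ hV₁)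
  have hwc : ContinuousOn w (nearSet h T₁ ∩ nearSet h T₂) :=
    ((H₁.continuousOn_mappedExt hT₁ hk hp₁).mono Set.inter_subset_left).sub
      ((H₂.continuousOn_mappedExt hT₂ hk hp₂).mono Set.inter_subset_right)
  have hU : Θ '' simplex T₁ ∪ Θ '' simplex T₂ ⊆ nearSet h T₁ ∩ nearSet h T₂ :=
    Set.union_subset
      (Set.subset_inter H₁.image_subset_nearSet (H₂.image_subset_nearSet_of_inter H₁ hV₂ hV₁))
      (Set.subset_inter (H₁.image_subset_nearSet_of_inter H₂ hV₁ hV₂) H₂.image_subset_nearSet)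
  have hint : IntegrableOn (fun x => w x ^ 2) (Θ '' simplex T₁ ∪ Θ '' simplex T₂) :=
    ((hwc.mono hU).pow 2).integrableOn_compact (H₁.isCompact_image.union H₂.isCompact_image)
  -- The ball of radius `ρ h / 2` was chosen to lie inside the deformed element, which contains the
  -- ball of radius `3 ρ h / 4`.
  have hbU : b ⊆ Θ '' simplex T₁ ∪ Θ '' simplex T₂ :=
    ((closedBall_subset_closedBall (by linarith)).trans H₁.closedBall_subset_image).trans
      Set.subset_union_left
  have hI : ∫ x in b, w x ^ 2 ≤ h ^ 2 * facetPenalty k q h Θ v v s(T₁, T₂) := by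
    have : h ^ 2 * facetPenalty k q h Θ v v s(T₁, T₂)
        = ∫ x in Θ '' simplex T₁ ∪ Θ '' simplex T₂, w x ^ 2 := by
      rw [facetPenalty_self]; field_simp; rfl
    rw [this]
    exact setIntegral_mono_set hint (Filter.Eventually.of_forall fun x => sq_nonneg _)
      hbU.eventuallyLE
  -- Each extension contributes an error `g ε`; with `(a + b)² ≤ 2a² + 2b²` the total error `2 g ε`
  -- produces the factor `8`.
  have hpt : ∀ x ∈ b, evalAt (p₁ - p₂) x ^ 2 ≤ 2 * w x ^ 2 + 8 * (g * ε) ^ 2 := by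
    intro x hx
    have h1 := abs_le.1 (H₁.abs_mappedExt_sub_le hT₁ hk hp₁ hg₁ (hb1 hx))
    have h2 := abs_le.1 (H₂.abs_mappedExt_sub_le hT₂ hk hp₂ hg₂ (hb2 hx))
    have h3 : (evalAt (p₁ - p₂) x - w x) ^ 2 ≤ (2 * (g * ε)) ^ 2 := by
      refine sq_le_sq' ?_ ?_ <;> simp only [hw, evalAt_sub] <;> linarith [h1.1, h1.2, h2.1, h2.2]
    nlinarith [sq_nonneg (evalAt (p₁ - p₂) x - 2 * w x)]
  have hintb : IntegrableOn (fun x => w x ^ 2) b := hint.mono_set hbU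
  have hconst : IntegrableOn (fun _ : Space d => 8 * (g * ε) ^ 2) b :=
    integrableOn_const (measure_closedBall_lt_top.ne)
  calc ∫ x in b, evalAt (p₁ - p₂) x ^ 2 ≤ ∫ x in b, (2 * w x ^ 2 + 8 * (g * ε) ^ 2) := by
        refine setIntegral_mono_on ?_ ((hintb.const_mul 2).add hconst) measurableSet_closedBall hpt
        exact ((continuous_evalAt _).pow 2).continuousOn.integrableOn_compact
          (isCompact_closedBall _ _)
    _ = 2 * (∫ x in b, w x ^ 2) + 8 * (g * ε) ^ 2 * volume.real b := by
        rw [integral_add (hintb.const_mul 2) hconst, integral_const_mul, setIntegral_const,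
          smul_eq_mul, mul_comm (volume.real b)]
    _ ≤ _ := by
        rw [hb, Triangulation.volume_real_closedBall _ (by linarith)]
        nlinarith

/-- The ghost penalty of a facet is controlled by the one of another function on another deformed
mesh if the polynomials of both functions on the undeformed elements are close. -/
theorem exists_facetPenalty_le (d k : ℕ) (hk : 1 ≤ k) {ρ : ℝ} (hρ : 0 < ρ) :
    ∃ A > 0, ∀ (q : ℕ) (h ε : ℝ) (Θ Ψ : Space d → Space d) (T₁ T₂ : Finset (Space d))
      (c₁ c₂ V : Space d) (u v : Space d → ℝ) (u₁ u₂ p₁ p₂ : MvPolynomial (Fin d) ℝ) (a g : ℝ),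
      IsElement T₁ → IsElement T₂ → V ∈ T₁ → V ∈ T₂ →
      LocalMap q ρ h ε Θ T₁ c₁ → LocalMap q ρ h ε Θ T₂ c₂ →
      LocalMap q ρ h ε Ψ T₁ c₁ → LocalMap q ρ h ε Ψ T₂ c₂ →
      IsPolyOn k (simplex T₁) (u ∘ Θ) u₁ → IsPolyOn k (simplex T₂) (u ∘ Θ) u₂ →
      IsPolyOn k (simplex T₁) (v ∘ Ψ) p₁ → IsPolyOn k (simplex T₂) (v ∘ Ψ) p₂ →
      (∀ x ∈ closedBall c₁ (3 * h), |evalAt u₁ x - evalAt p₁ x| ≤ a) →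
      (∀ x ∈ closedBall c₂ (3 * h), |evalAt u₂ x - evalAt p₂ x| ≤ a) →
      (∀ x ∈ closedBall c₁ (3 * h), ‖evalGrad u₁ x‖ ≤ g) →
      (∀ x ∈ closedBall c₂ (3 * h), ‖evalGrad u₂ x‖ ≤ g) →
      (∀ x ∈ closedBall c₁ (3 * h), ‖evalGrad p₁ x‖ ≤ g) →
      (∀ x ∈ closedBall c₂ (3 * h), ‖evalGrad p₂ x‖ ≤ g) →
      facetPenalty k q h Θ u u s(T₁, T₂) ≤
        A * (facetPenalty k q h Ψ v v s(T₁, T₂) + h ^ d / h ^ 2 * (a + g * ε) ^ 2) := by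
  obtain ⟨K, hK, hinv⟩ := exists_inverse_estimate d k (half_pos hρ) 3
  set ω := volume.real (ball (0 : Space d) 1) with hω
  have hω0 : 0 < ω := Triangulation.volume_real_unitBall_pos
  refine ⟨ω * 3 ^ d * (4 * K + 16 * K * ((ρ / 2) ^ d * ω) + 8), by positivity, ?_⟩
  intro q h ε Θ Ψ T₁ T₂ c₁ c₂ V u v u₁ u₂ p₁ p₂ a g hT₁ hT₂ hV₁ hV₂ H₁ H₂ H₁' H₂' hu₁ hu₂ hp₁ hp₂
    ha₁ ha₂ hgu₁ hgu₂ hgp₁ hgp₂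
  have hh := H₁.h_pos
  have hε := H₁.eps_nonneg
  have hc : c₁ ∈ closedBall c₁ (3 * h) := mem_closedBall_self (by linarith)
  have hg0 : 0 ≤ g := (norm_nonneg _).trans (hgp₁ _ hc)
  have ha0 : 0 ≤ a := (abs_nonneg _).trans (ha₁ _ hc)
  set FP := facetPenalty k q h Ψ v v s(T₁, T₂) with hFP
  have hFP0 : 0 ≤ FP := facetPenalty_self_nonneg _ _ _ _ _ _
  have hI := setIntegral_sub_sq_le hk hT₁ hT₂ hV₁ hV₂ H₁' H₂' hp₁ hp₂ hgp₁ hgp₂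
  rw [← hFP, ← hω] at hI
  -- `B` bounds `(p₁ - p₂)²` on the whole `3h`-ball: the inverse estimate spreads the control from
  -- the small ball, where the old penalty provides it.
  set B := K * ((h ^ d)⁻¹ * (2 * h ^ 2 * FP + 8 * (g * ε) ^ 2 * ((ρ / 2 * h) ^ d * ω))) with hB
  have hB0 : 0 ≤ B := by positivity
  have hU : Θ '' simplex T₁ ∪ Θ '' simplex T₂ ⊆ nearSet h T₁ ∩ nearSet h T₂ :=
    Set.union_subset
      (Set.subset_inter H₁.image_subset_nearSet (H₂.image_subset_nearSet_of_inter H₁ hV₂ hV₁))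
      (Set.subset_inter (H₁.image_subset_nearSet_of_inter H₂ hV₁ hV₂) H₂.image_subset_nearSet)
  have hsup : ∀ x ∈ Θ '' simplex T₁ ∪ Θ '' simplex T₂,
      ‖(mappedExt k q h Θ T₁ u x - mappedExt k q h Θ T₂ u x) ^ 2‖
        ≤ 2 * B + 8 * (a + g * ε) ^ 2 := by
    intro x hx
    obtain ⟨hx1, hx2⟩ := hU hx
    have h1 := abs_le.1 (H₁.abs_mappedExt_sub_le hT₁ hk hu₁ hgu₁ hx1)
    have h2 := abs_le.1 (H₂.abs_mappedExt_sub_le hT₂ hk hu₂ hgu₂ hx2)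
    have h3 := abs_le.1 (ha₁ x (H₁.nearSet_subset hx1))
    have h4 := abs_le.1 (ha₂ x (H₂.nearSet_subset hx2))
    have h5 : evalAt (p₁ - p₂) x ^ 2 ≤ B := by
      refine (hinv c₁ h hh _ ((MvPolynomial.totalDegree_sub _ _).trans (max_le hp₁.1 hp₂.1)) x
        (H₁.nearSet_subset hx1)).1.trans ?_
      rw [hB]
      gcongr
    have h6 : (mappedExt k q h Θ T₁ u x - mappedExt k q h Θ T₂ u x - evalAt (p₁ - p₂) x) ^ 2
        ≤ (2 * (a + g * ε)) ^ 2 := by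
      refine sq_le_sq' ?_ ?_ <;> simp only [evalAt_sub] <;>
        linarith [h1.1, h1.2, h2.1, h2.2, h3.1, h3.2, h4.1, h4.2]
    rw [Real.norm_of_nonneg (sq_nonneg _)]
    nlinarith [sq_nonneg (mappedExt k q h Θ T₁ u x - mappedExt k q h Θ T₂ u x
      - 2 * evalAt (p₁ - p₂) x)]
  -- The integral is estimated by supremum times volume; the patch lies in the `3h`-ball about `c₁`.
  have hvol : volume.real (Θ '' simplex T₁ ∪ Θ '' simplex T₂) ≤ (3 * h) ^ d * ω := by
    rw [hω, ← Triangulation.volume_real_closedBall c₁ (by linarith)]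
    exact measureReal_mono (hU.trans (Set.inter_subset_left.trans H₁.nearSet_subset))
      measure_closedBall_lt_top.ne
  have hint := norm_setIntegral_le_of_norm_le_const (μ := volume)
    (H₁.isCompact_image.union H₂.isCompact_image).measure_lt_top hsup
  rw [facetPenalty_self]
  have h7 : ∫ x in Θ '' simplex T₁ ∪ Θ '' simplex T₂,
      (mappedExt k q h Θ T₁ u x - mappedExt k q h Θ T₂ u x) ^ 2
        ≤ (2 * B + 8 * (a + g * ε) ^ 2) * ((3 * h) ^ d * ω) :=
    (le_abs_self _).trans (hint.trans (by gcongr))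
  have h8 : B = 2 * K * (h ^ 2 / h ^ d) * FP + 8 * K * ((ρ / 2) ^ d * ω) * (g * ε) ^ 2 := by
    rw [hB, mul_pow (ρ / 2)]; field_simp; 
  have h9 : (g * ε) ^ 2 ≤ (a + g * ε) ^ 2 := by
    have : 0 ≤ g * ε := by positivity
    gcongr; linarith
  set G := (a + g * ε) ^ 2 with hG
  have hG0 : 0 ≤ G := sq_nonneg _
  calc _ ≤ 1 / h ^ 2 * ((2 * B + 8 * G) * ((3 * h) ^ d * ω)) := by gcongr
    _ ≤ 1 / h ^ 2 * ((2 * (2 * K * (h ^ 2 / h ^ d) * FP + 8 * K * ((ρ / 2) ^ d * ω) * G) + 8 * G)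
          * ((3 * h) ^ d * ω)) := by
        rw [h8]; gcongr
    _ = ω * 3 ^ d * (4 * K * FP + (16 * K * ((ρ / 2) ^ d * ω) + 8) * (h ^ d / h ^ 2 * G)) := by
        rw [mul_pow]; field_simp; ring
    _ ≤ _ := by
        have e1 : 0 ≤ h ^ d / h ^ 2 * G := by positivity
        have e2 : 0 ≤ (16 * K * ((ρ / 2) ^ d * ω) + 8) * FP := by positivity
        have e3 : 0 ≤ 4 * K * (h ^ d / h ^ 2 * G) := by positivity
        rw [mul_assoc (ω * 3 ^ d)]
        refine mul_le_mul_of_nonneg_left ?_ (by positivity)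
        nlinarith

end Facet

/-! ### Gradient estimates -/

section Gradient

variable {d : ℕ} {k q : ℕ} {ρ h ε : ℝ} {Θ : Space d → Space d} {T : Finset (Space d)} {c : Space d}
  {v : Space d → ℝ} {p : MvPolynomial (Fin d) ℝ}

/-- The scaled mean square of the gradient of a polynomial in a ball. -/
def gradMean (ρ h : ℝ) (c : Space d) (p : MvPolynomial (Fin d) ℝ) : ℝ :=
  (h ^ d)⁻¹ * ∫ y in closedBall c (ρ / 2 * h), ∑ i, evalAt (MvPolynomial.pderiv i p) y ^ 2

lemma gradMean_nonneg (hh : 0 < h) (c : Space d) (p : MvPolynomial (Fin d) ℝ) :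
    0 ≤ gradMean ρ h c p :=
  mul_nonneg (by positivity) (integral_nonneg fun y => Finset.sum_nonneg fun i _ => sq_nonneg _)

lemma integrableOn_sum_pderiv_sq (c : Space d) (r : ℝ) (p : MvPolynomial (Fin d) ℝ) :
    IntegrableOn (fun y => ∑ i, evalAt (MvPolynomial.pderiv i p) y ^ 2) (closedBall c r) :=
  (continuous_finsetSum _ fun _ _ => (continuous_evalAt _).pow 2).continuousOn.integrableOn_compact
    (isCompact_closedBall _ _)

/-- First and second derivatives of a polynomial are controlled by the mean of its gradient. -/
lemma exists_evalGrad_le (d k : ℕ) {ρ : ℝ} (hρ : 0 < ρ) :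
    ∃ K > 0, ∀ (c : Space d) (h : ℝ), 0 < h → ∀ p : MvPolynomial (Fin d) ℝ, p.totalDegree ≤ k →
      ∀ x ∈ closedBall c (3 * h), ‖evalGrad p x‖ ≤ K * √(gradMean ρ h c p) ∧
        ∀ i, h * ‖evalGrad (MvPolynomial.pderiv i p) x‖ ≤ K * √(gradMean ρ h c p) := by
  obtain ⟨C, hC, hinv⟩ := exists_inverse_estimate d k (half_pos hρ) 3
  refine ⟨(d + 1) * √C, by positivity, fun c h hh p hp x hx => ?_⟩
  set G := gradMean ρ h c p with hG
  -- The inverse estimate is applied to the partial derivatives, so constants drop out and only the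
  -- gradient remains on the right.
  have hdeg := fun i => (totalDegree_pderiv_le p i).trans hp
  have hle : ∀ i, C * ((h ^ d)⁻¹ * ∫ y in closedBall c (ρ / 2 * h),
      evalAt (MvPolynomial.pderiv i p) y ^ 2) ≤ (√C * √G) ^ 2 := by
    intro i
    rw [mul_pow, Real.sq_sqrt hC.le, Real.sq_sqrt (gradMean_nonneg hh c p), gradMean]
    gcongr ?_ * (?_ * ?_)
    refine setIntegral_mono (((continuous_evalAt _).pow 2).continuousOn.integrableOn_compact
      (isCompact_closedBall _ _)) (integrableOn_sum_pderiv_sq c _ p) fun y => ?_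
    exact Finset.single_le_sum (f := fun i => evalAt (MvPolynomial.pderiv i p) y ^ 2)
      (fun i _ => sq_nonneg _) (Finset.mem_univ i)
  have hsG : 0 ≤ √C * √G := by positivity
  have hsum : ∀ f : Fin d → ℝ, (∀ i, |f i| ≤ √C * √G) → ∑ i, |f i| ≤ (d + 1) * √C * √G := by
    intro f hf
    refine (Finset.sum_le_sum fun i _ => hf i).trans ?_
    simp only [Finset.sum_const, Finset.card_univ, Fintype.card_fin, nsmul_eq_mul]
    nlinarith
  constructor
  · refine (norm_evalGrad_le p x).trans (hsum _ fun i => ?_)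
    exact abs_le_of_sq_le_sq (((hinv c h hh _ (hdeg i) x hx).1).trans (hle i)) hsG
  · intro i
    calc h * ‖evalGrad (MvPolynomial.pderiv i p) x‖
        ≤ h * ∑ j, |evalAt (MvPolynomial.pderiv j (MvPolynomial.pderiv i p)) x| := by
          gcongr; exact norm_evalGrad_le _ x
      _ = ∑ j, |h * evalAt (MvPolynomial.pderiv j (MvPolynomial.pderiv i p)) x| := by
          simp only [Finset.mul_sum, abs_mul, abs_of_pos hh]
      _ ≤ _ := hsum _ fun j =>
          abs_le_of_sq_le_sq (((hinv c h hh _ (hdeg i) x hx).2 j).trans (hle i)) hsG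

lemma norm_gradient (v : Space d → ℝ) (x : Space d) : ‖gradient v x‖ = ‖fderiv ℝ v x‖ := by
  rw [gradient, LinearIsometryEquiv.norm_map]

lemma LocalMap.apply_eq (H : LocalMap q ρ h ε Θ T c)
    (hp : IsPolyOn k (simplex T) (v ∘ Θ) p) {x : Space d} (hx : x ∈ Θ '' simplex T) :
    v x = evalAt p (mapExtInv q h Θ T x) := by
  obtain ⟨y, hy, rfl⟩ := hx
  rw [H.mapExtInv_apply hy]
  exact (hp.2 y hy).symm

/-- Inside a deformed element, the gradient of the polynomial on the undeformed element is
controlled by the gradient of the mapped function. -/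
lemma LocalMap.exists_evalGrad_le (H : LocalMap q ρ h ε Θ T c) (hρ : 0 < ρ)
    (hp : IsPolyOn k (simplex T) (v ∘ Θ) p) {x : Space d} (hx : x ∈ closedBall c (ρ / 2 * h)) :
    ∃ y ∈ closedBall c (3 * h), ‖y - x‖ ≤ ε ∧ ‖evalGrad p y‖ ≤ 2 * ‖gradient v x‖ := by
  have hh := H.h_pos
  have hρh : 0 < ρ * h := by positivity
  have hx' : x ∈ ball c (3 / 4 * (ρ * h)) := by
    rw [mem_closedBall] at hx
    rw [mem_ball]
    linarith
  have hnhds : closedBall c (3 / 4 * (ρ * h)) ∈ nhds x :=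
    Filter.mem_of_superset (isOpen_ball.mem_nhds hx') ball_subset_closedBall
  obtain ⟨hxn, hyT, -⟩ := H.mapExtInv_mem_simplex (mem_of_mem_nhds hnhds)
  set E := mapExt q Θ T
  set inv := mapExtInv q h Θ T
  obtain ⟨hyB, hEy, hyx⟩ := H.mapExtInv_spec hxn
  refine ⟨inv x, hyB, hyx, ?_⟩
  have hyball : closedBall c (3 * h) ∈ nhds (inv x) := by
    refine Filter.mem_of_superset (isOpen_ball.mem_nhds ?_) ball_subset_closedBall
    rw [mem_ball]
    have := dist_le_of_mem_simplex H.diam_le hyT H.center_mem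
    linarith
  have hEd : HasFDerivAt E (fderiv ℝ E (inv x)) (inv x) :=
    (H.contDiff.differentiable (by simp) _).hasFDerivAt
  obtain ⟨e, he⟩ := exists_equiv_of_norm_sub_id_le (H.near.norm_fderiv_sub_id_le hyball hEd)
  have hen : ‖(e : Space d →L[ℝ] Space d)‖ ≤ 2 := by
    have h1 := H.near.norm_fderiv_sub_id_le hyball hEd
    rw [← he] at h1
    have h2 := norm_add_le ((e : Space d →L[ℝ] Space d) - ContinuousLinearMap.id ℝ (Space d))
      (ContinuousLinearMap.id ℝ (Space d))
    rw [sub_add_cancel] at h2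
    have h3 : ‖ContinuousLinearMap.id ℝ (Space d)‖ ≤ 1 := ContinuousLinearMap.norm_id_le
    linarith
  have hcont : ContinuousAt inv x := by
    refine H.continuousOn_mapExtInv.continuousAt (Filter.mem_of_superset hnhds fun z hz => ?_)
    exact (H.mapExtInv_mem_simplex hz).1
  -- The inverse is continuous and the derivative of `E` is invertible, so the inverse is
  -- differentiable. The chain rule then writes the derivative of `p` as that of `v` composed with
  -- `e`, whose norm is at most `2`.
  have hinvd : HasFDerivAt inv (e.symm : Space d →L[ℝ] Space d) x := by
    refine HasFDerivAt.of_local_left_inverse hcont (by rw [he]; exact hEd) ?_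
    filter_upwards [hnhds] with z hz
    exact (H.mapExtInv_spec (H.mapExtInv_mem_simplex hz).1).2.1
  have hv : HasFDerivAt v ((evalGrad p (inv x)).comp (e.symm : Space d →L[ℝ] Space d)) x := by
    refine ((hasFDerivAt_evalAt p (inv x)).comp x hinvd).congr_of_eventuallyEq ?_
    filter_upwards [hnhds] with z hz
    exact H.apply_eq hp (H.closedBall_subset_image hz)
  have hg : evalGrad p (inv x) = (fderiv ℝ v x).comp (e : Space d →L[ℝ] Space d) := by
    rw [hv.fderiv]
    ext z
    simp
  rw [hg, norm_gradient, mul_comm]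
  exact (ContinuousLinearMap.opNorm_comp_le _ _).trans (by gcongr)

/-- On a deformed element `v` is Lipschitz, which bounds its derivative at interior points. The
remaining points lie in the image of the boundary of a convex set, a null set; off it nothing
depends on the values of `v` outside the element. -/
lemma LocalMap.integrableOn_gradient (H : LocalMap q ρ h ε Θ T c)
    (hp : IsPolyOn k (simplex T) (v ∘ Θ) p) :
    IntegrableOn (fun x => ‖gradient v x‖ ^ 2) (Θ '' simplex T) := by
  have hh := H.h_pos
  obtain ⟨g, hg⟩ : ∃ g : ℝ, ∀ x ∈ closedBall c (3 * h), ‖evalGrad p x‖ ≤ g := by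
    have hcont : Continuous (evalGrad p) :=
      continuous_finsetSum _ fun i _ => (continuous_evalAt _).smul continuous_const
    exact (isCompact_closedBall _ _).exists_bound_of_continuousOn hcont.continuousOn
  have hg0 : 0 ≤ g := (norm_nonneg _).trans (hg c (mem_closedBall_self (by linarith)))
  have hlip : LipschitzOnWith (Real.toNNReal (2 * g)) v (Θ '' simplex T) := by
    refine LipschitzOnWith.of_dist_le_mul fun x hx y hy => ?_
    rw [H.apply_eq hp hx, H.apply_eq hp hy, Real.dist_eq, Real.coe_toNNReal _ (by positivity),
      dist_eq_norm]
    have hxn := H.image_subset_nearSet hx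
    have hyn := H.image_subset_nearSet hy
    refine (abs_evalAt_sub_le hg (H.mapExtInv_spec hxn).1 (H.mapExtInv_spec hyn).1).trans ?_
    have := H.norm_mapExtInv_sub_le hxn hyn
    nlinarith
  have hbound : ∀ x ∈ Θ '' interior (simplex T), ‖‖gradient v x‖ ^ 2‖ ≤ (2 * g) ^ 2 := by
    rintro _ ⟨y, hy, rfl⟩
    obtain ⟨s, hs, hsub⟩ := Metric.nhds_basis_closedBall.mem_iff.1 (mem_interior_iff_mem_nhds.1 hy)
    have h1 := (H.near.mono (hsub.trans H.simplex_subset)).closedBall_subset_image hs.le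
    rw [H.eq_on y (interior_subset hy), Set.image_congr fun z hz => H.eq_on z (hsub hz)] at h1
    have h2 : Θ '' simplex T ∈ nhds (Θ y) :=
      Filter.mem_of_superset (closedBall_mem_nhds _ (half_pos hs))
        (h1.trans (Set.image_mono hsub))
    have h3 := norm_fderiv_le_of_lipschitzOn ℝ h2 hlip
    rw [Real.coe_toNNReal _ (by positivity)] at h3
    rw [norm_gradient, norm_pow, norm_norm]
    gcongr
  have hnull : volume (Θ '' frontier (simplex T)) = 0 :=
    (H.volume_image_eq_zero_iff (isCompact_simplex T).isClosed.frontier_subset).2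
      ((convex_convexHull ℝ _).addHaar_frontier volume)
  have hae : ∀ᵐ x ∂volume.restrict (Θ '' simplex T), ‖‖gradient v x‖ ^ 2‖ ≤ (2 * g) ^ 2 := by
    rw [ae_restrict_iff' H.isCompact_image.measurableSet]
    have : ∀ᵐ x, x ∉ Θ '' frontier (simplex T) := measure_eq_zero_iff_ae_notMem.1 hnull
    filter_upwards [this] with x hx hxT
    obtain ⟨y, hy, rfl⟩ := hxT
    refine hbound _ ⟨y, ?_, rfl⟩
    by_contra hcon
    exact hx ⟨y, ⟨subset_closure hy, hcon⟩, rfl⟩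
  have hmeas : Measurable fun x => ‖gradient v x‖ ^ 2 := by
    simp only [norm_gradient]
    exact (measurable_fderiv ℝ v).norm.pow_const 2
  have : IsFiniteMeasure (volume.restrict (Θ '' simplex T)) :=
    ⟨by rw [Measure.restrict_apply_univ]; exact H.isCompact_image.measure_lt_top⟩
  exact Integrable.of_bound hmeas.aestronglyMeasurable _ hae

/-- For small mesh size, the mean of the gradient of the polynomial on the undeformed element is
controlled by the gradient of the mapped function. -/
theorem exists_gradMean_le (d k : ℕ) {ρ K : ℝ} (hρ : 0 < ρ) (hK : 0 < K) :
    ∃ h₁ > 0, ∃ A > 0, ∀ (q : ℕ) (h : ℝ) (Θ : Space d → Space d) (T : Finset (Space d))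
      (c : Space d) (v : Space d → ℝ) (p : MvPolynomial (Fin d) ℝ), h ≤ h₁ →
      LocalMap q ρ h (K * h ^ 2) Θ T c → IsPolyOn k (simplex T) (v ∘ Θ) p →
      h ^ d * gradMean ρ h c p ≤ A * ∫ x in closedBall c (ρ / 2 * h), ‖gradient v x‖ ^ 2 := by
  obtain ⟨K₁, hK₁, hgrad⟩ := EvolvingFEM.exists_evalGrad_le d k hρ
  set ω := volume.real (ball (0 : Space d) 1) with hω
  have hω0 : 0 < ω := Triangulation.volume_real_unitBall_pos
  -- `L - 1` is the coefficient of the error term to be absorbed; the summand `1` makes `L ≥ 1`, so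
  -- that `h ≤ 1 / (2 L)` also forces `h ≤ 1/2`.
  set L := 2 * d * (K₁ * K) ^ 2 * ((ρ / 2) ^ d * ω) + 1 with hL
  have hL1 : 1 ≤ L := by
    have : 0 ≤ 2 * d * (K₁ * K) ^ 2 * ((ρ / 2) ^ d * ω) := by positivity
    linarith
  refine ⟨1 / (2 * L), by positivity, 16 * d + 1, by positivity, ?_⟩
  intro q h Θ T c v p hh₁ H hp
  have hh := H.h_pos
  set b := closedBall c (ρ / 2 * h) with hb
  set G := gradMean ρ h c p with hG
  have hG0 : 0 ≤ G := gradMean_nonneg hh c p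
  have hbT : b ⊆ Θ '' simplex T :=
    (closedBall_subset_closedBall (by linarith [H.rho_h_nonneg])).trans H.closedBall_subset_image
  have hint : IntegrableOn (fun x => ‖gradient v x‖ ^ 2) b :=
    (H.integrableOn_gradient hp).mono_set hbT
  have hb3 : b ⊆ closedBall c (3 * h) :=
    ((closedBall_subset_closedBall (by linarith [H.rho_h_nonneg])).trans H.ball_subset).trans
      H.simplex_subset
  have hpt : ∀ x ∈ b, ∑ i, evalAt (MvPolynomial.pderiv i p) x ^ 2 ≤
      8 * d * ‖gradient v x‖ ^ 2 + 2 * d * (K₁ * K) ^ 2 * h ^ 2 * G := by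
    intro x hx
    obtain ⟨y, hy, hyx, hgy⟩ := H.exists_evalGrad_le hρ hp hx
    have hi : ∀ i, evalAt (MvPolynomial.pderiv i p) x ^ 2 ≤
        8 * ‖gradient v x‖ ^ 2 + 2 * (K₁ * K) ^ 2 * h ^ 2 * G := by
      intro i
      have h1 : |evalAt (MvPolynomial.pderiv i p) y| ≤ 2 * ‖gradient v x‖ :=
        (abs_evalAt_pderiv_le p y i).trans hgy
      -- Second derivatives are of size `√G / h` and the points differ by `K h²`, so the change of
      -- the gradient is only of order `h √G`.
      have h2 : |evalAt (MvPolynomial.pderiv i p) x - evalAt (MvPolynomial.pderiv i p) y|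
          ≤ K₁ * √G / h * ‖x - y‖ := by
        refine abs_evalAt_sub_le (fun z hz => ?_) (hb3 hx) hy
        rw [le_div_iff₀ hh, mul_comm]
        exact (hgrad c h hh p hp.1 z hz).2 i
      have h3 : |evalAt (MvPolynomial.pderiv i p) x - evalAt (MvPolynomial.pderiv i p) y|
          ≤ K₁ * K * h * √G := by
        refine h2.trans ?_
        rw [norm_sub_rev]
        calc K₁ * √G / h * ‖y - x‖ ≤ K₁ * √G / h * (K * h ^ 2) := by gcongr
          _ = _ := by field_simp
      have h4 : |evalAt (MvPolynomial.pderiv i p) x| ≤ 2 * ‖gradient v x‖ + K₁ * K * h * √G := by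
        rw [abs_le] at *
        constructor <;> linarith [h1.1, h1.2, h3.1, h3.2]
      have h5 : evalAt (MvPolynomial.pderiv i p) x ^ 2
          ≤ (2 * ‖gradient v x‖ + K₁ * K * h * √G) ^ 2 := by
        rw [← sq_abs (evalAt _ x)]
        gcongr
      have h6 : √G ^ 2 = G := Real.sq_sqrt hG0
      calc _ ≤ _ := h5
        _ ≤ 2 * ((2 * ‖gradient v x‖) ^ 2 + (K₁ * K * h * √G) ^ 2) := add_sq_le
        _ = 8 * ‖gradient v x‖ ^ 2 + 2 * (K₁ * K) ^ 2 * h ^ 2 * √G ^ 2 := by ring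
        _ = _ := by rw [h6]
    refine (Finset.sum_le_sum fun i _ => hi i).trans_eq ?_
    simp only [Finset.sum_const, Finset.card_univ, Fintype.card_fin, nsmul_eq_mul]
    ring
  have hmain : h ^ d * G ≤ 8 * d * (∫ x in b, ‖gradient v x‖ ^ 2)
      + 2 * d * (K₁ * K) ^ 2 * h ^ 2 * G * ((ρ / 2 * h) ^ d * ω) := by
    have h1 : h ^ d * G = ∫ x in b, ∑ i, evalAt (MvPolynomial.pderiv i p) x ^ 2 := by
      rw [hG, gradMean, ← mul_assoc, mul_inv_cancel₀ (pow_pos hh d).ne', one_mul]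
    have hconst : IntegrableOn (fun _ : Space d => 2 * d * (K₁ * K) ^ 2 * h ^ 2 * G) b :=
      integrableOn_const measure_closedBall_lt_top.ne
    have hintR : Integrable (fun x => 8 * d * ‖gradient v x‖ ^ 2
        + 2 * d * (K₁ * K) ^ 2 * h ^ 2 * G) (volume.restrict b) :=
      Integrable.fun_add (Integrable.const_mul hint (8 * d : ℝ)) hconst
    rw [h1]
    calc _ ≤ ∫ x in b, (8 * d * ‖gradient v x‖ ^ 2 + 2 * d * (K₁ * K) ^ 2 * h ^ 2 * G) :=
          setIntegral_mono_on (integrableOn_sum_pderiv_sq c _ p)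
            hintR measurableSet_closedBall hpt
      _ = _ := by
          rw [integral_add (hint.const_mul _) hconst, integral_const_mul, setIntegral_const, hb,
            Triangulation.volume_real_closedBall _ (by linarith [H.rho_h_nonneg]), smul_eq_mul]
          ring
  -- Half of the left-hand side absorbs the error, which doubles `8 d` to `16 d`.
  have hsmall : 2 * d * (K₁ * K) ^ 2 * h ^ 2 * G * ((ρ / 2 * h) ^ d * ω) ≤ 1 / 2 * (h ^ d * G) := by
    have h1 : 2 * d * (K₁ * K) ^ 2 * h ^ 2 * G * ((ρ / 2 * h) ^ d * ω)
        = (L - 1) * h ^ 2 * (h ^ d * G) := by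
      rw [hL, mul_pow (ρ / 2)]; ring
    have h2 : L * h ≤ 1 / 2 := by
      rw [le_div_iff₀ (by positivity)] at hh₁
      linarith
    have h3 : h ≤ 1 / 2 := by nlinarith
    have h4 : (L - 1) * h ^ 2 ≤ 1 / 2 := by nlinarith
    rw [h1]
    gcongr
  have hI : 0 ≤ ∫ x in b, ‖gradient v x‖ ^ 2 := integral_nonneg fun x => sq_nonneg _
  linarith

end Gradient

/-! ### The transfer operator at the Lagrange nodes -/

namespace Triangulation

variable {d : ℕ} {M : Triangulation d} {k q : ℕ} {ρ h ε : ℝ}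

/-- A Lagrange node of one element that lies in another element has a multi-index supported in the
common vertices. -/
lemma exists_multiIndex_of_mem (hk : 1 ≤ k) {T S : Finset (Space d)} (hT : T ∈ M.elements)
    (hS : S ∈ M.elements) {x : Space d} (hx : x ∈ lagrangeNodes k T) (hxS : x ∈ simplex S) :
    ∃ α ∈ multiIndices k T, x = lagrangeNode k T α ∧ ∀ V, α V ≠ 0 → V ∈ S := by
  classical
  obtain ⟨α, hα, rfl⟩ := exists_multiIndex hx
  refine ⟨α, hα, rfl, fun V hV => ?_⟩
  by_contra hVS
  have hVT := (mem_multiIndices.1 hα).2 V hV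
  obtain ⟨w, -, hw1, hw⟩ := mem_simplex_iff.1
    (mem_simplex_inter hT hS (lagrangeNodes_subset_simplex hk T hx) hxS)
  have h1 := ((isElement hT).bary_face Finset.inter_subset_left hw1).2 V hVT
    fun h => hVS (Finset.mem_inter.1 h).2
  rw [hw, (isElement hT).bary_lagrangeNode hk hα hVT, div_eq_zero_iff] at h1
  rcases h1 with h1 | h1
  · exact hV (by exact_mod_cast h1)
  · have : k = 0 := by exact_mod_cast h1
    lia

/-- A node with multi-index supported in the common vertices is a Lagrange node of both elements, so
the local transfers of both are interpolatory at it. -/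
lemma lagrangeNode_mem_of_support {T S : Finset (Space d)} {α : Space d → ℕ}
    (hα : α ∈ multiIndices k T) (hS : ∀ V, α V ≠ 0 → V ∈ S) :
    lagrangeNode k T α ∈ lagrangeNodes k S := by
  classical
  obtain ⟨h1, h2⟩ := mem_multiIndices.1 hα
  have hT0 : ∀ V ∈ T, V ∉ T ∩ S → α V = 0 := fun V hV hn => by
    by_contra h
    exact hn (Finset.mem_inter.2 ⟨hV, hS V h⟩)
  have hS0 : ∀ V ∈ S, V ∉ T ∩ S → α V = 0 := fun V hV hn => by
    by_contra h
    exact hn (Finset.mem_inter.2 ⟨h2 V h, hV⟩)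
  refine ⟨α, ?_, ?_⟩
  · rw [← h1, ← Finset.sum_subset Finset.inter_subset_left hT0,
      ← Finset.sum_subset Finset.inter_subset_right hS0]
  · rw [lagrangeNode, ← Finset.sum_subset (Finset.inter_subset_left (s₁ := T) (s₂ := S)),
      ← Finset.sum_subset (Finset.inter_subset_right (s₁ := T) (s₂ := S))]
    · intro V hV hn
      simp [hS0 V hV hn]
    · intro V hV hn
      simp [hT0 V hV hn]

lemma localTransfer_eq (hk : 1 ≤ k) (Θ Ψ : Space d → Space d) (v : Space d → ℝ)
    {T : Finset (Space d)} (hT : IsElement T) {x : Space d} (hx : x ∈ lagrangeNodes k T) :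
    localTransfer k q h Θ Ψ v T x = mappedExt k q h Θ T v (Ψ x) := by
  rw [localTransfer, hT.polyExt_lagrangeNodes hk, hT.evalAt_lagrangeInterp_node hk _ hx]

lemma abs_oswaldMean_sub_le {w : Finset (Space d) → Space d → ℝ} {x : Space d} {a b : ℝ}
    {T : Finset (Space d)} (hT : T ∈ M.elements) (hx : x ∈ simplex T)
    (h : ∀ S ∈ M.elements, x ∈ simplex S → |w S x - a| ≤ b) : |M.oswaldMean w x - a| ≤ b := by
  classical
  rw [oswaldMean]
  set F := M.elements.filter fun T => x ∈ simplex T with hF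
  have hcard : 0 < (F.card : ℝ) := by
    exact_mod_cast Finset.card_pos.2 ⟨T, Finset.mem_filter.2 ⟨hT, hx⟩⟩
  have h1 : (F.card : ℝ)⁻¹ * ∑ S ∈ F, w S x - a = (F.card : ℝ)⁻¹ * ∑ S ∈ F, (w S x - a) := by
    rw [Finset.sum_sub_distrib, mul_sub, Finset.sum_const, nsmul_eq_mul, inv_mul_cancel_left₀
      hcard.ne']
  have h2 : |∑ S ∈ F, (w S x - a)| ≤ F.card * b := by
    refine (Finset.abs_sum_le_sum_abs _ _).trans ?_
    refine (Finset.sum_le_sum fun S hS => ?_).trans_eq (by rw [Finset.sum_const, nsmul_eq_mul])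
    exact h S (Finset.mem_filter.1 hS).1 (Finset.mem_filter.1 hS).2
  calc |(F.card : ℝ)⁻¹ * ∑ S ∈ F, w S x - a| = (F.card : ℝ)⁻¹ * |∑ S ∈ F, (w S x - a)| := by
        rw [h1, abs_mul, abs_of_pos (inv_pos.2 hcard)]
    _ ≤ (F.card : ℝ)⁻¹ * (F.card * b) := by gcongr
    _ = b := by rw [inv_mul_cancel_left₀ hcard.ne']

variable {Θ Ψ : Space d → Space d} {ctr : Finset (Space d) → Space d} {v : Space d → ℝ}
  {P : Finset (Space d) → MvPolynomial (Fin d) ℝ}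

/-- At the nodes of an element that shares all but at most one vertex with `T₂`, the transfer
operator changes the nodal values only by gradients on the neighbours of `T₂`: the remaining vertex
is fixed by the deformations. -/
lemma abs_oswaldMean_localTransfer_sub_le (hk : 1 ≤ k)
    (H : ∀ T ∈ M.elements, LocalMap q ρ h ε Θ T (ctr T))
    (H' : ∀ T ∈ M.elements, LocalMap q ρ h ε Ψ T (ctr T))
    (hΘV : ∀ T ∈ M.elements, ∀ V ∈ T, Θ V = V) (hΨV : ∀ T ∈ M.elements, ∀ V ∈ T, Ψ V = V)
    (hP : ∀ T ∈ M.elements, IsPolyOn k (simplex T) (v ∘ Θ) (P T))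
    {T T₂ : Finset (Space d)} (hT : T ∈ M.elements)
    (hTT₂ : ∀ V ∈ T, ∀ U ∈ T, V ∉ T₂ → U ∉ T₂ → V = U) {g : ℝ} (hg0 : 0 ≤ g)
    (hg : ∀ S ∈ M.elements, (∃ V ∈ S, V ∈ T₂) →
      ∀ z ∈ closedBall (ctr S) (3 * h), ‖evalGrad (P S) z‖ ≤ g)
    {x : Space d} (hx : x ∈ lagrangeNodes k T) :
    |M.oswaldMean (localTransfer k q h Θ Ψ v) x - evalAt (P T) x| ≤ g * (2 * ε) := by
  have hxT := lagrangeNodes_subset_simplex hk T hx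
  refine abs_oswaldMean_sub_le hT hxT fun S hS hxS => ?_
  obtain ⟨α, hα, hxα, hαS⟩ := exists_multiIndex_of_mem hk hT hS hx hxS
  have hxnS : x ∈ lagrangeNodes k S := hxα ▸ lagrangeNode_mem_of_support hα hαS
  -- All elements containing the node share the value of `v ∘ Θ` there, so each term of the average
  -- is compared with the same number.
  have hPS : evalAt (P S) x = evalAt (P T) x :=
    ((hP S hS).2 x hxS).trans ((hP T hT).2 x hxT).symm
  have hΨx : Ψ x ∈ nearSet h S := (H' S hS).image_subset_nearSet ⟨x, hxS, rfl⟩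
  rw [localTransfer_eq hk _ _ _ (isElement hS) hxnS,
    (H S hS).mappedExt_eq (isElement hS) hk (hP S hS),
    ← hPS]
  -- A vertex of `T₂` charged by the node belongs to every element `S` containing it, so `S` is a
  -- neighbour of `T₂` and its gradient is controlled. The argument of `P S` moves by at most `ε`
  -- from `Ψ` and `ε` from the inverse.
  by_cases hmeet : ∃ V, α V ≠ 0 ∧ V ∈ T₂
  · obtain ⟨V, hV, hV₂⟩ := hmeet
    have hgS := hg S hS ⟨V, hαS V hV, hV₂⟩
    obtain ⟨h1, -, h2⟩ := (H S hS).mapExtInv_spec hΨx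
    refine (abs_evalAt_sub_le hgS h1 ((H S hS).simplex_subset hxS)).trans ?_
    have h3 := (H' S hS).norm_sub_self_le hxS
    have h4 := norm_add_le (mapExtInv q h Θ S (Ψ x) - Ψ x) (Ψ x - x)
    rw [sub_add_sub_cancel] at h4
    gcongr
    linarith
  -- Otherwise the node charges only vertices off `T₂`, of which there is just one, so the node is
  -- that vertex. It is fixed by both deformations and the error is zero, without any gradient
  -- bound.
  · push Not at hmeet
    obtain ⟨V, hV⟩ : ∃ V, α V ≠ 0 := by
      by_contra! hcon
      have := (mem_multiIndices.1 hα).1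
      simp only [hcon, Finset.sum_const_zero] at this
      lia
    have hVT := (mem_multiIndices.1 hα).2 V hV
    have hother : ∀ U ∈ T, U ≠ V → α U = 0 := by
      intro U hU hne
      by_contra hU0
      exact hne (hTT₂ U hU V hVT (hmeet U hU0) (hmeet V hV))
    have hαV : α V = k := by
      rw [← (mem_multiIndices.1 hα).1]
      exact (Finset.sum_eq_single V hother fun h => absurd hVT h).symm
    have hxV : x = V := by
      rw [hxα, lagrangeNode, Finset.sum_eq_single V, hαV, div_self, one_smul]
      · exact_mod_cast (by lia : k ≠ 0)
      · intro U hU hne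
        simp [hother U hU hne]
      · exact fun h => absurd hVT h
    have hΨ : Ψ x = Θ x := by rw [hxV, hΨV T hT V hVT, hΘV T hT V hVT]
    rw [hΨ, (H S hS).mapExtInv_apply hxS, sub_self, abs_zero]
    have := (H S hS).eps_nonneg
    positivity

lemma isPolyOn_transfer (hk : 1 ≤ k) (hΨ : Set.InjOn Ψ M.domain) {T : Finset (Space d)}
    (hT : T ∈ M.elements) :
    IsPolyOn k (simplex T) (M.transfer k q h Θ Ψ v ∘ Ψ)
      ((isElement hT).lagrangeInterp k (M.oswaldMean (localTransfer k q h Θ Ψ v))) := by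
  refine ⟨(isElement hT).totalDegree_lagrangeInterp_le k _, fun x hx => ?_⟩
  have h1 : Function.invFunOn Ψ M.domain (Ψ x) = x :=
    hΨ.leftInvOn_invFunOn (simplex_subset_domain hT hx)
  rw [Function.comp_apply, transfer, h1, interpolate_eq hk hT _ hx]
  rfl

lemma evalGrad_sub (p r : MvPolynomial (Fin d) ℝ) (x : Space d) :
    evalGrad (p - r) x = evalGrad p x - evalGrad r x := by
  simp [evalGrad, sub_smul]

/-- The transferred function is close to the original one on the undeformed elements. -/
lemma exists_transfer_close (d k : ℕ) (hk : 1 ≤ k) {ρ : ℝ} (hρ : 0 < ρ) :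
    ∃ B ≥ 1, ∀ (q : ℕ) (h ε : ℝ) (Θ : Space d → Space d) (T : Finset (Space d)) (c : Space d)
      (p u : MvPolynomial (Fin d) ℝ) (g : ℝ), IsElement T → LocalMap q ρ h ε Θ T c →
      p.totalDegree ≤ k → u.totalDegree ≤ k →
      (∀ x ∈ lagrangeNodes k T, |evalAt u x - evalAt p x| ≤ g * (2 * ε)) →
      (∀ x ∈ closedBall c (3 * h), ‖evalGrad p x‖ ≤ g) →
      ∀ x ∈ closedBall c (3 * h), |evalAt u x - evalAt p x| ≤ B * g * ε ∧
        ‖evalGrad u x‖ ≤ B * g := by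
  obtain ⟨K, hK, hinv⟩ := exists_inverse_estimate_sup d k hρ 3
  -- This is the Lagrange stability constant, with barycentric coordinates bounded by `1 + 3 / ρ`
  -- since `3 h = (3 / ρ)(ρ h)`.
  set L : ℝ := (k + 1) ^ (d + 1) * (k * (1 + 3 / ρ) + k) ^ k with hL
  have hL0 : 0 ≤ L := by positivity
  refine ⟨2 * L + K * L + 1, by nlinarith, ?_⟩
  intro q h ε Θ T c p u g hT H hp hu hnode hg x hx
  have hh := H.h_pos
  have hε := H.eps_nonneg
  have hg0 : 0 ≤ g := (norm_nonneg _).trans (hg x hx)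
  have hdeg : (u - p).totalDegree ≤ k := (MvPolynomial.totalDegree_sub _ _).trans (max_le hu hp)
  have hsup : ∀ y ∈ closedBall c (3 * h), |evalAt (u - p) y| ≤ L * (g * (2 * ε)) := by
    intro y hy
    refine hT.abs_evalAt_le_of_nodes hk hdeg (by positivity) (fun z hz => ?_) fun V hV => ?_
    · rw [evalAt_sub]
      exact hnode z hz
    · refine hT.abs_bary_le (s := ρ * h) (by positivity) (by positivity) H.ball_subset ?_ hV
      rwa [show 3 / ρ * (ρ * h) = 3 * h by field_simp]
  have hgrad := (hinv c h hh _ hdeg _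
    (fun y hy => hsup y (H.simplex_subset (H.ball_subset hy))) x hx).2
  constructor
  · rw [← evalAt_sub]
    refine (hsup x hx).trans ?_
    have : 0 ≤ (K * L + 1) * (g * ε) := by positivity
    linarith
  -- The inverse estimate loses `1 / h`, compensated by `2 ε ≤ h / 2`.
  · have h1 : ‖evalGrad (u - p) x‖ ≤ K * L * g := by
      refine le_of_mul_le_mul_left (hgrad.trans ?_) hh
      have h2 : 0 ≤ K * L * g := by positivity
      have h3 := H.eps_le
      nlinarith
    have h2 : ‖evalGrad u x‖ ≤ ‖evalGrad (u - p) x‖ + ‖evalGrad p x‖ := by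
      rw [evalGrad_sub]
      have := norm_add_le (evalGrad u x - evalGrad p x) (evalGrad p x)
      rwa [sub_add_cancel] at this
    have h3 := hg x hx
    have h4 : 0 ≤ 2 * L * g := by positivity
    linarith

end Triangulation

/-! ### Stability of the transfer operator -/

namespace Triangulation

variable {d : ℕ} {M : Triangulation d} {k q : ℕ} {ρ h ε : ℝ}

/-- Two sets that share all but one element of the first. -/
lemma facet_vertices {α : Type*} [DecidableEq α] {T₁ T₂ : Finset α} (hd : 1 ≤ d)
    (hT₁ : T₁.card = d + 1) (hcard : (T₁ ∩ T₂).card = d) :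
    (∃ V ∈ T₁, V ∈ T₂) ∧ ∀ V ∈ T₁, ∀ U ∈ T₁, V ∉ T₂ → U ∉ T₂ → V = U := by
  obtain ⟨V, hV⟩ : (T₁ ∩ T₂).Nonempty := Finset.card_pos.1 (by rw [hcard]; exact hd)
  refine ⟨⟨V, Finset.mem_inter.1 hV⟩, fun V hV U hU hV' hU' => ?_⟩
  have h1 : (T₁ \ T₂).card ≤ 1 := by
    have h2 := Finset.card_sdiff_add_card_inter T₁ T₂
    rw [hcard, hT₁] at h2
    lia
  exact Finset.card_le_one.1 h1 V (Finset.mem_sdiff.2 ⟨hV, hV'⟩) U (Finset.mem_sdiff.2 ⟨hU, hU'⟩)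

/-- Ghost penalty of the transferred function on one facet. The sum runs over any set of elements
that contains all elements sharing a vertex with `T₂`. -/
theorem exists_facetPenalty_transfer_le (d k : ℕ) (hk : 1 ≤ k) {ρ K : ℝ} (hρ : 0 < ρ)
    (hK : 0 < K) :
    ∃ h₁ > 0, ∃ A > 0, ∃ B > 0, ∀ (M : Triangulation d) (q : ℕ) (h : ℝ) (Θ Ψ : Space d → Space d)
      (ctr : Finset (Space d) → Space d) (v : Space d → ℝ) (T₁ T₂ : Finset (Space d))
      (S : Finset (Finset (Space d))), 0 < h → h ≤ h₁ →
      (∀ T ∈ M.elements, LocalMap q ρ h (K * h ^ 2) Θ T (ctr T)) →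
      (∀ T ∈ M.elements, LocalMap q ρ h (K * h ^ 2) Ψ T (ctr T)) →
      (∀ T ∈ M.elements, ∀ V ∈ T, Θ V = V) → (∀ T ∈ M.elements, ∀ V ∈ T, Ψ V = V) →
      Set.InjOn Ψ M.domain → v ∈ M.mappedSpace k Θ →
      T₁ ∈ M.elements → T₂ ∈ M.elements → (∃ V ∈ T₁, V ∈ T₂) →
      (∀ V ∈ T₁, ∀ U ∈ T₁, V ∉ T₂ → U ∉ T₂ → V = U) →
      S ⊆ M.elements → (∀ T ∈ M.elements, (∃ V ∈ T, V ∈ T₂) → T ∈ S) →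
      facetPenalty k q h Ψ (M.transfer k q h Θ Ψ v) (M.transfer k q h Θ Ψ v) s(T₁, T₂) ≤
        A * facetPenalty k q h Θ v v s(T₁, T₂) +
          B * h ^ 2 * ∑ T ∈ S, ∫ x in closedBall (ctr T) (ρ / 2 * h), ‖gradient v x‖ ^ 2 := by
  obtain ⟨A, hA, hfac⟩ := exists_facetPenalty_le d k hk hρ
  obtain ⟨K₁, hK₁, hgrad⟩ := EvolvingFEM.exists_evalGrad_le d k hρ
  obtain ⟨h₁, hh₁, A₂, hA₂, hmean⟩ := exists_gradMean_le d k hρ hK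
  obtain ⟨B, hB, hclose⟩ := exists_transfer_close d k hk hρ
  refine ⟨h₁, hh₁, A, hA, A * (2 * B * K * K₁) ^ 2 * A₂, by positivity, ?_⟩
  intro M q h Θ Ψ ctr v T₁ T₂ S hh hhh₁ H H' hΘV hΨV hΨ hv hT₁ hT₂ ⟨V, hV₁, hV₂⟩ hopp hSM hS
  have hP : ∀ T : Finset (Space d), ∃ p, T ∈ M.elements → IsPolyOn k (simplex T) (v ∘ Θ) p := by
    intro T
    by_cases hT : T ∈ M.elements
    · obtain ⟨p, hp⟩ := hv.2 T hT
      exact ⟨p, fun _ => hp⟩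
    · exact ⟨0, fun h => absurd h hT⟩
  choose P hP using hP
  -- The sum over `S` dominates each local gradient mean, so a single bound `g` serves all
  -- neighbours of `T₂`.
  set G := ∑ T ∈ S, gradMean ρ h (ctr T) (P T) with hG
  have hGle : ∀ T ∈ S, gradMean ρ h (ctr T) (P T) ≤ G := fun T hT =>
    Finset.single_le_sum (f := fun T => gradMean ρ h (ctr T) (P T))
      (fun T _ => gradMean_nonneg hh _ _) hT
  have hG0 : 0 ≤ G := Finset.sum_nonneg fun T _ => gradMean_nonneg hh _ _
  set g := K₁ * √G with hg
  have hg0 : 0 ≤ g := by positivity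
  have hgT : ∀ T ∈ M.elements, (∃ V ∈ T, V ∈ T₂) →
      ∀ z ∈ closedBall (ctr T) (3 * h), ‖evalGrad (P T) z‖ ≤ g := by
    intro T hT hTV z hz
    refine (hgrad (ctr T) h hh (P T) (hP T hT).1 z hz).1.trans ?_
    exact mul_le_mul_of_nonneg_left (Real.sqrt_le_sqrt (hGle T (hS T hT hTV))) hK₁.le
  have hE₁ := isElement hT₁
  have hE₂ := isElement hT₂
  set w := M.oswaldMean (localTransfer k q h Θ Ψ v) with hw
  set u₁ := hE₁.lagrangeInterp k w
  set u₂ := hE₂.lagrangeInterp k w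
  have hu₁ : IsPolyOn k (simplex T₁) (M.transfer k q h Θ Ψ v ∘ Ψ) u₁ := isPolyOn_transfer hk hΨ hT₁
  have hu₂ : IsPolyOn k (simplex T₂) (M.transfer k q h Θ Ψ v ∘ Ψ) u₂ := isPolyOn_transfer hk hΨ hT₂
  have hg₁ := hgT T₁ hT₁ ⟨V, hV₁, hV₂⟩
  have hg₂ := hgT T₂ hT₂ ⟨V, hV₂, hV₂⟩
  have hPe : ∀ T ∈ M.elements, IsPolyOn k (simplex T) (v ∘ Θ) (P T) := hP
  have hc₁ := hclose q h (K * h ^ 2) Θ T₁ (ctr T₁) (P T₁) u₁ g hE₁ (H T₁ hT₁) (hP T₁ hT₁).1 hu₁.1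
    (fun x hx => by
      rw [hE₁.evalAt_lagrangeInterp_node hk _ hx]
      exact abs_oswaldMean_localTransfer_sub_le hk H H' hΘV hΨV hPe hT₁ hopp hg0 hgT hx) hg₁
  -- For `T₂` itself there is no exceptional vertex, so the condition on vertices off `T₂` is
  -- vacuous.
  have hc₂ := hclose q h (K * h ^ 2) Θ T₂ (ctr T₂) (P T₂) u₂ g hE₂ (H T₂ hT₂) (hP T₂ hT₂).1 hu₂.1
    (fun x hx => by
      rw [hE₂.evalAt_lagrangeInterp_node hk _ hx]
      exact abs_oswaldMean_localTransfer_sub_le hk H H' hΘV hΨV hPe hT₂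
        (fun V hV _ _ hV' => absurd hV hV') hg0 hgT hx) hg₂
  have hgB : g ≤ B * g := by nlinarith
  have hmain := hfac q h (K * h ^ 2) Ψ Θ T₁ T₂ (ctr T₁) (ctr T₂) V (M.transfer k q h Θ Ψ v) v u₁ u₂
    (P T₁) (P T₂) (B * g * (K * h ^ 2)) (B * g) hE₁ hE₂ hV₁ hV₂ (H' T₁ hT₁) (H' T₂ hT₂)
    (H T₁ hT₁) (H T₂ hT₂) hu₁ hu₂ (hP T₁ hT₁) (hP T₂ hT₂) (fun x hx => (hc₁ x hx).1)
    (fun x hx => (hc₂ x hx).1) (fun x hx => (hc₁ x hx).2) (fun x hx => (hc₂ x hx).2)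
    (fun x hx => (hg₁ x hx).trans hgB) (fun x hx => (hg₂ x hx).trans hgB)
  refine hmain.trans ?_
  rw [mul_add]
  have hsum : h ^ d * G ≤
      A₂ * ∑ T ∈ S, ∫ x in closedBall (ctr T) (ρ / 2 * h), ‖gradient v x‖ ^ 2 := by
    rw [hG, Finset.mul_sum, Finset.mul_sum]
    exact Finset.sum_le_sum fun T hT =>
      hmean q h Θ T (ctr T) v (P T) hhh₁ (H T (hSM hT)) (hP T (hSM hT))
  -- The squared error carries `h⁴`; the penalty weight `h⁻²` leaves the factor `h²` of the claim.
  have hrew : A * (h ^ d / h ^ 2 * (B * g * (K * h ^ 2) + B * g * (K * h ^ 2)) ^ 2)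
      = A * (2 * B * K * K₁) ^ 2 * h ^ 2 * (h ^ d * G) := by
    have h6 : √G ^ 2 = G := Real.sq_sqrt hG0
    have h7 : (B * g * (K * h ^ 2) + B * g * (K * h ^ 2)) ^ 2
        = (2 * B * K * K₁) ^ 2 * h ^ 4 * G := by
      calc _ = (2 * B * K * K₁) ^ 2 * h ^ 4 * √G ^ 2 := by rw [hg]; ring
        _ = _ := by rw [h6]
    rw [h7]
    field_simp
  rw [hrew]
  have h8 : A * (2 * B * K * K₁) ^ 2 * h ^ 2 * (h ^ d * G) ≤ A * (2 * B * K * K₁) ^ 2 * h ^ 2 *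
      (A₂ * ∑ T ∈ S, ∫ x in closedBall (ctr T) (ρ / 2 * h), ‖gradient v x‖ ^ 2) := by gcongr
  linarith

/-- The gradients on disjoint inscribed balls are bounded by the gradient on the strip. -/
lemma sum_setIntegral_le_stripRegion {φ v : Space d → ℝ} {Θ : Space d → Space d}
    {ctr : Finset (Space d) → Space d} {δ : ℝ} {r : ℕ} (hρ : 0 < ρ)
    (H : ∀ T ∈ M.elements, LocalMap q ρ h ε Θ T (ctr T)) (hv : v ∈ M.mappedSpace k Θ)
    (hS : M.stripLayered φ Θ δ r ⊆ M.elements) :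
    ∑ T ∈ M.stripLayered φ Θ δ r, ∫ x in closedBall (ctr T) (ρ / 2 * h), ‖gradient v x‖ ^ 2 ≤
      ∫ x in M.stripRegion φ Θ δ r, ‖gradient v x‖ ^ 2 := by
  have hsub : ∀ T ∈ M.stripLayered φ Θ δ r,
      closedBall (ctr T) (ρ / 2 * h) ⊆ Θ '' simplex T := fun T hT =>
    (closedBall_subset_closedBall (by linarith [(H T (hS hT)).rho_h_nonneg])).trans
      (H T (hS hT)).closedBall_subset_image
  have hint : ∀ T ∈ M.stripLayered φ Θ δ r,
      IntegrableOn (fun x => ‖gradient v x‖ ^ 2) (Θ '' simplex T) := fun T hT => by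
    obtain ⟨p, hp⟩ := hv.2 T (hS hT)
    exact (H T (hS hT)).integrableOn_gradient hp
  rw [← integral_biUnion_finset _ (fun T _ => measurableSet_closedBall)
    (fun T hT T' hT' hne => ?_) fun T hT => (hint T hT).mono_set (hsub T hT)]
  · refine setIntegral_mono_set ?_ (Filter.Eventually.of_forall fun x => sq_nonneg _)
      (Set.iUnion₂_mono hsub).eventuallyLE
    exact integrableOn_finset_iUnion.2 hint
  · have hh := (H T (hS hT)).h_pos
    refine disjoint_ball_of_ne (hS hT) (hS hT') hne ?_ (H T (hS hT)).ball_subset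
      (H T' (hS hT')).ball_subset
    nlinarith

lemma stripLayered_subset_elements (φ : Space d → ℝ) (Θ : Space d → Space d) (δ : ℝ) (r : ℕ) :
    M.stripLayered φ Θ δ r ⊆ M.elements := by
  cases r with
  | zero => exact Finset.filter_subset _ _
  | succ r =>
    rw [stripLayered, Function.iterate_succ_apply']
    exact addLayer_subset_elements _

lemma activeLayered_subset_elements (φ : Space d → ℝ) (Θ : Space d → Space d) (δ : ℝ) (r : ℕ) :
    M.activeLayered φ Θ δ r ⊆ M.elements := by
  cases r with
  | zero => exact Finset.filter_subset _ _
  | succ r =>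
    rw [activeLayered, Function.iterate_succ_apply']
    exact addLayer_subset_elements _

open Classical in
/-- The unordered pairs of elements close to `T`. -/
def nearPairs (M : Triangulation d) (ctr : Finset (Space d) → Space d) (r : ℝ)
    (T : Finset (Space d)) : Finset (Sym2 (Finset (Space d))) :=
  let N := M.elements.filter fun T' => dist (ctr T') (ctr T) ≤ r
  (N ×ˢ N).image fun P => s(P.1, P.2)

/-- Packing bounds the number of elements near `T`; squaring counts pairs. The result is the overlap
constant in the summation over facets. -/
lemma card_nearPairs_le (hρ : 0 < ρ) (hh : 0 < h) {ctr : Finset (Space d) → Space d}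
    (hctr : ∀ T ∈ M.elements, closedBall (ctr T) (ρ * h) ⊆ simplex T) {R : ℝ} (hR : 0 ≤ R)
    (T : Finset (Space d)) :
    ((nearPairs M ctr (R * h) T).card : ℝ) ≤ (((R + ρ) / (ρ / 2)) ^ d) ^ 2 := by
  classical
  set N := M.elements.filter fun T' => dist (ctr T') (ctr T) ≤ R * h with hN
  have h1 : (N.card : ℝ) ≤ ((R + ρ) / (ρ / 2)) ^ d :=
    card_le_of_centers hρ hh hctr (Finset.filter_subset _ _) hR fun T' hT' =>
      (Finset.mem_filter.1 hT').2
  have h2 : (nearPairs M ctr (R * h) T).card ≤ N.card ^ 2 := by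
    refine Finset.card_image_le.trans ?_
    rw [Finset.card_product, pow_two]
  calc ((nearPairs M ctr (R * h) T).card : ℝ) ≤ (N.card : ℝ) ^ 2 := by exact_mod_cast h2
    _ ≤ _ := by gcongr

/-- Summation of facet estimates with local right-hand sides. -/
lemma sum_facets_le {ι κ : Type*} [DecidableEq ι] {F F' : Finset ι} {S : Finset κ}
    {a b : ι → ℝ} {I : κ → ℝ}
    {N : κ → Finset ι} {A B P : ℝ} (hA : 0 ≤ A) (hB : 0 ≤ B) (hF : F ⊆ F')
    (hb : ∀ i ∈ F', 0 ≤ b i) (hI : ∀ j ∈ S, 0 ≤ I j) (hN : ∀ j ∈ S, ((N j).card : ℝ) ≤ P)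
    (h : ∀ i ∈ F, a i ≤ A * b i + B * ∑ j ∈ S.filter (fun j => i ∈ N j), I j) :
    ∑ i ∈ F, a i ≤ A * ∑ i ∈ F', b i + B * P * ∑ j ∈ S, I j := by
  have h1 : ∑ i ∈ F, ∑ j ∈ S.filter (fun j => i ∈ N j), I j ≤ P * ∑ j ∈ S, I j := by
    simp only [Finset.sum_filter]
    -- After exchanging the sums each `I j` is counted once for every facet in `N j`, hence at most
    -- `P` times.
    rw [Finset.sum_comm, Finset.mul_sum]
    refine Finset.sum_le_sum fun j hj => ?_
    rw [← Finset.sum_filter, Finset.sum_const, nsmul_eq_mul]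
    refine mul_le_mul_of_nonneg_right (le_trans ?_ (hN j hj)) (hI j hj)
    exact_mod_cast Finset.card_le_card fun i hi => (Finset.mem_filter.1 hi).2
  calc ∑ i ∈ F, a i
      ≤ ∑ i ∈ F, (A * b i + B * ∑ j ∈ S.filter (fun j => i ∈ N j), I j) := Finset.sum_le_sum h
    _ = A * ∑ i ∈ F, b i + B * ∑ i ∈ F, ∑ j ∈ S.filter (fun j => i ∈ N j), I j := by
        rw [Finset.sum_add_distrib, Finset.mul_sum, Finset.mul_sum]
    _ ≤ A * ∑ i ∈ F', b i + B * (P * ∑ j ∈ S, I j) := by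
        have h2 := Finset.sum_le_sum_of_subset_of_nonneg hF fun i hi _ => hb i hi
        gcongr
    _ = _ := by ring

end Triangulation

end EvolvingFEM

end

/-! ### Stability of the ghost penalty under transfer -/

open EvolvingFEM EvolvingFEM.Triangulation in
theorem mainTheorem5 (d : ℕ) (hd : d = 2 ∨ d = 3) (k q : ℕ) (hk : 1 ≤ k) (hq : 1 ≤ q)
    (ρ C : ℝ) (hρ : 0 < ρ) :
    ∃ h₀ > 0, ∃ ca > 0, ∃ cb > 0,
      ∀ (M : EvolvingFEM.Triangulation d) (h : ℝ), M.QuasiUniform ρ h → h ≤ h₀ →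
      ∀ (tEnd : ℝ) (N : ℕ) (Δt : ℝ), 0 < tEnd → 1 ≤ N → Δt = tEnd / N →
      ∀ (W δ : ℝ), 0 < δ → Δt * W ≤ δ →
      ∀ (φ : ℕ → EvolvingFEM.Space d → ℝ)
        (Θ : ℕ → EvolvingFEM.Space d → EvolvingFEM.Space d),
        (∀ n ≤ N, φ n ∈ M.feSpace q) →
        (∀ n < N, ∀ T ∈ M.elements, ∀ V ∈ T, |φ (n + 1) V - φ n V| ≤ Δt * W) →
        (∀ n ≤ N, M.IsDeformation q C h (φ n) (Θ n)) →
      ∀ m n : ℕ, n ≤ N → n = m + 1 →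
      ∀ v ∈ M.mappedSpace k (Θ m),
        M.ghostPenalty k q h (φ n) (Θ n) δ 1
            (M.transfer k q h (Θ m) (Θ n) v) (M.transfer k q h (Θ m) (Θ n) v) ≤
          ca * M.ghostPenalty k q h (φ m) (Θ m) δ 2 v v +
            cb * h ^ 2 * ∫ x in M.stripRegion (φ m) (Θ m) δ 2, ‖gradient v x‖ ^ 2 := by
  classical
  obtain ⟨K, hK, hloc⟩ := exists_localMap d q hq hρ C
  obtain ⟨h₁, hh₁, A, hA, B, hB, hfac⟩ :=
    exists_facetPenalty_transfer_le d k hk hρ hK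
  -- Centres of elements sharing a vertex are at most `2h` apart; from a neighbour of `T₂` through
  -- `T₂` to `T₁` this gives `4h`.
  set P := (((4 + ρ) / (ρ / 2)) ^ d) ^ 2 with hP
  refine ⟨min h₁ (min (1 / 4 / K) (ρ / 8 / K)), by positivity, A, hA, B * P, by positivity, ?_⟩
  intro M h hM hh₀ tEnd N Δt _ _ _ W δ _ hW φ Θ _ hφ hΘ m n hnN hnm v hv
  have hh := hM.pos
  obtain ⟨hhh₁, hh2⟩ := le_min_iff.1 hh₀
  obtain ⟨hh3, hh4⟩ := le_min_iff.1 hh2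
  rw [le_div_iff₀ hK, mul_comm] at hh3 hh4
  -- The centres depend on the mesh alone, so the same balls serve both time levels.
  obtain ⟨ctr, hctr⟩ : ∃ ctr : Finset (Space d) → Space d,
      ∀ T ∈ M.elements, Metric.closedBall (ctr T) (ρ * h) ⊆ simplex T := by
    have hex : ∀ T : Finset (Space d), ∃ c, T ∈ M.elements →
        Metric.closedBall c (ρ * h) ⊆ simplex T := by
      intro T
      by_cases hT : T ∈ M.elements
      · obtain ⟨c, hc⟩ := hM.ball_subset T hT
        exact ⟨c, fun _ => hc⟩
      · exact ⟨0, fun h => absurd h hT⟩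
    exact ⟨fun T => (hex T).choose, fun T hT => (hex T).choose_spec hT⟩
  have hDn := hΘ n hnN
  have hDm := hΘ m (by lia)
  have Hn : ∀ T ∈ M.elements, LocalMap q ρ h (K * h ^ 2) (Θ n) T (ctr T) := fun T hT =>
    hloc M h hM hh3 hh4 (φ n) (Θ n) hDn T hT (ctr T) (hctr T hT)
  have Hm : ∀ T ∈ M.elements, LocalMap q ρ h (K * h ^ 2) (Θ m) T (ctr T) := fun T hT =>
    hloc M h hM hh3 hh4 (φ m) (Θ m) hDm T hT (ctr T) (hctr T hT)
  have hlin : ∀ x ∈ M.domain, |M.linLevelSet (φ n) x - M.linLevelSet (φ m) x| ≤ δ := by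
    intro x hx
    refine abs_linLevelSet_sub_le (fun T hT V hV => ?_) hx
    rw [hnm]
    exact (hφ m (by lia) T hT V hV).trans hW
  have hstrip : M.addLayer (M.stripLayered (φ n) (Θ n) δ 1) ⊆ M.stripLayered (φ m) (Θ m) δ 2 :=
    addLayer_stripLayered_subset hlin hDn.bijOn.injOn hDm.bijOn.injOn Hn Hm
  have hfacets : M.activeFacets (φ n) (Θ n) δ 1 ⊆ M.activeFacets (φ m) (Θ m) δ 2 :=
    activeFacets_subset hlin hDn.bijOn.injOn hDm.bijOn.injOn Hn Hm
  set S := M.stripLayered (φ m) (Θ m) δ 2 with hS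
  have hSM : S ⊆ M.elements := stripLayered_subset_elements _ _ _ _
  set I : Finset (Space d) → ℝ := fun T =>
    ∫ x in Metric.closedBall (ctr T) (ρ / 2 * h), ‖gradient v x‖ ^ 2 with hI
  have hI0 : ∀ T, 0 ≤ I T := fun T => MeasureTheory.integral_nonneg fun x => sq_nonneg _
  have hsum : M.ghostPenalty k q h (φ n) (Θ n) δ 1
        (M.transfer k q h (Θ m) (Θ n) v) (M.transfer k q h (Θ m) (Θ n) v) ≤
      A * M.ghostPenalty k q h (φ m) (Θ m) δ 2 v v + B * h ^ 2 * P * ∑ T ∈ S, I T := by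
    refine sum_facets_le (N := nearPairs M ctr (4 * h)) hA.le (by positivity) hfacets
      (fun F _ => facetPenalty_self_nonneg _ _ _ _ _ _) (fun T _ => hI0 T)
      (fun T _ => card_nearPairs_le hρ hh hctr (by norm_num) T) fun F hF => ?_
    obtain ⟨⟨T₁, T₂⟩, hT, rfl⟩ := Finset.mem_image.1 hF
    obtain ⟨hT, -, hcard⟩ := Finset.mem_filter.1 hT
    obtain ⟨hT₁, hT₂⟩ := Finset.mem_product.1 hT
    have hT₁M := activeLayered_subset_elements _ _ _ _ hT₁
    have hT₂M := stripLayered_subset_elements _ _ _ _ hT₂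
    obtain ⟨⟨U, hU₁, hU₂⟩, hopp⟩ := facet_vertices (by lia) (isElement hT₁M).card_eq hcard
    refine hfac M q h (Θ m) (Θ n) ctr v T₁ T₂ _ hh hhh₁ Hm Hn hDm.vertex_fixed hDn.vertex_fixed
      hDn.bijOn.injOn hv hT₁M hT₂M ⟨U, hU₁, hU₂⟩ hopp ((Finset.filter_subset _ _).trans hSM) ?_
    rintro T hTM ⟨V, hV, hV₂⟩
    have hdist : ∀ T T' : Finset (Space d), T ∈ M.elements → T' ∈ M.elements →
        (∃ V ∈ T, V ∈ T') → dist (ctr T') (ctr T) ≤ 2 * h := by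
      rintro T T' hT hT' ⟨V, hV, hV'⟩
      have h1 := dist_le_of_mem_simplex (hM.diam_le T hT) (subset_convexHull ℝ _ hV)
        (Hm T hT).center_mem
      have h2 := dist_le_of_mem_simplex (hM.diam_le T' hT') (Hm T' hT').center_mem
        (subset_convexHull ℝ _ hV')
      linarith [dist_triangle (ctr T') V (ctr T)]
    have hd₂ := hdist T T₂ hTM hT₂M ⟨V, hV, hV₂⟩
    have hd₁ := hdist T₂ T₁ hT₂M hT₁M ⟨U, hU₂, hU₁⟩
    -- A neighbour of `T₂` is one layer beyond the new strip and therefore in the old one; applied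
    -- to `T₁` this would fail, as `T₁` is only known to be active.
    refine Finset.mem_filter.2 ⟨hstrip (mem_addLayer.2 ⟨hTM, T₂, hT₂, V, hV, hV₂⟩), ?_⟩
    refine Finset.mem_image.2 ⟨(T₁, T₂), Finset.mem_product.2
      ⟨Finset.mem_filter.2 ⟨hT₁M, ?_⟩, Finset.mem_filter.2 ⟨hT₂M, ?_⟩⟩, rfl⟩
    · linarith [dist_triangle (ctr T₁) (ctr T₂) (ctr T)]
    · linarith
  have hle := sum_setIntegral_le_stripRegion (φ := φ m) (δ := δ) (r := 2) hρ Hm hv hSM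
  refine hsum.trans ?_
  rw [show B * P * h ^ 2 = B * h ^ 2 * P by ring]
  gcongr
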